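/- Let $N\in\mathbb N$ and write $\Theta$ for the space of $C^1$ maps $\theta:\mathbb R^N\to\mathbb R^N$ such that $\theta$ and $D\theta$ are bounded, with the norm $\|\theta\|_{1,\infty}=\sup|\theta|+\sup\|D\theta\|$. For a measurable set $E\subset\mathbb R^N$ let $$P(E)=\sup\Big\{\int_E\nabla\cdot\varphi\,dx:\ \varphi\in C_c^\infty(\mathbb R^N,\mathbb R^N),\ |\varphi|\le 1\Big\}$$ be its perimeter. If $P(E)<\infty$ and $|E|<\infty$, the distribution $\nabla\chi_E$ is a bounded $\mathbb R^N$-valued measure; the reduced boundary $\partial^*E$ is the set of points $x$ with $|\nabla\chi_E|(B(x,\rho))>0$ for all $\rho>0$ at which the limit $\nu_E(x)=-\lim_{\rho\to0}\nabla\chi_E(B(x,\rho))/|\nabla\chi_E|(B(x,\rho))$ exists and has norm $1$; the unit vector $\nu_E(x)$ is the outward unit normal, and we put $\nu_E=0$ off $\partial^*E$. Let $\mathcal H^{N-1}$ be the $(N-1)$-dimensional Hausdorff measure. **Theorem.** Let $C$ be a bounded convex subset of $\mathbb R^N$ and $\mathcal P_C(\theta)=P((Id+\theta)(C))$ for $\theta\in\Theta$.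 Then $\mathcal P_C$ is finite in a neighbourhood of $0$ in $\Theta$ and Fréchet differentiable at $\theta=0$, and there exists $k>0$ such that $$\forall\xi\in\Theta,\quad |\mathcal P_C'(0)\cdot\xi|\le k\,\|\xi_{|\partial C}\cdot\nu_C\|_{L^\infty(\partial C,\mathcal H^{N-1})}.$$ Moreover there exists a bounded $\mathbb R^N$-valued Borel measure $\overrightarrow{\mathbf H}$ with support in $\partial C$ such that $$\forall\xi\in\Theta,\quad \mathcal P_C'(0)\cdot\xi=\int_{\partial C}\xi\cdot d\overrightarrow{\mathbf H},$$ and, if $C$ has non-empty interior, then $\mathcal H^{N-1}$-almost every point of $\partial C$ belongs to $\partial^*C$ and, for all $\xi\in\Theta$, the tangential divergence $\nabla_{\partial C}\cdot\xi=\nabla\cdot\xi-(D\xi\cdot\nu_C)\cdot\nu_C$ is $\mathcal H^{N-1}$-integrable on $\partial C$ and $$\mathcal P_C'(0)\cdot\xi=\int_{\partial C}\nabla_{\partial C}\cdot\xi\,d\mathcal H^{N-1}=\int_{\partial C}\xi\cdot d\overrightarrow{\mathbf H}.$$ -/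

import Mathlib

open MeasureTheory Filter Topology Set
open scoped ENNReal

noncomputable section

namespace ShapePerimeter

/-- The Euclidean space `ℝ^N`. -/
abbrev Eucl (N : ℕ) : Type := EuclideanSpace ℝ (Fin N)

/-! ### The space `Θ` of `C¹` vector fields, bounded with bounded differential -/

/-- The `C¹` vector fields `θ : ℝ^N → ℝ^N` such that `θ` and `Dθ` are bounded, as a linear subspace
of the space of all maps. -/
def thetaSubmodule (N : ℕ) : Submodule ℝ (Eucl N → Eucl N) where
  carrier := {θ | ContDiff ℝ 1 θ ∧ BddAbove (range fun x => ‖θ x‖) ∧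
    BddAbove (range fun x => ‖fderiv ℝ θ x‖)}
  zero_mem' := by
    refine ⟨contDiff_const, ⟨0, ?_⟩, ⟨0, ?_⟩⟩
    · rintro _ ⟨x, rfl⟩
      simp
    · rintro _ ⟨x, rfl⟩
      simp
  add_mem' := by
    rintro f g ⟨hf, ⟨a, ha⟩, ⟨b, hb⟩⟩ ⟨hg, ⟨c, hc⟩, ⟨d, hd⟩⟩
    refine ⟨hf.add hg, ⟨a + c, ?_⟩, ⟨b + d, ?_⟩⟩
    · rintro _ ⟨x, rfl⟩
      exact (norm_add_le _ _).trans (add_le_add (ha ⟨x, rfl⟩) (hc ⟨x, rfl⟩))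
    · rintro _ ⟨x, rfl⟩
      have h := fderiv_add (hf.differentiable one_ne_zero x) (hg.differentiable one_ne_zero x)
      simp only [h]
      exact (norm_add_le _ _).trans (add_le_add (hb ⟨x, rfl⟩) (hd ⟨x, rfl⟩))
  smul_mem' := by
    rintro r f ⟨hf, ⟨a, ha⟩, ⟨b, hb⟩⟩
    refine ⟨contDiff_const.smul hf, ⟨‖r‖ * a, ?_⟩, ⟨‖r‖ * b, ?_⟩⟩
    · rintro _ ⟨x, rfl⟩
      simp only [Pi.smul_apply, norm_smul]
      exact mul_le_mul_of_nonneg_left (ha ⟨x, rfl⟩) (norm_nonneg r)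
    · rintro _ ⟨x, rfl⟩
      have h := fderiv_const_smul (hf.differentiable one_ne_zero x) r
      simp only [h, norm_smul]
      exact mul_le_mul_of_nonneg_left (hb ⟨x, rfl⟩) (norm_nonneg r)

/-- The space `Θ` (as a type of its own, so that it does not carry the topology of pointwise
convergence). -/
def Theta (N : ℕ) : Type := thetaSubmodule N

namespace Theta

variable {N : ℕ}

instance : AddCommGroup (Theta N) := inferInstanceAs (AddCommGroup (thetaSubmodule N))

instance : Module ℝ (Theta N) := inferInstanceAs (Module ℝ (thetaSubmodule N))

instance : CoeFun (Theta N) (fun _ => Eucl N → Eucl N) := ⟨fun θ => θ.1⟩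

/-- The norm `‖θ‖_{1,∞} = sup |θ| + sup ‖Dθ‖`. -/
instance : Norm (Theta N) :=
  ⟨fun θ => (⨆ x, ‖θ x‖) + ⨆ x, ‖fderiv ℝ (θ : Eucl N → Eucl N) x‖⟩

theorem norm_def (θ : Theta N) :
    ‖θ‖ = (⨆ x, ‖θ x‖) + ⨆ x, ‖fderiv ℝ (θ : Eucl N → Eucl N) x‖ := rfl

theorem add_apply (θ η : Theta N) (x : Eucl N) : (θ + η) x = θ x + η x := rfl

theorem smul_apply (r : ℝ) (θ : Theta N) (x : Eucl N) : (r • θ) x = r • θ x := rfl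

theorem differentiableAt (θ : Theta N) (x : Eucl N) :
    DifferentiableAt ℝ (θ : Eucl N → Eucl N) x := θ.2.1.differentiable one_ne_zero x

theorem fderiv_add_apply (θ η : Theta N) (x : Eucl N) :
    fderiv ℝ (θ + η : Theta N) x = fderiv ℝ θ x + fderiv ℝ η x :=
  fderiv_add (θ.differentiableAt x) (η.differentiableAt x)

theorem fderiv_smul_apply (r : ℝ) (θ : Theta N) (x : Eucl N) :
    fderiv ℝ (r • θ : Theta N) x = r • fderiv ℝ θ x :=
  fderiv_const_smul (θ.differentiableAt x) r

theorem normedSpaceCore : NormedSpace.Core ℝ (Theta N) where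
  norm_nonneg θ :=
    add_nonneg (Real.iSup_nonneg fun _ => norm_nonneg _) (Real.iSup_nonneg fun _ => norm_nonneg _)
  norm_smul r θ := by
    simp only [norm_def, smul_apply, fderiv_smul_apply, norm_smul]
    rw [← Real.mul_iSup_of_nonneg (norm_nonneg r), ← Real.mul_iSup_of_nonneg (norm_nonneg r),
      mul_add]
  norm_triangle θ η := by
    simp only [norm_def, add_apply, fderiv_add_apply]
    have h1 : ⨆ x, ‖θ x + η x‖ ≤ (⨆ x, ‖θ x‖) + ⨆ x, ‖η x‖ :=
      ciSup_le fun x => (norm_add_le _ _).trans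
        (add_le_add (le_ciSup θ.2.2.1 x) (le_ciSup η.2.2.1 x))
    have h2 : ⨆ x, ‖fderiv ℝ θ x + fderiv ℝ η x‖ ≤
        (⨆ x, ‖fderiv ℝ θ x‖) + ⨆ x, ‖fderiv ℝ η x‖ :=
      ciSup_le fun x => (norm_add_le _ _).trans
        (add_le_add (le_ciSup θ.2.2.2 x) (le_ciSup η.2.2.2 x))
    linarith
  norm_eq_zero_iff θ := by
    constructor
    · intro h
      have h2 : 0 ≤ ⨆ x, ‖fderiv ℝ θ x‖ := Real.iSup_nonneg fun _ => norm_nonneg _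
      rw [norm_def] at h
      apply Subtype.ext
      funext x
      have h3 : ‖θ x‖ ≤ ⨆ x, ‖θ x‖ := le_ciSup θ.2.2.1 x
      exact norm_le_zero_iff.1 (by linarith)
    · rintro rfl
      have h0 : ((0 : Theta N) : Eucl N → Eucl N) = fun _ => 0 := rfl
      simp [norm_def, h0]

instance : NormedAddCommGroup (Theta N) := NormedAddCommGroup.ofCore normedSpaceCore

instance : NormedSpace ℝ (Theta N) := NormedSpace.ofCore normedSpaceCore

end Theta

/-! ### Perimeter -/

/-- The divergence `∇ · φ = ∑ᵢ ∂ᵢ φᵢ` of a vector field. -/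
def divergence {N : ℕ} (φ : Eucl N → Eucl N) (x : Eucl N) : ℝ :=
  ∑ i, (fderiv ℝ φ x (EuclideanSpace.single i 1)) i

/-- The perimeter `P(E) = sup { ∫_E ∇ · φ : φ ∈ C_c^∞(ℝ^N, ℝ^N), |φ| ≤ 1 } ∈ [0, ∞]`.
(The supremum is unchanged by `ENNReal.ofReal`, because `φ = 0` is admissible.) -/
def perimeter {N : ℕ} (E : Set (Eucl N)) : ℝ≥0∞ :=
  ⨆ (φ : Eucl N → Eucl N) (_ : ContDiff ℝ (⊤ : ℕ∞) φ) (_ : HasCompactSupport φ) (_ : ∀ x, ‖φ x‖ ≤ 1),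
    ENNReal.ofReal (∫ x in E, divergence φ x)

/-- The deformed set `E_θ = (Id + θ)(E)`. -/
def deform {N : ℕ} (E : Set (Eucl N)) (θ : Theta N) : Set (Eucl N) :=
  (fun x => x + θ x) '' E

/-- The perimeter as a function of the deformation, `θ ↦ P((Id + θ)(E))`. -/
def perimeterFunctional {N : ℕ} (E : Set (Eucl N)) (θ : Theta N) : ℝ :=
  (perimeter (deform E θ)).toReal

/-! ### The measure `∇χ_E`, the reduced boundary and the outward unit normal -/

/-- `D` is a bounded `ℝ^N`-valued measure equal to the distributional gradient of `χ_E`, that is,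
`∫_E ∇ · φ = - ∫ φ · dD` for all `φ ∈ C_c^∞(ℝ^N, ℝ^N)`. -/
def IsGradIndicator {N : ℕ} (E : Set (Eucl N)) (D : VectorMeasure (Eucl N) (Eucl N)) : Prop :=
  D.variation univ < ∞ ∧
    ∀ φ : Eucl N → Eucl N, ContDiff ℝ (⊤ : ℕ∞) φ → HasCompactSupport φ →
      ∫ x in E, divergence φ x = -D.integral φ (innerSL ℝ)

open Classical in
/-- The measure `∇χ_E` for a set `E` of finite perimeter (`0` if `∇χ_E` is not a measure). -/
def gradIndicator {N : ℕ} (E : Set (Eucl N)) : VectorMeasure (Eucl N) (Eucl N) :=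
  if h : ∃ D, IsGradIndicator E D then h.choose else 0

/-- The averages `∇χ_E(B(x,ρ)) / |∇χ_E|(B(x,ρ))`. -/
def gradQuotient {N : ℕ} (E : Set (Eucl N)) (x : Eucl N) (ρ : ℝ) : Eucl N :=
  ((gradIndicator E).variation (Metric.ball x ρ)).toReal⁻¹ • gradIndicator E (Metric.ball x ρ)

/-- The reduced boundary `∂*E`: the points `x` with `|∇χ_E|(B(x,ρ)) > 0` for all `ρ > 0` at which
`-lim_{ρ → 0} ∇χ_E(B(x,ρ)) / |∇χ_E|(B(x,ρ))` exists and is a unit vector. -/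
def reducedBoundary {N : ℕ} (E : Set (Eucl N)) : Set (Eucl N) :=
  {x | (∀ ρ > 0, 0 < (gradIndicator E).variation (Metric.ball x ρ)) ∧
    ∃ v : Eucl N, ‖v‖ = 1 ∧ Tendsto (gradQuotient E x) (𝓝[>] 0) (𝓝 (-v))}

open Classical in
/-- The outward unit normal `ν_E(x) = -lim_{ρ → 0} ∇χ_E(B(x,ρ)) / |∇χ_E|(B(x,ρ))` at the points of
the reduced boundary, extended by `0`. -/
def outerNormal {N : ℕ} (E : Set (Eucl N)) (x : Eucl N) : Eucl N :=
  if x ∈ reducedBoundary E then -limUnder (𝓝[>] 0) (gradQuotient E x) else 0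

/-- The tangential divergence `∇ · ξ - (Dξ · ν_E) · ν_E`. -/
def tangentialDivergence {N : ℕ} (E : Set (Eucl N)) (ξ : Eucl N → Eucl N) (x : Eucl N) : ℝ :=
  divergence ξ x - inner ℝ (fderiv ℝ ξ x (outerNormal E x)) (outerNormal E x)

/-- The restriction to the topological boundary `∂E` of the `(N-1)`-dimensional Hausdorff measure of
`ℝ^N`, normalized so as to be the `(N-1)`-dimensional Lebesgue measure on hyperplanes. -/
def surfaceMeasure {N : ℕ} (E : Set (Eucl N)) : Measure (Eucl N) :=
  (Measure.euclideanHausdorffMeasure (N - 1) : Measure (Eucl N)).restrict (frontier E)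

end ShapePerimeter

end

/-!
# The first variation of the perimeter at a convex set

Let `C` be a bounded convex set with interior, `g` its gauge with respect to an interior point. The
boundary `∂C` is the level set `{g = 1}`, and `g` is Lipschitz, hence differentiable almost
everywhere; being convex, it is strictly differentiable at these points, and its differential is
continuous along them. All regularity of `∂C` which is needed follows from this. Surface integrals
are written in terms of the *cone measure* of `C`, the image of `N` times the volume of `C` under the
radial projection to `∂C` (`coneMeasure`), for which the surface measure has the density `‖Dg‖`.

*The perimeter of deformed sets.* For a `C¹` homeomorphism `Ψ` with Lipschitz inverse, testing a
divergence with functions of `g ∘ Ψ⁻¹` which approximate the indicator function of `Ψ(C)` gives the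
divergence theorem `IsBody.setIntegral_divergence`, hence a formula for `P(Ψ(C))` as an integral over
the undeformed boundary (`IsBody.perimeter_image`). The area formula
`IsBody.euclideanHausdorffMeasure_image` says that the same integral is the Hausdorff measure of
`Ψ(∂C)`: near a regular point, central projection to the tangent hyperplane is nearly an isometry, and
the volumes of cones compare the Hausdorff measure of flat pieces with the cone measure.

*Differentiability.* Thus `P((Id + θ)(C)) = ∫ |det (1 + Dθ)| |(1 + Dθ)⁻ᵀ ν| dσ` for small `θ`, with
the surface measure `σ` and the normal `ν = ∇g / |∇g|`. The integrand is
`1 + ∇ · θ - (Dθ ν) · ν + o(‖Dθ‖)`, uniformly in `ν` (`exists_abs_det_mul_norm_sub_le`), so the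
derivative is the integral of the tangential divergence (`hasFDerivAt_perimeterFunctional`).

*The normal.* By the divergence theorem `∇χ_C = -ν σ` (`gradIndicator_eq`), and continuity of `ν` along
the regular points puts these into the reduced boundary, with outward normal `ν`
(`mem_reducedBoundary`, `outerNormal_eq`).

*The estimate and the curvature measure.* A field `ξ` with `ξ · ν ≥ δ > 0` enlarges `C` under
`Id + t ξ` for small `t > 0` (`eventually_closure_subset_image`), and enlarging a convex set does not
decrease its perimeter, since the projection onto it is `1`-Lipschitz (`perimeterFunctional_zero_le`).
Hence the derivative `L` is nonnegative on such fields. The field `X = x - x₀`, cut off outside `C`, is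
one of them, and comparison of `±ξ` with multiples of `X` gives the `L^∞` estimate
(`abs_le_of_nonneg_of_outward`). For an outward field `Y` the functional `f ↦ L (f Y)` is positive on
the `C¹` functions, hence a measure by the theorems of M. Riesz (extension) and Riesz–Markov; writing
the constant fields as differences of outward fields yields the vector measure
(`exists_vectorMeasure`).

A convex set without interior has volume zero, and so have its deformations: all perimeters vanish.
-/

set_option linter.unusedSectionVars false

/-! ### The gauge of a convex body -/

namespace ShapePerimeter

open scoped Pointwise

section Gauge

variable {E : Type*} [NormedAddCommGroup E] [NormedSpace ℝ E]

/-- A convex function is strictly differentiable wherever it is differentiable. -/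
theorem exists_ball_abs_sub_sub_fderiv_le {f : E → ℝ} (hf : ConvexOn ℝ univ f) {x : E}
    (hx : DifferentiableAt ℝ f x) {ε : ℝ} (hε : 0 < ε) :
    ∃ ρ > 0, ∀ y ∈ Metric.ball x ρ, ∀ z ∈ Metric.ball x ρ,
      |f y - f z - fderiv ℝ f x (y - z)| ≤ ε * ‖y - z‖ := by
  set k : E → ℝ := fun y => f y - fderiv ℝ f x y - (f x - fderiv ℝ f x x) with hk
  have hkc : ConvexOn ℝ univ k := by
    refine (hf.sub ?_).sub (concaveOn_const _ convex_univ)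
    exact (fderiv ℝ f x).toLinearMap.concaveOn convex_univ
  have h1 := hx.hasFDerivAt.isLittleO.def (show 0 < ε / 4 by positivity)
  obtain ⟨δ, hδ, hball⟩ := Metric.eventually_nhds_iff.1 h1
  have hbd : ∀ a, dist a x < δ → |k a| ≤ ε / 4 * δ := by
    intro a ha
    have h2 := hball ha
    rw [Real.norm_eq_abs] at h2
    have h3 : k a = f a - f x - fderiv ℝ f x (a - x) := by simp [hk]; ring
    rw [h3]
    refine h2.trans ?_
    gcongr
    rw [← dist_eq_norm]; exact ha.le
  have hl := (hkc.subset (subset_univ _) (convex_ball x δ)).lipschitzOnWith_of_abs_le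
    (show 0 < δ / 2 by positivity) hbd
  refine ⟨δ - δ / 2, by linarith, fun y hy z hz => ?_⟩
  have h4 := hl.dist_le_mul y hy z hz
  have h5 : 2 * (ε / 4 * δ) / (δ / 2) = ε := by field_simp; norm_num
  rw [h5, Real.coe_toNNReal _ hε.le, Real.dist_eq, dist_eq_norm] at h4
  convert h4 using 2
  simp [hk]; ring

/-- The derivative of a convex function, where it exists, is continuous. -/
theorem exists_ball_norm_fderiv_sub_le {f : E → ℝ} (hf : ConvexOn ℝ univ f) {x : E}
    (hx : DifferentiableAt ℝ f x) {ε : ℝ} (hε : 0 < ε) :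
    ∃ ρ > 0, ∀ y ∈ Metric.ball x ρ, DifferentiableAt ℝ f y →
      ‖fderiv ℝ f y - fderiv ℝ f x‖ ≤ ε := by
  obtain ⟨ρ, hρ, h⟩ := exists_ball_abs_sub_sub_fderiv_le hf hx hε
  refine ⟨ρ, hρ, fun y hy hdy => ?_⟩
  have h1 : HasFDerivAt (fun z => f z - fderiv ℝ f x z) (fderiv ℝ f y - fderiv ℝ f x) y :=
    hdy.hasFDerivAt.sub (fderiv ℝ f x).hasFDerivAt
  have h2 : LipschitzOnWith ε.toNNReal (fun z => f z - fderiv ℝ f x z) (Metric.ball x ρ) := by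
    refine LipschitzOnWith.of_dist_le_mul fun a ha b hb => ?_
    rw [Real.coe_toNNReal _ hε.le, Real.dist_eq, dist_eq_norm]
    convert h a ha b hb using 2
    simp; ring
  have h3 := h1.le_of_lipschitzOn (Metric.isOpen_ball.mem_nhds hy) h2
  rwa [Real.coe_toNNReal _ hε.le] at h3

/-- A bounded convex neighbourhood of the origin. -/
structure IsBody (K : Set E) : Prop where
  convex : Convex ℝ K
  nhds : K ∈ 𝓝 (0 : E)
  bounded : Bornology.IsBounded K

namespace IsBody

variable {K : Set E} (hK : IsBody K)
include hK

theorem absorbent : Absorbent ℝ K := absorbent_nhds_zero hK.nhds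

theorem continuous_gauge : Continuous (gauge K) := _root_.continuous_gauge hK.convex hK.nhds

theorem gauge_pos {x : E} : 0 < gauge K x ↔ x ≠ 0 :=
  _root_.gauge_pos hK.absorbent ((NormedSpace.isVonNBounded_iff ℝ).2 hK.bounded)

theorem ne_zero_of_gauge_eq_one {x : E} (hx : gauge K x = 1) : x ≠ 0 :=
  hK.gauge_pos.1 (hx ▸ one_pos)

theorem exists_lipschitzWith : ∃ L, LipschitzWith L (gauge K) :=
  hK.convex.lipschitz_gauge hK.nhds

theorem exists_norm_le : ∃ R : ℝ, 0 < R ∧ ∀ x, ‖x‖ ≤ R * gauge K x := by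
  obtain ⟨R, hR, h⟩ := hK.bounded.subset_closedBall_lt 0 0
  refine ⟨R, hR, fun x => ?_⟩
  have := le_gauge_of_subset_closedBall hK.absorbent hR.le h (x := x)
  rwa [div_le_iff₀ hR, mul_comm] at this

theorem convexOn_gauge : ConvexOn ℝ univ (gauge K) := by
  refine ⟨convex_univ, fun x _ y _ a b ha hb _ => ?_⟩
  refine (gauge_add_le hK.convex hK.absorbent _ _).trans ?_
  rw [gauge_smul_of_nonneg ha, gauge_smul_of_nonneg hb]

omit hK in
theorem fderiv_gauge_smul {t : ℝ} (ht : 0 < t) (x : E) :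
    fderiv ℝ (gauge K) (t • x) = fderiv ℝ (gauge K) x := by
  have h1 := fderiv_comp_smul (𝕜 := ℝ) (f := gauge K) (x := x) t
  have h2 : (fun y => gauge K (t • y)) = t • gauge K := by
    funext y; exact gauge_smul_of_nonneg ht.le y
  let _ := invertibleOfNonzero ht.ne'
  rw [h2, fderiv_const_smul_of_invertible] at h1
  exact (smul_right_injective _ ht.ne' h1).symm

omit hK in
/-- Euler's identity for the positively homogeneous function `gauge K`. -/
theorem fderiv_gauge_self {x : E} (hx : DifferentiableAt ℝ (gauge K) x) :
    fderiv ℝ (gauge K) x x = gauge K x := by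
  have h1 : HasDerivAt (fun t : ℝ => gauge K (t • x)) (fderiv ℝ (gauge K) x x) 1 := by
    have ha : HasDerivAt (fun t : ℝ => t • x) ((1 : ℝ) • x) 1 :=
      (hasDerivAt_id (1 : ℝ)).smul_const x
    rw [one_smul] at ha
    have hb : HasFDerivAt (gauge K) (fderiv ℝ (gauge K) x) ((1 : ℝ) • x) := by
      rw [one_smul]; exact hx.hasFDerivAt
    exact hb.comp_hasDerivAt 1 ha
  have h2 : HasDerivAt (fun t : ℝ => gauge K (t • x)) (gauge K x) 1 := by
    have h3 : HasDerivAt (fun t : ℝ => t * gauge K x) (1 * gauge K x) 1 :=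
      (hasDerivAt_id (1 : ℝ)).mul_const _
    rw [one_mul] at h3
    refine h3.congr_of_eventuallyEq ?_
    filter_upwards [lt_mem_nhds (one_pos : (0 : ℝ) < 1)] with t ht
    rw [gauge_smul_of_nonneg ht.le, smul_eq_mul]
  exact h1.unique h2

theorem fderiv_gauge_le {x : E} (hx : DifferentiableAt ℝ (gauge K) x) (y : E) :
    fderiv ℝ (gauge K) x y ≤ gauge K y := by
  have h1 : HasDerivAt (fun t : ℝ => gauge K (x + t • y)) (fderiv ℝ (gauge K) x y) 0 :=
    hx.hasFDerivAt.hasLineDerivAt y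
  refine le_of_tendsto h1.tendsto_slope_zero_right ?_
  filter_upwards [self_mem_nhdsWithin] with t (ht : 0 < t)
  rw [zero_add, zero_smul, add_zero, smul_eq_mul, inv_mul_le_iff₀ ht]
  have := gauge_add_le hK.convex hK.absorbent x (t • y)
  rw [gauge_smul_of_nonneg ht.le y, smul_eq_mul] at this
  linarith

theorem exists_norm_fderiv_le : ∃ L : ℝ, 0 ≤ L ∧ ∀ x, ‖fderiv ℝ (gauge K) x‖ ≤ L := by
  obtain ⟨L, hL⟩ := hK.exists_lipschitzWith
  exact ⟨L, L.2, fun x => norm_fderiv_le_of_lipschitz ℝ hL⟩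

omit hK in
theorem fderiv_gauge_ne_zero {x : E} (hx : DifferentiableAt ℝ (gauge K) x)
    (h1 : 0 < gauge K x) : fderiv ℝ (gauge K) x ≠ 0 := by
  intro h
  have := fderiv_gauge_self hx
  rw [h] at this
  simp at this
  linarith

theorem ae_differentiableAt [FiniteDimensional ℝ E] [MeasurableSpace E] [BorelSpace E]
    (μ : Measure E) [μ.IsAddHaarMeasure] : ∀ᵐ x ∂μ, DifferentiableAt ℝ (gauge K) x := by
  obtain ⟨L, hL⟩ := hK.exists_lipschitzWith
  exact hL.ae_differentiableAt

theorem isBounded_gauge_le (s : ℝ) : Bornology.IsBounded {x | gauge K x ≤ s} := by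
  obtain ⟨R, hR, h⟩ := hK.exists_norm_le
  refine (Metric.isBounded_closedBall (x := (0 : E)) (r := R * s)).subset fun x hx => ?_
  rw [mem_closedBall_zero_iff]
  exact (h x).trans (by gcongr; exact hx)

theorem isCompact_gauge_le [FiniteDimensional ℝ E] (s : ℝ) : IsCompact {x | gauge K x ≤ s} :=
  Metric.isCompact_of_isClosed_isBounded (isClosed_le hK.continuous_gauge continuous_const)
    (hK.isBounded_gauge_le s)

omit hK in
theorem smul_setOf_gauge_le {s : ℝ} (hs : 0 < s) :
    s • {x | gauge K x ≤ 1} = {x | gauge K x ≤ s} := by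
  ext x
  rw [mem_smul_set_iff_inv_smul_mem₀ hs.ne', mem_ofPred_eq, mem_ofPred_eq,
    gauge_smul_of_nonneg (inv_nonneg.2 hs.le), smul_eq_mul, inv_mul_le_iff₀ hs, mul_one]

end IsBody

end Gauge

end ShapePerimeter

/-! ### The cone measure of a convex body -/

namespace ShapePerimeter

open scoped Pointwise

section Cone

variable {E : Type*} [NormedAddCommGroup E] [InnerProductSpace ℝ E] [FiniteDimensional ℝ E]
  [MeasurableSpace E] [BorelSpace E] {K : Set E}

/-- The radial projection onto the boundary `{gauge K = 1}` of `K`. -/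
noncomputable def radial (K : Set E) (x : E) : E := (gauge K x)⁻¹ • x

/-- The cone measure of `K`, carried by `∂K`: a set `A ⊆ ∂K` has as mass the volume of the cone
`{t • z | z ∈ A, 0 < t ≤ 1}`, times the dimension. -/
noncomputable def coneMeasure (K : Set E) : Measure E :=
  (Module.finrank ℝ E : ℝ≥0∞) • ((volume.restrict {x | gauge K x ≤ 1}).map (radial K))

theorem radial_smul {t : ℝ} (ht : 0 < t) (x : E) : radial K (t • x) = radial K x := by
  rw [radial, radial, gauge_smul_of_nonneg ht.le, smul_eq_mul, mul_inv, smul_smul]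
  congr 1
  field_simp

theorem radial_of_gauge_eq_one {x : E} (hx : gauge K x = 1) : radial K x = x := by
  simp [radial, hx]

namespace IsBody

variable (hK : IsBody K)
include hK

theorem measurable_radial : Measurable (radial K) :=
  hK.continuous_gauge.measurable.inv.smul measurable_id

theorem gauge_radial {x : E} (hx : x ≠ 0) : gauge K (radial K x) = 1 := by
  have := hK.gauge_pos.2 hx
  rw [radial, gauge_smul_of_nonneg (inv_nonneg.2 this.le), smul_eq_mul, inv_mul_cancel₀ this.ne']

theorem fderiv_gauge_radial {x : E} (hx : x ≠ 0) :
    fderiv ℝ (gauge K) (radial K x) = fderiv ℝ (gauge K) x :=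
  fderiv_gauge_smul (inv_pos.2 (hK.gauge_pos.2 hx)) x

omit hK in
theorem differentiableAt_gauge_smul {t : ℝ} (ht : 0 < t) {x : E}
    (hx : DifferentiableAt ℝ (gauge K) x) : DifferentiableAt ℝ (gauge K) (t • x) := by
  have h1 : gauge K = fun y => t * gauge K (t⁻¹ • y) := by
    funext y
    rw [gauge_smul_of_nonneg (inv_nonneg.2 ht.le), smul_eq_mul, mul_inv_cancel_left₀ ht.ne']
  have h2 : DifferentiableAt ℝ (gauge K) (t⁻¹ • t • x) := by
    rwa [smul_smul, inv_mul_cancel₀ ht.ne', one_smul]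
  rw [h1]
  exact (DifferentiableAt.comp (t • x) h2 (differentiableAt_id.const_smul _)).const_mul t

theorem isFiniteMeasure_coneMeasure : IsFiniteMeasure (coneMeasure K) := by
  have : IsFiniteMeasure (volume.restrict {x | gauge K x ≤ 1}) :=
    ⟨by simpa using (hK.isCompact_gauge_le 1).measure_lt_top⟩
  exact Measure.smul_finite _ (ENNReal.natCast_ne_top _)

theorem measurableSet_gauge_le (s : ℝ) : MeasurableSet {x | gauge K x ≤ s} :=
  measurableSet_le hK.continuous_gauge.measurable measurable_const

theorem coneMeasure_apply {A : Set E} (hA : MeasurableSet A) :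
    coneMeasure K A = Module.finrank ℝ E * volume ({x | gauge K x ≤ 1} ∩ radial K ⁻¹' A) := by
  rw [coneMeasure, Measure.smul_apply, smul_eq_mul, Measure.map_apply hK.measurable_radial hA,
    Measure.restrict_apply (hK.measurable_radial hA), inter_comm]

theorem ae_coneMeasure_of_ae {P : E → Prop} (hP : MeasurableSet {x | P x})
    (h : ∀ᵐ x, P (radial K x)) : ∀ᵐ z ∂coneMeasure K, P z := by
  refine Measure.ae_smul_measure ?_ _
  rw [ae_map_iff hK.measurable_radial.aemeasurable hP]
  exact ae_restrict_of_ae h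

theorem ae_gauge_eq_one [Nontrivial E] : ∀ᵐ z ∂coneMeasure K, gauge K z = 1 := by
  refine hK.ae_coneMeasure_of_ae
    (measurableSet_eq_fun hK.continuous_gauge.measurable measurable_const) ?_
  filter_upwards [compl_mem_ae_iff.2 (measure_singleton (μ := (volume : Measure E)) 0)] with x hx
  exact hK.gauge_radial hx

theorem ae_coneMeasure_differentiableAt :
    ∀ᵐ z ∂coneMeasure K, DifferentiableAt ℝ (gauge K) z := by
  refine hK.ae_coneMeasure_of_ae (measurableSet_of_differentiableAt ℝ (gauge K)) ?_
  filter_upwards [hK.ae_differentiableAt volume] with x hx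
  rcases eq_or_ne x 0 with rfl | h0
  · simpa [radial] using hx
  · exact differentiableAt_gauge_smul (inv_pos.2 (hK.gauge_pos.2 h0)) hx

theorem integral_coneMeasure {F : Type*} [NormedAddCommGroup F] [NormedSpace ℝ F] {f : E → F}
    (hf : StronglyMeasurable f) :
    ∫ z, f z ∂coneMeasure K =
      (Module.finrank ℝ E : ℝ) • ∫ x in {x | gauge K x ≤ 1}, f (radial K x) := by
  rw [coneMeasure, integral_smul_measure, integral_map hK.measurable_radial.aemeasurable
    hf.aestronglyMeasurable, ENNReal.toReal_natCast]

/-- Homogeneity of the volume on the cone over a set. -/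
theorem finrank_mul_volume_gauge_le_inter {s : ℝ} (hs : 0 < s) {A : Set E}
    (hA : MeasurableSet A) :
    Module.finrank ℝ E * volume ({x | gauge K x ≤ s} ∩ radial K ⁻¹' A) =
      ENNReal.ofReal (s ^ Module.finrank ℝ E) * coneMeasure K A := by
  have h1 : {x | gauge K x ≤ s} ∩ radial K ⁻¹' A =
      s • ({x | gauge K x ≤ 1} ∩ radial K ⁻¹' A) := by
    rw [smul_set_inter₀ hs.ne', smul_setOf_gauge_le hs]
    congr 1
    ext x
    rw [mem_smul_set_iff_inv_smul_mem₀ hs.ne', mem_preimage, mem_preimage,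
      radial_smul (inv_pos.2 hs)]
  rw [h1, Measure.addHaar_smul, hK.coneMeasure_apply hA, abs_of_nonneg (by positivity)]
  ring

theorem setIntegral_gauge_le {F : Type*} [NormedAddCommGroup F] [NormedSpace ℝ F] {f : E → F}
    (hf : StronglyMeasurable f) {s : ℝ} (hs : 0 < s) :
    (Module.finrank ℝ E : ℝ) • ∫ x in {x | gauge K x ≤ s}, f (radial K x) =
      s ^ Module.finrank ℝ E • ∫ z, f z ∂coneMeasure K := by
  rw [hK.integral_coneMeasure hf, ← smul_setOf_gauge_le hs]
  have h1 := Measure.setIntegral_comp_smul (volume : Measure E) (fun x => f (radial K x))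
    {x | gauge K x ≤ 1} hs.ne'
  simp only [radial_smul hs] at h1
  rw [h1, smul_comm (s ^ _) (Module.finrank ℝ E : ℝ), smul_smul (s ^ _),
    abs_of_nonneg (by positivity), mul_inv_cancel₀ (by positivity), one_smul]

end IsBody

end Cone

end ShapePerimeter

/-! ### Deformations -/

namespace ShapePerimeter

open scoped Pointwise

section Deformation

variable {E : Type*} [NormedAddCommGroup E] [InnerProductSpace ℝ E] [FiniteDimensional ℝ E]
  [MeasurableSpace E] [BorelSpace E] {K : Set E}

/-- A `C¹` homeomorphism of the whole space with Lipschitz inverse. -/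
structure IsDeformation (Ψ : E ≃ₜ E) : Prop where
  contDiff : ContDiff ℝ 1 Ψ
  lipschitz_symm : ∃ L, LipschitzWith L Ψ.symm

/-- The transposed cofactor matrix `|det DΨ| (DΨ)⁻¹` of the differential of `Ψ`: its transpose maps
the normals of a surface, weighted by area, to those of the image of the surface under `Ψ`. -/
noncomputable def cof (Ψ : E → E) (x : E) : E →L[ℝ] E :=
  |(fderiv ℝ Ψ x).det| • (fderiv ℝ Ψ x).inverse

theorem measurable_clm_apply {F : Type*} [NormedAddCommGroup F] [NormedSpace ℝ F]
    [FiniteDimensional ℝ F] [MeasurableSpace F] [BorelSpace F] {X : Type*} [MeasurableSpace X]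
    {ℓ : X → E →L[ℝ] F} {W : X → E} (hℓ : Measurable ℓ) (hW : Measurable W) :
    Measurable fun x => ℓ x (W x) := by
  have h : Continuous fun p : (E →L[ℝ] F) × E => p.1 p.2 := isBoundedBilinearMap_apply.continuous
  exact h.measurable.comp (hℓ.prodMk hW)

namespace IsDeformation

variable {Ψ : E ≃ₜ E} (hΨ : IsDeformation Ψ)
include hΨ

theorem hasFDerivAt (x : E) : HasFDerivAt Ψ (fderiv ℝ Ψ x) x :=
  (hΨ.contDiff.differentiable one_ne_zero x).hasFDerivAt

theorem continuous_fderiv : Continuous (fderiv ℝ Ψ) := hΨ.contDiff.continuous_fderiv one_ne_zero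

theorem exists_norm_le_norm_fderiv : ∃ L : ℝ, 0 < L ∧ ∀ x v, ‖v‖ ≤ L * ‖fderiv ℝ Ψ x v‖ := by
  obtain ⟨L, hL⟩ := hΨ.lipschitz_symm
  refine ⟨L + 1, by positivity, fun x v => ?_⟩
  have h1 : HasDerivAt (fun t : ℝ => Ψ (x + t • v)) (fderiv ℝ Ψ x v) 0 :=
    (hΨ.hasFDerivAt x).hasLineDerivAt v
  have h2 := (h1.tendsto_slope_zero_right.norm.const_mul ((L : ℝ) + 1))
  refine ge_of_tendsto h2 ?_
  filter_upwards [self_mem_nhdsWithin] with t (ht : 0 < t)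
  have h3 := hL.dist_le_mul (Ψ (x + t • v)) (Ψ x)
  rw [Ψ.symm_apply_apply, Ψ.symm_apply_apply, dist_eq_norm, dist_eq_norm, add_sub_cancel_left,
    norm_smul, Real.norm_of_nonneg ht.le] at h3
  rw [zero_add, zero_smul, add_zero, norm_smul, norm_inv, Real.norm_of_nonneg ht.le]
  calc ‖v‖ = t⁻¹ * (t * ‖v‖) := by field_simp
    _ ≤ t⁻¹ * ((L + 1) * ‖Ψ (x + t • v) - Ψ x‖) := by
        refine mul_le_mul_of_nonneg_left (h3.trans ?_) (inv_pos.2 ht).le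
        gcongr
        linarith
    _ = _ := by ring

theorem isInvertible_fderiv (x : E) : (fderiv ℝ Ψ x).IsInvertible := by
  obtain ⟨L, _, hL⟩ := hΨ.exists_norm_le_norm_fderiv
  have hinj : Function.Injective (fderiv ℝ Ψ x).toLinearMap := by
    rw [injective_iff_map_eq_zero]
    intro v hv
    have := hL x v
    have hv' : fderiv ℝ Ψ x v = 0 := hv
    rw [hv', norm_zero, mul_zero] at this
    exact norm_le_zero_iff.1 this
  refine ⟨(LinearEquiv.ofInjectiveEndo _ hinj).toContinuousLinearEquiv, ?_⟩
  ext v; rfl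

theorem inverse_apply_fderiv (x v : E) : (fderiv ℝ Ψ x).inverse (fderiv ℝ Ψ x v) = v := by
  obtain ⟨e, he⟩ := hΨ.isInvertible_fderiv x
  rw [← he]; simp

theorem det_ne_zero (x : E) : (fderiv ℝ Ψ x).det ≠ 0 := by
  obtain ⟨e, he⟩ := hΨ.isInvertible_fderiv x
  rw [← he]
  exact (LinearEquiv.isUnit_det' e.toLinearEquiv).ne_zero

theorem hasFDerivAt_symm (x : E) : HasFDerivAt Ψ.symm (fderiv ℝ Ψ x).inverse (Ψ x) := by
  obtain ⟨e, he⟩ := hΨ.isInvertible_fderiv x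
  rw [← he, ContinuousLinearMap.inverse_equiv]
  refine HasFDerivAt.of_local_left_inverse Ψ.symm.continuous.continuousAt ?_
    (Eventually.of_forall fun y => Ψ.apply_symm_apply y)
  rw [Ψ.symm_apply_apply, he]
  exact hΨ.hasFDerivAt x

theorem continuous_cof : Continuous (cof Ψ) := by
  refine (ContinuousLinearMap.continuous_det.comp hΨ.continuous_fderiv).abs.smul ?_
  refine continuous_iff_continuousAt.2 fun x => ?_
  exact ContinuousAt.comp (f := fderiv ℝ Ψ)
    ((hΨ.isInvertible_fderiv x).contDiffAt_map_inverse (n := 0)).continuousAt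
    hΨ.continuous_fderiv.continuousAt

theorem integral_comp {F : Type*} [NormedAddCommGroup F] [NormedSpace ℝ F] (f : E → F) :
    ∫ y, f y = ∫ x, |(fderiv ℝ Ψ x).det| • f (Ψ x) := by
  have := integral_image_eq_integral_abs_det_fderiv_smul volume MeasurableSet.univ
    (fun x _ => (hΨ.hasFDerivAt x).hasFDerivWithinAt) Ψ.injective.injOn f
  rwa [image_univ, Ψ.surjective.range_eq, setIntegral_univ, setIntegral_univ] at this

end IsDeformation

/-! ### The divergence theorem on a deformed convex body -/

namespace IsBody

variable (hK : IsBody K)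
include hK

theorem measurable_fderiv_gauge_apply {W : E → E} (hW : Measurable W) :
    StronglyMeasurable fun x => fderiv ℝ (gauge K) x (W x) :=
  (measurable_clm_apply (measurable_fderiv ℝ _) hW).stronglyMeasurable

theorem volume_gauge_eq {s : ℝ} (hs : 0 < s) : volume {x | gauge K x = s} = 0 := by
  have h1 : {x | gauge K x = s} = s • frontier K := by
    ext x
    rw [mem_smul_set_iff_inv_smul_mem₀ hs.ne', ← gauge_eq_one_iff_mem_frontier hK.convex hK.nhds,
      mem_ofPred_eq, gauge_smul_of_nonneg (inv_nonneg.2 hs.le), smul_eq_mul,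
      inv_mul_eq_iff_eq_mul₀ hs.ne', mul_one]
  rw [h1, Measure.addHaar_smul, hK.convex.addHaar_frontier volume, mul_zero]

/-- Averages over the thin layer `{1 < gauge K ≤ 1 + ε}` around `∂K` converge to integrals against
the cone measure. -/
theorem tendsto_layer_integral [Nontrivial E] {W : E → E} (hW : Continuous W) {ε : ℕ → ℝ}
    (hε : ∀ n, 0 < ε n) (hε0 : Tendsto ε atTop (𝓝 0)) :
    Tendsto (fun n => (ε n)⁻¹ * ∫ x in {x | 1 < gauge K x ∧ gauge K x ≤ 1 + ε n},
      fderiv ℝ (gauge K) x (W x)) atTop (𝓝 (∫ z, fderiv ℝ (gauge K) z (W z) ∂coneMeasure K)) := by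
  set d := Module.finrank ℝ E with hd
  have hd0 : 0 < d := Module.finrank_pos
  have hd0' : (0 : ℝ) < d := by exact_mod_cast hd0
  have := hK.isFiniteMeasure_coneMeasure
  obtain ⟨L, hL0, hL⟩ := hK.exists_norm_fderiv_le
  obtain ⟨R, hR, hRx⟩ := hK.exists_norm_le
  set S : ℕ → Set E := fun n => {x | 1 < gauge K x ∧ gauge K x ≤ 1 + ε n} with hS
  have hSdiff : ∀ n, S n = {x | gauge K x ≤ 1 + ε n} \ {x | gauge K x ≤ 1} := by
    intro n; ext x; simp [hS, and_comm]
  have hsub : ∀ n, {x | gauge K x ≤ 1} ⊆ {x | gauge K x ≤ 1 + ε n} := fun n x hx =>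
    le_trans (show gauge K x ≤ 1 from hx) (by linarith [hε n])
  have hSm : ∀ n, MeasurableSet (S n) := fun n => by
    rw [hSdiff]; exact (hK.measurableSet_gauge_le _).diff (hK.measurableSet_gauge_le _)
  have hfin : ∀ s, volume {x | gauge K x ≤ s} ≠ ∞ := fun s =>
    (hK.isCompact_gauge_le s).measure_lt_top.ne
  have hSfin : ∀ n, volume (S n) ≠ ∞ := fun n =>
    measure_ne_top_of_subset (by rw [hSdiff]; exact sdiff_subset) (hfin (1 + ε n))
  -- the ratio of the volumes
  set c : ℕ → ℝ := fun n => (ε n)⁻¹ * (((1 + ε n) ^ d - 1) / d) with hc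
  have hc1 : Tendsto c atTop (𝓝 1) := by
    have h1 : HasDerivAt (fun t : ℝ => (1 + t) ^ d) ((d : ℝ) * (1 + 0) ^ (d - 1) * 1) 0 :=
      ((hasDerivAt_id (0 : ℝ)).const_add 1).pow d
    have h2 := h1.tendsto_slope_zero
    have h3 : Tendsto ε atTop (𝓝[≠] 0) :=
      tendsto_nhdsWithin_iff.2 ⟨hε0, Eventually.of_forall fun n => (hε n).ne'⟩
    have h4 := (h2.comp h3).div_const (d : ℝ)
    simp only [add_zero, one_pow, mul_one, div_self hd0'.ne', zero_add] at h4
    refine h4.congr fun n => ?_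
    simp [hc]; ring
  have hmain : ∀ f : E → ℝ, StronglyMeasurable f → (∃ M, ∀ x, ‖f x‖ ≤ M) → ∀ n,
      (ε n)⁻¹ * ∫ x in S n, f (radial K x) = c n * ∫ z, f z ∂coneMeasure K := by
    rintro f hf ⟨M, hM⟩ n
    have hint : IntegrableOn (fun x => f (radial K x)) {x | gauge K x ≤ 1 + ε n} :=
      Measure.integrableOn_of_bounded (hfin _)
        (hf.comp_measurable hK.measurable_radial).aestronglyMeasurable
        (Eventually.of_forall fun x => hM _)
    rw [hSdiff, setIntegral_sdiff (hK.measurableSet_gauge_le _) hint (hsub n)]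
    have e1 := hK.setIntegral_gauge_le hf (show 0 < 1 + ε n by linarith [hε n])
    have e2 := hK.setIntegral_gauge_le hf (show (0 : ℝ) < 1 by norm_num)
    rw [smul_eq_mul, smul_eq_mul, ← hd] at e1 e2
    rw [one_pow, one_mul] at e2
    simp only [hc]
    have e3 : (∫ x in {x | gauge K x ≤ 1 + ε n}, f (radial K x)) -
        ∫ x in {x | gauge K x ≤ 1}, f (radial K x) =
        (((1 + ε n) ^ d - 1) / d) * ∫ z, f z ∂coneMeasure K := by
      field_simp
      rw [sub_mul, mul_comm _ (d : ℝ), mul_comm _ (d : ℝ), e1, e2]; ring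
    rw [e3, mul_assoc]
  set f : E → ℝ := fun z => fderiv ℝ (gauge K) z (W z) with hf
  have hfm : StronglyMeasurable f := hK.measurable_fderiv_gauge_apply hW.measurable
  -- bound `W` near `∂K` by truncating outside a compact set
  have hcpt : IsCompact {x | gauge K x ≤ 2} := hK.isCompact_gauge_le 2
  obtain ⟨M, hM⟩ := hcpt.exists_bound_of_continuousOn hW.continuousOn
  have hM0 : 0 ≤ M := (norm_nonneg _).trans (hM 0 (by simp))
  set f' : E → ℝ := {x | gauge K x ≤ 2}.indicator f with hf'
  have hf'm : StronglyMeasurable f' := hfm.indicator (hK.measurableSet_gauge_le 2)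
  have hf'b : ∃ M, ∀ x, ‖f' x‖ ≤ M := by
    refine ⟨L * M, fun x => ?_⟩
    by_cases hx : gauge K x ≤ 2
    · rw [hf', indicator_of_mem (by exact hx)]
      exact (ContinuousLinearMap.le_opNorm _ _).trans (mul_le_mul (hL x) (hM x hx)
        (norm_nonneg _) hL0)
    · rw [hf', indicator_of_notMem (by exact hx), norm_zero]; positivity
  have hff' : ∫ z, f' z ∂coneMeasure K = ∫ z, f z ∂coneMeasure K := by
    refine integral_congr_ae ?_
    filter_upwards [hK.ae_gauge_eq_one] with z hz
    rw [hf', indicator_of_mem]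
    rw [mem_ofPred_eq, hz]; norm_num
  have hlim : Tendsto (fun n => (ε n)⁻¹ * ∫ x in S n, f' (radial K x)) atTop
      (𝓝 (∫ z, f z ∂coneMeasure K)) := by
    simp_rw [hmain f' hf'm hf'b, hff']
    simpa using hc1.mul_const (∫ z, f z ∂coneMeasure K)
  -- the error made by replacing `x` by its radial projection
  refine (tendsto_iff_of_dist ?_).1 hlim
  rw [Metric.tendsto_atTop]
  intro η hη
  have hvol : ∀ n, (ε n)⁻¹ * volume.real (S n) = c n * (coneMeasure K).real univ := by
    intro n
    have := hmain (fun _ => 1) stronglyMeasurable_const ⟨1, by simp⟩ n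
    simpa using this
  set T := (coneMeasure K).real univ
  have hT : 0 ≤ T := measureReal_nonneg
  have hucont := hcpt.uniformContinuousOn_of_continuous hW.continuousOn
  rw [Metric.uniformContinuousOn_iff] at hucont
  obtain ⟨δ, hδ, hWδ⟩ := hucont (η / (4 * (L + 1) * (T + 1))) (by positivity)
  have hev1 : ∀ᶠ n in atTop, c n < 2 := hc1.eventually (gt_mem_nhds (by norm_num))
  have hev2 : ∀ᶠ n in atTop, ε n < min 1 (δ / (2 * R + 1)) :=
    hε0.eventually (gt_mem_nhds (by positivity))
  obtain ⟨n₀, hn₀⟩ := eventually_atTop.1 (hev1.and hev2)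
  refine ⟨n₀, fun n hn => ?_⟩
  obtain ⟨hcn, hεn⟩ := hn₀ n hn
  have hε1 := (hεn.trans_le (min_le_left _ _)).le
  have hε2 := hεn.trans_le (min_le_right _ _)
  have hpt : ∀ x ∈ S n, ‖f' (radial K x) - f x‖ ≤ η / (4 * (T + 1)) := by
    intro x hx
    have hgx : 0 < gauge K x := one_pos.trans hx.1
    have hx0 : x ≠ 0 := hK.gauge_pos.1 hgx
    have hr1 : gauge K (radial K x) = 1 := hK.gauge_radial hx0
    have hr2 : radial K x ∈ {x | gauge K x ≤ 2} := by rw [mem_ofPred_eq, hr1]; norm_num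
    have hx2 : x ∈ {x | gauge K x ≤ 2} := by
      have := hx.2; rw [mem_ofPred_eq]; linarith
    rw [hf', indicator_of_mem hr2, hf]
    simp only
    rw [hK.fderiv_gauge_radial hx0, ← map_sub]
    have hdist : dist (radial K x) x < δ := by
      have h1 : radial K x - x = ((gauge K x)⁻¹ - 1) • x := by rw [radial, sub_smul, one_smul]
      have h2 : |(gauge K x)⁻¹ - 1| ≤ ε n := by
        rw [abs_sub_comm, abs_of_nonneg (sub_nonneg.2 (inv_le_one_of_one_le₀ hx.1.le))]
        have : 1 - (gauge K x)⁻¹ = (gauge K x - 1) * (gauge K x)⁻¹ := by field_simp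
        rw [this]
        calc _ ≤ (gauge K x - 1) * 1 := by
              gcongr
              · linarith [hx.1]
              · exact inv_le_one_of_one_le₀ hx.1.le
          _ ≤ ε n := by linarith [hx.2]
      rw [dist_eq_norm, h1, norm_smul, Real.norm_eq_abs]
      calc _ ≤ ε n * (R * 2) := by
            gcongr
            · exact (hε n).le
            · exact (hRx x).trans (by gcongr; exact hx2)
        _ ≤ ε n * (2 * R + 1) := mul_le_mul_of_nonneg_left (by linarith) (hε n).le
        _ < δ := by rwa [lt_div_iff₀ (by positivity)] at hε2
    have h3 := (hWδ _ hr2 _ hx2 hdist).le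
    rw [dist_eq_norm] at h3
    calc _ ≤ ‖fderiv ℝ (gauge K) x‖ * ‖W (radial K x) - W x‖ := ContinuousLinearMap.le_opNorm _ _
      _ ≤ (L + 1) * (η / (4 * (L + 1) * (T + 1))) := by
          gcongr; exact (hL x).trans (by linarith)
      _ = η / (4 * (T + 1)) := by field_simp
  have hi1 : IntegrableOn (fun x => f' (radial K x)) (S n) := by
    obtain ⟨M', hM'⟩ := hf'b
    exact Measure.integrableOn_of_bounded (hSfin n)
      (hf'm.comp_measurable hK.measurable_radial).aestronglyMeasurable
      (Eventually.of_forall fun x => hM' _)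
  have hi2 : IntegrableOn f (S n) := by
    refine Measure.integrableOn_of_bounded (M := L * M) (hSfin n) hfm.aestronglyMeasurable ?_
    filter_upwards [ae_restrict_mem (hSm n)] with x hx
    refine (ContinuousLinearMap.le_opNorm _ _).trans (mul_le_mul (hL x) (hM x ?_)
        (norm_nonneg _) hL0)
    have := hx.2; rw [mem_ofPred_eq]; linarith
  rw [Real.dist_eq, sub_zero, abs_of_nonneg dist_nonneg, Real.dist_eq, ← mul_sub,
    ← integral_sub hi1 hi2, abs_mul, abs_of_pos (inv_pos.2 (hε n))]
  have h5 := norm_setIntegral_le_of_norm_le_const (hSfin n).lt_top hpt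
  rw [Real.norm_eq_abs] at h5
  calc _ ≤ (ε n)⁻¹ * (η / (4 * (T + 1)) * volume.real (S n)) := by
        gcongr; exact (inv_pos.2 (hε n)).le
    _ = η / (4 * (T + 1)) * (c n * T) := by rw [← hvol n]; ring
    _ ≤ η / (4 * (T + 1)) * (2 * (T + 1)) := by gcongr; linarith
    _ = η / 2 := by field_simp; norm_num
    _ < η := by linarith

end IsBody

end Deformation

end ShapePerimeter

namespace ShapePerimeter

theorem clm_apply_eq_sum {N : ℕ} {F : Type*} [NormedAddCommGroup F] [NormedSpace ℝ F]
    (ℓ : Eucl N →L[ℝ] F) (v : Eucl N) :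
    ℓ v = ∑ i, v i • ℓ (EuclideanSpace.single i 1) := by
  conv_lhs => rw [← (EuclideanSpace.basisFun (Fin N) ℝ).sum_repr v]
  simp

theorem continuous_divergence {N : ℕ} {φ : Eucl N → Eucl N} (hφ : ContDiff ℝ 1 φ) :
    Continuous (divergence φ) := by
  refine continuous_finsetSum _ fun i _ => ?_
  exact (EuclideanSpace.proj (𝕜 := ℝ) i).continuous.comp
    ((hφ.continuous_fderiv one_ne_zero).clm_apply continuous_const)

theorem hasCompactSupport_divergence {N : ℕ} {φ : Eucl N → Eucl N} (hc : HasCompactSupport φ) :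
    HasCompactSupport (divergence φ) := by
  refine (hc.fderiv ℝ).mono' fun x hx => subset_tsupport _ ?_
  contrapose! hx
  rw [Function.notMem_support] at hx ⊢
  simp [divergence, hx]

/-- Integration by parts of a Lipschitz function against a vector field. -/
theorem integral_mul_divergence {N : ℕ} {C : NNReal} {F : Eucl N → ℝ} (hF : LipschitzWith C F)
    {φ : Eucl N → Eucl N} (hφ : ContDiff ℝ 1 φ) (hc : HasCompactSupport φ) :
    ∫ y, F y * divergence φ y = -∫ y, fderiv ℝ F y (φ y) := by
  have hφi : ∀ i, ContDiff ℝ 1 fun y => φ y i := fun i => contDiff_euclidean.1 hφ i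
  have hci : ∀ i, HasCompactSupport fun y => φ y i := fun i =>
    hc.comp_left (g := fun v : Eucl N => v i) rfl
  have hd : ∀ i y v, lineDeriv ℝ (fun y => φ y i) y v = (fderiv ℝ φ y v) i := by
    intro i y v
    have h1 : HasFDerivAt (fun y => φ y i)
        ((EuclideanSpace.proj (𝕜 := ℝ) i).comp (fderiv ℝ φ y)) y :=
      (EuclideanSpace.proj (𝕜 := ℝ) i).hasFDerivAt.comp y
        (hφ.differentiable one_ne_zero y).hasFDerivAt
    rw [h1.hasLineDerivAt v |>.lineDeriv]
    rfl
  have hI : ∀ i, ∫ y, F y * (fderiv ℝ φ y (EuclideanSpace.single i 1)) i =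
      -∫ y, φ y i * lineDeriv ℝ F y (EuclideanSpace.single i 1) := by
    intro i
    obtain ⟨D, hD⟩ := (hφi i).lipschitzWith_of_hasCompactSupport (hci i) one_ne_zero
    have := hF.integral_lineDeriv_mul_eq (μ := volume) hD (hci i) (EuclideanSpace.single i 1)
    simp_rw [hd] at this
    simp_rw [mul_comm (φ _ i), this, ← integral_neg]
    congr 1; funext y
    simp [mul_comm]
  have hint1 : ∀ i, Integrable fun y => F y * (fderiv ℝ φ y (EuclideanSpace.single i 1)) i := by
    intro i
    refine Continuous.integrable_of_hasCompactSupport (hF.continuous.mul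
      ((EuclideanSpace.proj (𝕜 := ℝ) i).continuous.comp
        ((hφ.continuous_fderiv one_ne_zero).clm_apply continuous_const))) ?_
    refine HasCompactSupport.mul_left ?_
    exact (hc.fderiv ℝ).comp_left (g := fun ℓ : Eucl N →L[ℝ] Eucl N =>
      (ℓ (EuclideanSpace.single i 1)) i) (by simp)
  have hint2 : ∀ i, Integrable fun y => φ y i * lineDeriv ℝ F y (EuclideanSpace.single i 1) :=
    fun i => (hF.locallyIntegrable_lineDeriv
      (EuclideanSpace.single i 1)).integrable_smul_left_of_hasCompactSupport
        (hφi i).continuous (hci i)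
  simp_rw [divergence, Finset.mul_sum]
  rw [integral_finsetSum _ fun i _ => hint1 i]
  simp_rw [hI, Finset.sum_neg_distrib]
  rw [← integral_finsetSum _ fun i _ => hint2 i]
  congr 1
  refine integral_congr_ae ?_
  filter_upwards [hF.ae_differentiableAt] with y hy
  rw [clm_apply_eq_sum (fderiv ℝ F y)]
  simp_rw [hy.lineDeriv_eq_fderiv, smul_eq_mul]

/-- The continuous, piecewise affine function equal to `1` on `(-∞, 1]` and to `0` on
`[1 + ε, ∞)`. -/
noncomputable def ramp (ε s : ℝ) : ℝ := max 0 (min 1 (1 - ε⁻¹ * (s - 1)))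

theorem ramp_of_le {ε s : ℝ} (hε : 0 < ε) (hs : s ≤ 1) : ramp ε s = 1 := by
  have : ε⁻¹ * (s - 1) ≤ 0 := mul_nonpos_of_nonneg_of_nonpos (inv_pos.2 hε).le (by linarith)
  rw [ramp, min_eq_left (by linarith), max_eq_right zero_le_one]

theorem ramp_of_ge {ε s : ℝ} (hε : 0 < ε) (hs : 1 + ε ≤ s) : ramp ε s = 0 := by
  have : 1 ≤ ε⁻¹ * (s - 1) := by
    rw [inv_mul_eq_div, le_div_iff₀ hε]; linarith
  rw [ramp, max_eq_left]
  exact (min_le_right _ _).trans (by linarith)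

theorem ramp_of_mem {ε s : ℝ} (hε : 0 < ε) (hs : 1 ≤ s) (hs' : s ≤ 1 + ε) :
    ramp ε s = 1 - ε⁻¹ * (s - 1) := by
  have h1 : 0 ≤ ε⁻¹ * (s - 1) := mul_nonneg (inv_pos.2 hε).le (by linarith)
  have h2 : ε⁻¹ * (s - 1) ≤ 1 := by
    rw [inv_mul_eq_div, div_le_iff₀ hε]; linarith
  rw [ramp, min_eq_right (by linarith), max_eq_right (by linarith)]

theorem ramp_mem_Icc (ε s : ℝ) : ramp ε s ∈ Icc 0 1 :=
  ⟨le_max_left _ _, max_le zero_le_one (min_le_left _ _)⟩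

theorem lipschitzWith_ramp {ε : ℝ} (hε : 0 < ε) : ∃ L, LipschitzWith L (ramp ε) := by
  have h1 : LipschitzWith (Real.toNNReal ε⁻¹) fun s : ℝ => 1 - ε⁻¹ * (s - 1) := by
    refine LipschitzWith.of_dist_le_mul fun a b => ?_
    rw [Real.coe_toNNReal _ (inv_pos.2 hε).le, Real.dist_eq, Real.dist_eq,
      show 1 - ε⁻¹ * (a - 1) - (1 - ε⁻¹ * (b - 1)) = -(ε⁻¹ * (a - b)) by ring, abs_neg, abs_mul,
      abs_of_pos (inv_pos.2 hε)]
  exact ⟨_, (h1.const_min 1).const_max 0⟩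

namespace IsBody

variable {N : ℕ} {K : Set (Eucl N)} (hK : IsBody K) {Ψ : Eucl N ≃ₜ Eucl N}
  (hΨ : IsDeformation Ψ)
include hK hΨ

theorem ae_image_eq : Ψ '' K =ᵐ[volume] {y | gauge K (Ψ.symm y) ≤ 1} := by
  have h0 : volume (Ψ '' {x | gauge K x = 1}) = 0 :=
    addHaar_image_eq_zero_of_differentiableOn_of_addHaar_eq_zero _
      (fun x _ => (hΨ.hasFDerivAt x).differentiableAt.differentiableWithinAt)
      (hK.volume_gauge_eq one_pos)
  filter_upwards [compl_mem_ae_iff.2 h0] with y hy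
  have hy1 : gauge K (Ψ.symm y) ≠ 1 := fun h => hy ⟨Ψ.symm y, h, Ψ.apply_symm_apply y⟩
  apply propext
  change y ∈ Ψ '' K ↔ gauge K (Ψ.symm y) ≤ 1
  constructor
  · rintro ⟨x, hx, rfl⟩
    rw [Ψ.symm_apply_apply]
    exact gauge_le_one_of_mem hx
  · intro h
    refine ⟨Ψ.symm y, ?_, Ψ.apply_symm_apply y⟩
    exact setOfPred_gauge_lt_one_subset_self hK.convex (mem_of_mem_nhds hK.nhds) hK.absorbent
      (lt_of_le_of_ne h hy1)

/-- The integral of a divergence over a deformed convex body, against the cone measure of the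
undeformed body. As the cofactors of a `C¹` map need not be differentiable, the divergence is not
transported to `K`; instead it is tested with Lipschitz functions which approximate the indicator
function of `Ψ(K)`. -/
theorem setIntegral_divergence [NeZero N] {φ : Eucl N → Eucl N} (hφ : ContDiff ℝ 1 φ)
    (hc : HasCompactSupport φ) :
    ∫ y in Ψ '' K, divergence φ y =
      ∫ z, fderiv ℝ (gauge K) z (cof Ψ z (φ (Ψ z))) ∂coneMeasure K := by
  have : Nontrivial (Eucl N) := inferInstance
  obtain ⟨Lg, hLg⟩ := hK.exists_lipschitzWith
  obtain ⟨LΨ, hLΨ⟩ := hΨ.lipschitz_symm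
  set ε : ℕ → ℝ := fun n => 1 / ((n : ℝ) + 1) with hεdef
  have hε : ∀ n, 0 < ε n := fun n => by positivity
  have hε0 : Tendsto ε atTop (𝓝 0) := tendsto_one_div_add_atTop_nhds_zero_nat
  set F : ℕ → Eucl N → ℝ := fun n y => ramp (ε n) (gauge K (Ψ.symm y)) with hF
  have hW : Continuous fun z => cof Ψ z (φ (Ψ z)) :=
    hΨ.continuous_cof.clm_apply (hφ.continuous.comp Ψ.continuous)
  refine tendsto_nhds_unique ?_ (hK.tendsto_layer_integral hW hε hε0)
  -- the layer integrals are the integrals of `F n * divergence φ`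
  have hkey : ∀ n, (ε n)⁻¹ * ∫ x in {x | 1 < gauge K x ∧ gauge K x ≤ 1 + ε n},
      fderiv ℝ (gauge K) x (cof Ψ x (φ (Ψ x))) = ∫ y, F n y * divergence φ y := by
    intro n
    obtain ⟨Lr, hLr⟩ := lipschitzWith_ramp (hε n)
    have hFL : LipschitzWith (Lr * (Lg * LΨ)) (F n) := hLr.comp (hLg.comp hLΨ)
    rw [integral_mul_divergence hFL hφ hc, hΨ.integral_comp, ← integral_neg,
      ← integral_const_mul, ← integral_indicator]
    swap
    · exact (measurableSet_lt measurable_const hK.continuous_gauge.measurable).inter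
        (hK.measurableSet_gauge_le _)
    refine integral_congr_ae ?_
    filter_upwards [hK.ae_differentiableAt volume,
      compl_mem_ae_iff.2 (hK.volume_gauge_eq one_pos),
      compl_mem_ae_iff.2 (hK.volume_gauge_eq (show 0 < 1 + ε n by linarith [hε n]))]
      with x hx hx1 hx2
    have hcomp : ∀ r, HasDerivAt (ramp (ε n)) r (gauge K x) →
        fderiv ℝ (F n) (Ψ x) =
          (r • fderiv ℝ (gauge K) x).comp (fderiv ℝ Ψ x).inverse := by
      intro r hr
      have h1 : HasFDerivAt (fun y => ramp (ε n) (gauge K y)) (r • fderiv ℝ (gauge K) x)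
          (Ψ.symm (Ψ x)) := by
        rw [Ψ.symm_apply_apply]; exact hr.comp_hasFDerivAt x hx.hasFDerivAt
      exact (h1.comp (Ψ x) (hΨ.hasFDerivAt_symm x)).fderiv
    have hx1' : gauge K x ≠ 1 := hx1
    have hx2' : gauge K x ≠ 1 + ε n := hx2
    rcases lt_or_gt_of_ne hx1' with h | h
    · have hr : HasDerivAt (ramp (ε n)) 0 (gauge K x) := by
        refine (hasDerivAt_const _ (1 : ℝ)).congr_of_eventuallyEq ?_
        filter_upwards [gt_mem_nhds h] with s hs using ramp_of_le (hε n) hs.le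
      rw [hcomp 0 hr, indicator_of_notMem fun h' => lt_asymm h h'.1]
      simp
    rcases lt_or_gt_of_ne hx2' with h' | h'
    · have hr : HasDerivAt (ramp (ε n)) (-(ε n)⁻¹) (gauge K x) := by
        have h2 : HasDerivAt (fun s : ℝ => 1 - (ε n)⁻¹ * (s - 1)) (-((ε n)⁻¹ * 1)) (gauge K x) :=
          (((hasDerivAt_id _).sub_const 1).const_mul (ε n)⁻¹).const_sub 1
        rw [mul_one] at h2
        refine h2.congr_of_eventuallyEq ?_
        filter_upwards [gt_mem_nhds h', lt_mem_nhds h] with s hs hs'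
          using ramp_of_mem (hε n) hs'.le hs.le
      rw [hcomp _ hr, indicator_of_mem (by exact ⟨h, h'.le⟩)]
      simp [cof]; ring
    · have hr : HasDerivAt (ramp (ε n)) 0 (gauge K x) := by
        refine (hasDerivAt_const _ (0 : ℝ)).congr_of_eventuallyEq ?_
        filter_upwards [lt_mem_nhds h'] with s hs using ramp_of_ge (hε n) hs.le
      rw [hcomp 0 hr, indicator_of_notMem fun hh => not_lt.2 hh.2 h']
      simp
  simp_rw [hkey]
  -- dominated convergence on the other side
  have hm : MeasurableSet {y | gauge K (Ψ.symm y) ≤ 1} :=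
    measurableSet_le (hK.continuous_gauge.comp Ψ.symm.continuous).measurable measurable_const
  rw [setIntegral_congr_set (hK.ae_image_eq hΨ), ← integral_indicator hm]
  refine tendsto_integral_of_dominated_convergence (fun y => ‖divergence φ y‖) ?_ ?_ ?_ ?_
  · intro n
    obtain ⟨Lr, hLr⟩ := lipschitzWith_ramp (hε n)
    exact ((hLr.continuous.comp (hK.continuous_gauge.comp Ψ.symm.continuous)).mul
      (continuous_divergence hφ)).aestronglyMeasurable
  · exact ((continuous_divergence hφ).integrable_of_hasCompactSupport
      (hasCompactSupport_divergence hc)).norm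
  · intro n
    refine Eventually.of_forall fun y => ?_
    obtain ⟨h0, h1⟩ := ramp_mem_Icc (ε n) (gauge K (Ψ.symm y))
    rw [norm_mul, Real.norm_of_nonneg h0]
    exact mul_le_of_le_one_left (norm_nonneg _) h1
  · refine Eventually.of_forall fun y => ?_
    by_cases hy : gauge K (Ψ.symm y) ≤ 1
    · rw [indicator_of_mem (by exact hy)]
      refine tendsto_const_nhds.congr fun n => ?_
      simp only [hF, ramp_of_le (hε n) hy, one_mul]
    · rw [indicator_of_notMem (by exact hy)]
      push Not at hy
      refine tendsto_const_nhds.congr' ?_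
      filter_upwards [hε0.eventually (gt_mem_nhds (sub_pos.2 hy))] with n hn
      simp only [hF]
      rw [ramp_of_ge (hε n) (by linarith), zero_mul]

end IsBody

end ShapePerimeter

/-! ### Perimeter as a total variation -/

namespace ShapePerimeter

section Density

variable {E : Type*} [NormedAddCommGroup E] [InnerProductSpace ℝ E] [FiniteDimensional ℝ E]
  [MeasurableSpace E] [BorelSpace E]

/-- The radial retraction `v ↦ v / max 1 ‖v‖` onto the unit ball at most doubles the distance to a
point of the ball. -/
theorem norm_inv_max_smul_sub_le {F : Type*} [NormedAddCommGroup F] [NormedSpace ℝ F] (u v : F)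
    (hu : ‖u‖ ≤ 1) : ‖u - (max 1 ‖v‖)⁻¹ • v‖ ≤ 2 * ‖u - v‖ := by
  have h1 : ‖v - (max 1 ‖v‖)⁻¹ • v‖ ≤ ‖u - v‖ := by
    rcases le_total ‖v‖ 1 with h | h
    · rw [max_eq_left h]; simp
    · have hv : 0 < ‖v‖ := by linarith
      rw [max_eq_right h]
      have : v - ‖v‖⁻¹ • v = (1 - ‖v‖⁻¹) • v := by rw [sub_smul, one_smul]
      rw [this, norm_smul, Real.norm_of_nonneg (sub_nonneg.2 (inv_le_one_of_one_le₀ h)), sub_mul,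
        inv_mul_cancel₀ hv.ne', one_mul]
      have := norm_sub_norm_le v u
      rw [norm_sub_rev] at this
      linarith
  have h2 := norm_add_le (u - v) (v - (max 1 ‖v‖)⁻¹ • v)
  rw [sub_add_sub_cancel] at h2
  linarith

/-- Vector fields bounded by `1` are approximated in `L¹` by test fields bounded by `1`. -/
theorem exists_testField_integral_sub_le {F : Type*} [NormedAddCommGroup F] [NormedSpace ℝ F]
    [CompleteSpace F] (μ : Measure E) [IsFiniteMeasure μ] {f : E → F} (hf : Integrable f μ)
    (hf1 : ∀ x, ‖f x‖ ≤ 1) {ε : ℝ} (hε : 0 < ε) :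
    ∃ φ : E → F, ContDiff ℝ (⊤ : ℕ∞) φ ∧ HasCompactSupport φ ∧ (∀ x, ‖φ x‖ ≤ 1) ∧
      Integrable φ μ ∧ ∫ x, ‖f x - φ x‖ ∂μ ≤ ε := by
  obtain ⟨g, hgc, hg, hgcont, -⟩ := hf.exists_hasCompactSupport_integral_sub_le
    (show 0 < ε / 4 by positivity)
  set g' : E → F := fun x => (max 1 ‖g x‖)⁻¹ • g x with hg'
  have hg'c : Continuous g' := ((continuous_const.max hgcont.norm).inv₀
    fun x => (lt_max_of_lt_left one_pos).ne').smul hgcont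
  have hg'1 : ∀ x, ‖g' x‖ ≤ 1 := fun x => by
    rw [hg', norm_smul, norm_inv, Real.norm_of_nonneg (zero_le_one.trans (le_max_left _ _)),
      inv_mul_le_iff₀ (lt_max_of_lt_left one_pos), mul_one]
    exact le_max_right _ _
  have hg's : HasCompactSupport g' := hgc.mono' fun x hx => subset_tsupport _ fun h0 => hx (by
    simp [hg', h0])
  set T := μ.real univ
  have hT : 0 ≤ T := measureReal_nonneg
  set δ := ε / (4 * (T + 1)) with hδdef
  have hδ : 0 < δ := by positivity
  obtain ⟨h, hh, hhd⟩ := (hg's.uniformContinuous_of_continuous hg'c).exists_contDiff_dist_le hδ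
  obtain ⟨R, hR, hRs⟩ := hg's.isBounded.subset_closedBall_lt 0 (0 : E)
  let χ : ContDiffBump (0 : E) := ⟨R, R + 1, hR, by linarith⟩
  have hb : ∀ x, ‖χ x • h x - g' x‖ ≤ δ := by
    intro x
    by_cases hx : x ∈ tsupport g'
    · rw [χ.one_of_mem_closedBall (hRs hx), one_smul, ← dist_eq_norm]; exact (hhd x).le
    · have h0 : g' x = 0 := image_eq_zero_of_notMem_tsupport hx
      have := hhd x
      rw [h0, dist_zero_right] at this
      rw [h0, sub_zero, norm_smul, Real.norm_of_nonneg χ.nonneg]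
      exact (mul_le_of_le_one_left (norm_nonneg _) χ.le_one).trans this.le
  have hχh : ∀ x, ‖χ x • h x‖ ≤ 1 + δ := fun x => by
    have h1 := norm_add_le (χ x • h x - g' x) (g' x)
    rw [sub_add_cancel] at h1
    linarith [hb x, hg'1 x]
  set φ : E → F := fun x => (1 + δ)⁻¹ • (χ x • h x) with hφ
  have hφs : HasCompactSupport φ :=
    (χ.hasCompactSupport.smul_right (f' := h)).smul_left (f := fun _ => (1 + δ)⁻¹)
  have hφd : ContDiff ℝ (⊤ : ℕ∞) φ := contDiff_const.smul (χ.contDiff.smul hh)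
  have hφi : Integrable φ μ := hφd.continuous.integrable_of_hasCompactSupport hφs
  refine ⟨φ, hφd, hφs, ?_, hφi, ?_⟩
  · intro x
    rw [hφ, norm_smul, norm_inv, Real.norm_of_nonneg (by positivity),
      inv_mul_le_iff₀ (by positivity), mul_one]
    exact hχh x
  · have hpt : ∀ x, ‖f x - φ x‖ ≤ 2 * ‖f x - g x‖ + 2 * δ := by
      intro x
      have h1 := norm_inv_max_smul_sub_le (f x) (g x) (hf1 x)
      have h2 : ‖χ x • h x - φ x‖ ≤ δ := by
        have : χ x • h x - φ x = (δ * (1 + δ)⁻¹) • (χ x • h x) := by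
          rw [hφ]
          nth_rewrite 1 [← one_smul ℝ (χ x • h x)]
          rw [← sub_smul]
          congr 1
          field_simp
          ring
        rw [this, norm_smul, Real.norm_of_nonneg (by positivity), mul_assoc]
        refine mul_le_of_le_one_right hδ.le ?_
        rw [inv_mul_le_iff₀ (by positivity), mul_one]
        exact hχh x
      have h3 := hb x
      rw [norm_sub_rev] at h3
      calc ‖f x - φ x‖ = ‖(f x - g' x) + (g' x - χ x • h x) + (χ x • h x - φ x)‖ := by
            congr 1; abel
        _ ≤ ‖f x - g' x‖ + ‖g' x - χ x • h x‖ + ‖χ x • h x - φ x‖ := norm_add₃_le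
        _ ≤ _ := by linarith
    have hfg : Integrable (fun x => ‖f x - g x‖) μ :=
      (hf.sub (hgcont.integrable_of_hasCompactSupport hgc)).norm
    calc ∫ x, ‖f x - φ x‖ ∂μ ≤ ∫ x, (2 * ‖f x - g x‖ + 2 * δ) ∂μ :=
          integral_mono (hf.sub hφi).norm ((hfg.const_mul 2).add (integrable_const _)) hpt
      _ = 2 * ∫ x, ‖f x - g x‖ ∂μ + T * (2 * δ) := by
          rw [integral_add (hfg.const_mul 2) (integrable_const _), integral_const_mul,
            integral_const, smul_eq_mul]
      _ ≤ 2 * (ε / 4) + (T + 1) * (2 * δ) := by gcongr; linarith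
      _ = ε := by rw [hδdef]; field_simp; ring

/-- The total mass of `|ℓ|` is approached by testing `ℓ` against fields bounded by `1`. -/
theorem exists_testField_integral_norm_sub_le (μ : Measure E) [IsFiniteMeasure μ]
    {ℓ : E → E →L[ℝ] ℝ} (hℓ : Measurable ℓ) {M : ℝ} (hM : ∀ᵐ x ∂μ, ‖ℓ x‖ ≤ M) {ε : ℝ}
    (hε : 0 < ε) :
    ∃ φ : E → E, ContDiff ℝ (⊤ : ℕ∞) φ ∧ HasCompactSupport φ ∧ (∀ x, ‖φ x‖ ≤ 1) ∧
      ∫ x, ‖ℓ x‖ ∂μ - ε ≤ ∫ x, ℓ x (φ x) ∂μ := by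
  set w : E → E := fun x => (InnerProductSpace.toDual ℝ E).symm (ℓ x) with hw
  have hwm : Measurable w :=
    (InnerProductSpace.toDual ℝ E).symm.continuous.measurable.comp hℓ
  have hwn : ∀ x, ‖w x‖ = ‖ℓ x‖ := fun x => (InnerProductSpace.toDual ℝ E).symm.norm_map _
  have hwi : ∀ x v, ℓ x v = inner ℝ (w x) v := fun x v => by
    rw [hw, InnerProductSpace.toDual_symm_apply]
  set u : E → E := fun x => ‖w x‖⁻¹ • w x with hu
  have hum : Measurable u := hwm.norm.inv.smul hwm
  have hu1 : ∀ x, ‖u x‖ ≤ 1 := fun x => by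
    rw [hu, norm_smul, norm_inv, norm_norm]; exact inv_mul_le_one
  have hui : Integrable u μ := Integrable.of_bound hum.aestronglyMeasurable 1
    (Eventually.of_forall hu1)
  have huℓ : ∀ x, ℓ x (u x) = ‖ℓ x‖ := fun x => by
    rw [hwi, hu, inner_smul_right, real_inner_self_eq_norm_sq, hwn]
    rcases eq_or_ne ‖ℓ x‖ 0 with h | h
    · simp [h]
    · field_simp
  obtain ⟨φ, hφ, hφs, hφ1, hφi, hφu⟩ := exists_testField_integral_sub_le μ hui hu1
    (show 0 < ε / (|M| + 1) by positivity)
  refine ⟨φ, hφ, hφs, hφ1, ?_⟩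
  have hint : ∀ v : E → E, Measurable v → (∀ x, ‖v x‖ ≤ 1) → Integrable (fun x => ℓ x (v x)) μ := by
    intro v hv hv1
    refine Integrable.of_bound (measurable_clm_apply hℓ hv).aestronglyMeasurable M ?_
    filter_upwards [hM] with x hx
    exact ((ℓ x).le_opNorm _).trans ((mul_le_of_le_one_right (norm_nonneg _) (hv1 x)).trans hx)
  have h1 := hint u hum hu1
  have h2 := hint φ hφ.continuous.measurable hφ1
  have h3 : ∫ x, ‖ℓ x‖ ∂μ - ∫ x, ℓ x (φ x) ∂μ ≤ ∫ x, (|M| + 1) * ‖u x - φ x‖ ∂μ := by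
    simp_rw [← huℓ]
    rw [← integral_sub h1 h2]
    refine integral_mono_ae (h1.sub h2) ((hui.sub hφi).norm.const_mul _) ?_
    filter_upwards [hM] with x hx
    rw [← map_sub]
    refine (le_abs_self _).trans (((ℓ x).le_opNorm _).trans ?_)
    gcongr
    exact hx.trans ((le_abs_self M).trans (by linarith))
  rw [integral_const_mul] at h3
  have h4 : (|M| + 1) * ∫ x, ‖u x - φ x‖ ∂μ ≤ (|M| + 1) * (ε / (|M| + 1)) := by gcongr
  rw [mul_div_cancel₀ _ (by positivity)] at h4
  linarith

end Density

section Perimeter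

variable {E : Type*} [NormedAddCommGroup E] [InnerProductSpace ℝ E] [FiniteDimensional ℝ E]
  [MeasurableSpace E] [BorelSpace E]

/-- The density of the area of the deformed boundary `Ψ(∂K)` with respect to the cone measure
of `K`. -/
noncomputable def areaDensity (K : Set E) (Ψ : E → E) (z : E) : ℝ :=
  ‖(fderiv ℝ (gauge K) z).comp (cof Ψ z)‖

theorem measurable_fderiv_gauge_comp_cof (K : Set E) {Ψ : E ≃ₜ E} (hΨ : IsDeformation Ψ) :
    Measurable fun z => (fderiv ℝ (gauge K) z).comp (cof Ψ z) := by
  have h : Continuous fun p : (E →L[ℝ] ℝ) × (E →L[ℝ] E) => p.1.comp p.2 :=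
    isBoundedBilinearMap_comp.continuous
  exact h.measurable.comp ((measurable_fderiv ℝ _).prodMk hΨ.continuous_cof.measurable)

theorem measurable_areaDensity (K : Set E) {Ψ : E ≃ₜ E} (hΨ : IsDeformation Ψ) :
    Measurable (areaDensity K Ψ) := (measurable_fderiv_gauge_comp_cof K hΨ).norm

theorem IsBody.exists_areaDensity_le [Nontrivial E] {K : Set E} (hK : IsBody K) {Ψ : E ≃ₜ E}
    (hΨ : IsDeformation Ψ) : ∃ M, ∀ᵐ z ∂coneMeasure K, areaDensity K Ψ z ≤ M := by
  obtain ⟨L, hL0, hL⟩ := hK.exists_norm_fderiv_le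
  obtain ⟨M, hM⟩ := (hK.isCompact_gauge_le 1).exists_bound_of_continuousOn
    hΨ.continuous_cof.continuousOn
  refine ⟨L * M, ?_⟩
  filter_upwards [hK.ae_gauge_eq_one] with z hz
  exact (ContinuousLinearMap.opNorm_comp_le _ _).trans
    (mul_le_mul (hL z) (hM z hz.le) (norm_nonneg _) hL0)

theorem IsBody.integrable_areaDensity [Nontrivial E] {K : Set E} (hK : IsBody K) {Ψ : E ≃ₜ E}
    (hΨ : IsDeformation Ψ) : Integrable (areaDensity K Ψ) (coneMeasure K) := by
  have := hK.isFiniteMeasure_coneMeasure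
  obtain ⟨M, hM⟩ := hK.exists_areaDensity_le hΨ
  refine Integrable.of_bound (measurable_areaDensity K hΨ).aestronglyMeasurable M ?_
  filter_upwards [hM] with z hz
  rwa [Real.norm_of_nonneg (show 0 ≤ areaDensity K Ψ z from norm_nonneg _)]

/-- The perimeter of a deformed convex body. It is the total mass of `|ℓ|` for the density
`ℓ = Dg ∘ cof Ψ` in the divergence theorem, `g` being the gauge. -/
theorem IsBody.perimeter_image {N : ℕ} [NeZero N] {K : Set (Eucl N)} (hK : IsBody K)
    {Ψ : Eucl N ≃ₜ Eucl N} (hΨ : IsDeformation Ψ) :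
    perimeter (Ψ '' K) = ENNReal.ofReal (∫ z, areaDensity K Ψ z ∂coneMeasure K) := by
  have := hK.isFiniteMeasure_coneMeasure
  have hone : ((1 : ℕ∞) : WithTop ℕ∞) ≤ ((⊤ : ℕ∞) : WithTop ℕ∞) := by exact_mod_cast le_top
  apply le_antisymm
  · refine iSup_le fun φ => iSup_le fun hφ => iSup_le fun hφc => iSup_le fun hφ1 => ?_
    rw [hK.setIntegral_divergence hΨ (hφ.of_le hone) hφc]
    refine ENNReal.ofReal_le_ofReal ((le_abs_self _).trans ?_)
    rw [← Real.norm_eq_abs]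
    refine norm_integral_le_of_norm_le (hK.integrable_areaDensity hΨ)
      (Eventually.of_forall fun z => ?_)
    exact (ContinuousLinearMap.le_opNorm ((fderiv ℝ (gauge K) z).comp (cof Ψ z)) _).trans
      (mul_le_of_le_one_right (norm_nonneg _) (hφ1 _))
  · refine ENNReal.le_of_forall_pos_le_add fun ε hε _ => ?_
    set ℓ : Eucl N → Eucl N →L[ℝ] ℝ := fun y =>
      (fderiv ℝ (gauge K) (Ψ.symm y)).comp (cof Ψ (Ψ.symm y)) with hℓ
    have hℓm : Measurable ℓ :=
      (measurable_fderiv_gauge_comp_cof K hΨ).comp Ψ.symm.continuous.measurable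
    obtain ⟨M, hM⟩ := hK.exists_areaDensity_le hΨ
    have hΨm : Measurable Ψ := Ψ.continuous.measurable
    have hM' : ∀ᵐ y ∂(coneMeasure K).map Ψ, ‖ℓ y‖ ≤ M := by
      rw [ae_map_iff hΨm.aemeasurable (measurableSet_le hℓm.norm measurable_const)]
      filter_upwards [hM] with z hz
      simpa [hℓ, areaDensity] using hz
    obtain ⟨φ, hφ, hφc, hφ1, hint⟩ := exists_testField_integral_norm_sub_le
      ((coneMeasure K).map Ψ) hℓm hM' (NNReal.coe_pos.2 hε)
    rw [integral_map hΨm.aemeasurable hℓm.norm.aestronglyMeasurable,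
      integral_map hΨm.aemeasurable
        (measurable_clm_apply hℓm hφ.continuous.measurable).aestronglyMeasurable] at hint
    simp only [hℓ, Ψ.symm_apply_apply] at hint
    have h1 := hK.setIntegral_divergence hΨ (hφ.of_le hone) hφc
    have h2 : ENNReal.ofReal (∫ x in Ψ '' K, divergence φ x) ≤ perimeter (Ψ '' K) :=
      le_iSup_of_le φ (le_iSup_of_le hφ (le_iSup_of_le hφc (le_iSup_of_le hφ1 le_rfl)))
    have h3 : ∫ z, areaDensity K Ψ z ∂coneMeasure K ≤
        (∫ x in Ψ '' K, divergence φ x) + ε := by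
      rw [h1]
      exact sub_le_iff_le_add.1 hint
    calc _ ≤ ENNReal.ofReal ((∫ x in Ψ '' K, divergence φ x) + ε) := ENNReal.ofReal_le_ofReal h3
      _ ≤ ENNReal.ofReal (∫ x in Ψ '' K, divergence φ x) + ENNReal.ofReal ε :=
          ENNReal.ofReal_add_le
      _ ≤ _ := by rw [ENNReal.ofReal_coe_nnreal]; gcongr

end Perimeter

end ShapePerimeter

/-! ### Hausdorff measure of flat pieces and of cones -/

namespace ShapePerimeter

open scoped Pointwise

section Hausdorff

variable {E : Type*} [NormedAddCommGroup E] [InnerProductSpace ℝ E] [FiniteDimensional ℝ E]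
  [MeasurableSpace E] [BorelSpace E]

theorem euclideanHausdorffMeasure_image_le {X Y : Type*} [EMetricSpace X] [EMetricSpace Y]
    [MeasurableSpace X] [BorelSpace X] [MeasurableSpace Y] [BorelSpace Y] {L : NNReal} {f : X → Y}
    {s : Set X} (h : LipschitzOnWith L f s) (m : ℕ) :
    (Measure.euclideanHausdorffMeasure m : Measure Y) (f '' s) ≤
      (L : ℝ≥0∞) ^ m * (Measure.euclideanHausdorffMeasure m : Measure X) s := by
  have := h.hausdorffMeasure_image_le (d := m) (Nat.cast_nonneg m)
  rw [Measure.euclideanHausdorffMeasure_def, Measure.euclideanHausdorffMeasure_def,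
    Measure.smul_apply, Measure.smul_apply, ENNReal.smul_def, ENNReal.smul_def, smul_eq_mul,
    smul_eq_mul, mul_left_comm]
  gcongr
  simpa using this

/-- The cone with apex `0` over a piece of a hyperplane. -/
def flatCone (ℓ : E →L[ℝ] ℝ) (B : Set E) : Set E := {y | 0 < ℓ y ∧ ℓ y ≤ 1 ∧ (ℓ y)⁻¹ • y ∈ B}

theorem measurableSet_flatCone (ℓ : E →L[ℝ] ℝ) {B : Set E} (hB : MeasurableSet B) :
    MeasurableSet (flatCone ℓ B) := by
  have hm : Measurable ℓ := ℓ.continuous.measurable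
  exact (measurableSet_lt measurable_const hm).inter ((measurableSet_le hm measurable_const).inter
    ((hm.inv.smul measurable_id) hB))

theorem lintegral_Ioc_pow_pred {d : ℕ} (hd : 0 < d) :
    (d : ℝ≥0∞) * ∫⁻ x in Ioc (0 : ℝ) 1, ENNReal.ofReal x ^ (d - 1) = 1 := by
  have h1 : ∫⁻ x in Ioc (0 : ℝ) 1, ENNReal.ofReal x ^ (d - 1) =
      ENNReal.ofReal (∫ x in Ioc (0 : ℝ) 1, x ^ (d - 1)) := by
    rw [ofReal_integral_eq_lintegral_ofReal]
    · refine setLIntegral_congr_fun measurableSet_Ioc fun x hx => ?_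
      exact (ENNReal.ofReal_pow hx.1.le _).symm
    · exact ((continuous_pow (d - 1)).integrableOn_Icc (a := (0 : ℝ)) (b := 1)).mono_set
        Ioc_subset_Icc_self
    · filter_upwards [ae_restrict_mem measurableSet_Ioc] with x hx
      exact pow_nonneg hx.1.le _
  rw [h1, ← intervalIntegral.integral_of_le zero_le_one, integral_pow, Nat.sub_add_cancel hd,
    ← ENNReal.ofReal_natCast, ← ENNReal.ofReal_mul (Nat.cast_nonneg d)]
  have : (d : ℝ) ≠ 0 := by exact_mod_cast hd.ne'
  simp [hd.ne', Nat.cast_sub hd]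

/-- The volume of a cone is its height times the area of its base, divided by the dimension; the
hyperplane `{ℓ = 1}` has distance `‖ℓ‖⁻¹` from the apex. -/
theorem finrank_mul_volume_flatCone {ℓ : E →L[ℝ] ℝ} (hℓ : ℓ ≠ 0) {B : Set E}
    (hB : MeasurableSet B) (hB1 : ∀ y ∈ B, ℓ y = 1) :
    ‖ℓ‖ₑ * (Module.finrank ℝ E * volume (flatCone ℓ B)) =
      (Measure.euclideanHausdorffMeasure (Module.finrank ℝ E - 1) : Measure E) B := by
  set w : E := (InnerProductSpace.toDual ℝ E).symm ℓ with hw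
  have hwi : ∀ y, ℓ y = inner ℝ w y := fun y => by
    rw [hw, InnerProductSpace.toDual_symm_apply]
  have hwn : ‖w‖ = ‖ℓ‖ := (InnerProductSpace.toDual ℝ E).symm.norm_map _
  have hℓ0 : ‖ℓ‖ ≠ 0 := norm_ne_zero_iff.2 hℓ
  have hw0 : w ≠ 0 := norm_ne_zero_iff.1 (hwn ▸ hℓ0)
  set v : E := (‖ℓ‖ ^ 2)⁻¹ • w with hv
  have hv0 : v ≠ 0 := smul_ne_zero (by positivity) hw0
  have hvn : ‖v‖ = ‖ℓ‖⁻¹ := by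
    rw [hv, norm_smul, hwn, norm_inv, norm_pow, norm_norm]; field_simp
  have hd : 0 < Module.finrank ℝ E := Module.finrank_pos_iff_exists_ne_zero.2 ⟨w, hw0⟩
  have hslice : ∀ x : ℝ, flatCone ℓ B ∩ AffineSubspace.mk' (x • v +ᵥ (0 : E)) (ℝ ∙ v)ᗮ =
      if x ∈ Ioc (0 : ℝ) 1 then x • B else ∅ := by
    intro x
    have hmem : ∀ y : E, y ∈ AffineSubspace.mk' (x • v +ᵥ (0 : E)) (ℝ ∙ v)ᗮ ↔ ℓ y = x := by
      intro y
      rw [AffineSubspace.mem_mk', Submodule.mem_orthogonal_singleton_iff_inner_right]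
      simp only [vadd_eq_add, add_zero, vsub_eq_sub, inner_sub_right, inner_smul_right,
        real_inner_self_eq_norm_sq, hvn]
      rw [hv, real_inner_smul_left, ← hwi]
      have : (‖ℓ‖ ^ 2)⁻¹ * ℓ y - x * ‖ℓ‖⁻¹ ^ 2 = (‖ℓ‖ ^ 2)⁻¹ * (ℓ y - x) := by
        rw [inv_pow]; ring
      rw [this, mul_eq_zero, or_iff_right (by positivity), sub_eq_zero]
    ext y
    simp only [mem_inter_iff, SetLike.mem_coe, hmem]
    split_ifs with hx
    · rw [mem_smul_set_iff_inv_smul_mem₀ hx.1.ne']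
      constructor
      · rintro ⟨⟨-, -, h⟩, h'⟩; rwa [h'] at h
      · intro h
        have h1 := hB1 _ h
        rw [map_smul, smul_eq_mul, inv_mul_eq_iff_eq_mul₀ hx.1.ne', mul_one] at h1
        refine ⟨⟨?_, ?_, ?_⟩, h1⟩ <;> rw [h1]
        exacts [hx.1, hx.2, h]
    · simp only [mem_empty_iff_false, iff_false]
      rintro ⟨⟨h1, h2, -⟩, h3⟩
      exact hx ⟨h3 ▸ h1, h3 ▸ h2⟩
  have h1 := EuclideanGeometry.euclideanHausdorffMeasure_eq_lintegral (0 : E) hv0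
    (measurableSet_flatCone ℓ hB)
  rw [InnerProductSpace.euclideanHausdorffMeasure_eq_volume] at h1
  simp_rw [hslice] at h1
  have h2 : ∀ x : ℝ, (Measure.euclideanHausdorffMeasure (Module.finrank ℝ E - 1) : Measure E)
      (if x ∈ Ioc (0 : ℝ) 1 then x • B else ∅) =
      (Ioc (0 : ℝ) 1).indicator (fun x => ENNReal.ofReal x ^ (Module.finrank ℝ E - 1) *
        (Measure.euclideanHausdorffMeasure (Module.finrank ℝ E - 1) : Measure E) B) x := by
    intro x
    by_cases hx : x ∈ Ioc (0 : ℝ) 1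
    · rw [if_pos hx, indicator_of_mem hx, Measure.euclideanHausdorffMeasure_smul₀ _ hx.1.ne',
        ENNReal.smul_def, smul_eq_mul, ENNReal.coe_pow, ← enorm_eq_nnnorm,
        Real.enorm_of_nonneg hx.1.le]
    · rw [if_neg hx, indicator_of_notMem hx, measure_empty]
  simp_rw [h2] at h1
  rw [lintegral_indicator measurableSet_Ioc, lintegral_mul_const _ (by fun_prop)] at h1
  have h3 : ‖ℓ‖ₑ * ‖v‖ₑ = 1 := by
    rw [← enorm_norm v, hvn, enorm_inv (by simpa using hℓ0), enorm_norm]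
    refine ENNReal.mul_inv_cancel ?_ (by simp)
    rw [← ofReal_norm]
    exact (ENNReal.ofReal_pos.2 (norm_pos_iff.2 hℓ)).ne'
  rw [h1]
  calc _ = (‖ℓ‖ₑ * ‖v‖ₑ) * (Module.finrank ℝ E *
        ∫⁻ x in Ioc (0 : ℝ) 1, ENNReal.ofReal x ^ (Module.finrank ℝ E - 1)) *
        (Measure.euclideanHausdorffMeasure (Module.finrank ℝ E - 1) : Measure E) B := by ring
    _ = _ := by rw [h3, lintegral_Ioc_pow_pred hd, one_mul, one_mul]

/-- The area of a linear image of a flat piece, in terms of the cone over that piece. -/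
theorem euclideanHausdorffMeasure_image_flat {ℓ : E →L[ℝ] ℝ} (hℓ : ℓ ≠ 0) {B : Set E}
    (hB : MeasurableSet B) (hB1 : ∀ y ∈ B, ℓ y = 1) (M : E ≃L[ℝ] E) :
    (Measure.euclideanHausdorffMeasure (Module.finrank ℝ E - 1) : Measure E) (M '' B) =
      ENNReal.ofReal (|(M : E →L[ℝ] E).det| * ‖ℓ.comp (M.symm : E →L[ℝ] E)‖) *
        (Module.finrank ℝ E * volume (flatCone ℓ B)) := by
  have hMB : MeasurableSet (M '' B) := M.toHomeomorph.measurableEmbedding.measurableSet_image.2 hB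
  have hne : ℓ.comp (M.symm : E →L[ℝ] E) ≠ 0 := by
    intro h
    apply hℓ
    ext y
    have := DFunLike.congr_fun h (M y)
    simpa using this
  rw [← finrank_mul_volume_flatCone hne hMB]
  · have hc : flatCone (ℓ.comp (M.symm : E →L[ℝ] E)) (M '' B) = (M : E →L[ℝ] E) '' flatCone ℓ B := by
      ext y
      constructor
      · rintro ⟨h1, h2, h3⟩
        refine ⟨M.symm y, ⟨h1, h2, ?_⟩, by simp⟩
        obtain ⟨b, hb, hb'⟩ := h3
        have : M.symm (M b) = M.symm _ := congrArg M.symm hb'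
        rw [M.symm_apply_apply, map_smul] at this
        have h' : (ℓ (M.symm y))⁻¹ • M.symm y = b := this.symm
        rw [h']; exact hb
      · rintro ⟨z, ⟨h1, h2, h3⟩, rfl⟩
        refine ⟨by simpa using h1, by simpa using h2, ⟨_, h3, by simp⟩⟩
    rw [hc, Measure.addHaar_image_continuousLinearMap, ENNReal.ofReal_mul (abs_nonneg _),
      ofReal_norm]
    ring
  · rintro _ ⟨b, hb, rfl⟩
    simpa using hB1 b hb

end Hausdorff

/-! ### Central projection of the boundary to a hyperplane -/

section Central

variable {E : Type*} [NormedAddCommGroup E] [InnerProductSpace ℝ E] [FiniteDimensional ℝ E]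
  [MeasurableSpace E] [BorelSpace E] {K : Set E}

/-- The image of `A ⊆ ∂K` under the central projection to the hyperplane `{ℓ = 1}`. -/
def flatShadow (K : Set E) (ℓ : E →L[ℝ] ℝ) (A : Set E) : Set E := {w | ℓ w = 1 ∧ radial K w ∈ A}

namespace IsBody

variable (hK : IsBody K)
include hK

theorem measurableSet_flatShadow (ℓ : E →L[ℝ] ℝ) {A : Set E} (hA : MeasurableSet A) :
    MeasurableSet (flatShadow K ℓ A) :=
  (measurableSet_eq_fun ℓ.continuous.measurable measurable_const).inter (hK.measurable_radial hA)

theorem image_flatShadow {ℓ : E →L[ℝ] ℝ} {A : Set E} (hA : ∀ z ∈ A, gauge K z = 1 ∧ 0 < ℓ z) :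
    (fun z => (ℓ z)⁻¹ • z) '' A = flatShadow K ℓ A := by
  ext w
  constructor
  · rintro ⟨z, hz, rfl⟩
    obtain ⟨h1, h2⟩ := hA z hz
    refine ⟨?_, ?_⟩
    · simp only [map_smul, smul_eq_mul]; exact inv_mul_cancel₀ h2.ne'
    · change radial K ((ℓ z)⁻¹ • z) ∈ A
      rw [radial_smul (inv_pos.2 h2), radial_of_gauge_eq_one h1]; exact hz
  · rintro ⟨h1, h2⟩
    refine ⟨radial K w, h2, ?_⟩
    have hw0 : w ≠ 0 := by rintro rfl; simp at h1
    have := hK.gauge_pos.2 hw0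
    simp only [radial, map_smul, smul_eq_mul, h1, mul_one, inv_inv, smul_smul]
    rw [mul_inv_cancel₀ this.ne', one_smul]

theorem radial_image_flatShadow {ℓ : E →L[ℝ] ℝ} {A : Set E}
    (hA : ∀ z ∈ A, gauge K z = 1 ∧ 0 < ℓ z) : radial K '' flatShadow K ℓ A = A := by
  rw [← hK.image_flatShadow hA, image_image]
  ext z
  constructor
  · rintro ⟨z, hz, rfl⟩
    obtain ⟨h1, h2⟩ := hA z hz
    change radial K ((ℓ z)⁻¹ • z) ∈ A
    rw [radial_smul (inv_pos.2 h2), radial_of_gauge_eq_one h1]; exact hz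
  · intro hz
    obtain ⟨h1, h2⟩ := hA z hz
    refine ⟨z, hz, ?_⟩
    change radial K ((ℓ z)⁻¹ • z) = z
    rw [radial_smul (inv_pos.2 h2), radial_of_gauge_eq_one h1]

theorem eq_gauge_smul_radial (y : E) : y = gauge K y • radial K y := by
  rcases eq_or_ne y 0 with rfl | h
  · simp [radial]
  · rw [radial, smul_smul, mul_inv_cancel₀ (hK.gauge_pos.2 h).ne', one_smul]

/-- If `A ⊆ ∂K` stays close to the hyperplane `{ℓ = 1}`, then the cones over `A` and over its
central projection to that hyperplane have about the same volume. -/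
theorem volume_flatCone_flatShadow {ℓ : E →L[ℝ] ℝ} {A : Set E} (hAm : MeasurableSet A) {c : ℝ}
    (hc : 0 < c) (hA : ∀ z ∈ A, gauge K z = 1 ∧ c⁻¹ ≤ ℓ z ∧ ℓ z ≤ c) :
    Module.finrank ℝ E * volume (flatCone ℓ (flatShadow K ℓ A)) ≤
        ENNReal.ofReal (c ^ Module.finrank ℝ E) * coneMeasure K A ∧
      coneMeasure K A ≤ ENNReal.ofReal (c ^ Module.finrank ℝ E) *
        (Module.finrank ℝ E * volume (flatCone ℓ (flatShadow K ℓ A))) := by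
  have hc' : 0 < c⁻¹ := inv_pos.2 hc
  have hy0 : ∀ y, radial K y ∈ A → 0 < gauge K y := by
    intro y hy
    rw [hK.gauge_pos]
    rintro rfl
    have := (hA _ hy).1
    simp [radial] at this
  have hyl : ∀ y, ℓ y = gauge K y * ℓ (radial K y) := by
    intro y
    conv_lhs => rw [hK.eq_gauge_smul_radial y]
    simp
  constructor
  · rw [← hK.finrank_mul_volume_gauge_le_inter hc hAm]
    gcongr
    rintro y ⟨h1, h2, h3, h4⟩
    rw [radial_smul (inv_pos.2 h1)] at h4
    refine ⟨?_, h4⟩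
    obtain ⟨-, h5, -⟩ := hA _ h4
    rw [hyl] at h2
    have h6 : gauge K y * c⁻¹ ≤ 1 :=
      (mul_le_mul_of_nonneg_left h5 (gauge_nonneg _)).trans h2
    rw [mem_ofPred_eq]
    rwa [← div_eq_mul_inv, div_le_one hc] at h6
  · have h1 : Module.finrank ℝ E * volume ({x | gauge K x ≤ c⁻¹} ∩ radial K ⁻¹' A) ≤
        Module.finrank ℝ E * volume (flatCone ℓ (flatShadow K ℓ A)) := by
      gcongr
      rintro y ⟨h1, h2⟩
      have h2' : radial K y ∈ A := h2
      obtain ⟨-, h5, h6⟩ := hA _ h2'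
      have h7 : 0 < ℓ y := by rw [hyl]; exact mul_pos (hy0 y h2) (hc'.trans_le h5)
      refine ⟨h7, ?_, ?_, ?_⟩
      · rw [hyl]
        calc _ ≤ c⁻¹ * c := mul_le_mul h1 h6 (hc'.le.trans h5) hc'.le
          _ = 1 := inv_mul_cancel₀ hc.ne'
      · rw [map_smul, smul_eq_mul, inv_mul_cancel₀ h7.ne']
      · rw [radial_smul (inv_pos.2 h7)]; exact h2
    rw [hK.finrank_mul_volume_gauge_le_inter hc' hAm] at h1
    calc coneMeasure K A = ENNReal.ofReal (c ^ Module.finrank ℝ E) *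
          (ENNReal.ofReal (c⁻¹ ^ Module.finrank ℝ E) * coneMeasure K A) := by
          rw [← mul_assoc, ← ENNReal.ofReal_mul (by positivity), ← mul_pow, mul_inv_cancel₀ hc.ne',
            one_pow, ENNReal.ofReal_one, one_mul]
      _ ≤ _ := by gcongr

end IsBody

end Central

end ShapePerimeter

/-! ### The area formula for the deformed boundary -/

namespace ShapePerimeter

section Localization

variable {X : Type*} [PseudoMetricSpace X] [SecondCountableTopology X] [MeasurableSpace X]
  [OpensMeasurableSpace X]

/-- An inequality between measures is a local property. -/
theorem measure_le_of_locally {μ ν : Measure X} {c : ℝ≥0∞} {S : Set X}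
    (h : ∀ x ∈ S, ∃ ρ > 0, ∀ A, MeasurableSet A → A ⊆ Metric.ball x ρ ∩ S → μ A ≤ c * ν A)
    {A : Set X} (hA : MeasurableSet A) (hAS : A ⊆ S) : μ A ≤ c * ν A := by
  choose! ρ hρ hle using h
  obtain ⟨t, htS, htc, ht⟩ := TopologicalSpace.countable_cover_nhdsWithin
    (s := S) (f := fun x => Metric.ball x (ρ x))
    fun x hx => mem_nhdsWithin_of_mem_nhds (Metric.ball_mem_nhds x (hρ x hx))
  rcases t.eq_empty_or_nonempty with rfl | hne
  · have : A = ∅ := by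
      rw [← subset_empty_iff]; simpa using hAS.trans ht
    simp [this]
  obtain ⟨e, rfl⟩ := htc.exists_eq_range hne
  set B : ℕ → Set X := disjointed fun n => Metric.ball (e n) (ρ (e n)) with hB
  have hBm : ∀ n, MeasurableSet (B n) := fun n =>
    MeasurableSet.disjointed (fun _ => measurableSet_ball) n
  have hBd : Pairwise (Function.onFun Disjoint fun n => A ∩ B n) := fun i j hij =>
    (disjoint_disjointed _ hij).mono inter_subset_right inter_subset_right
  have hAB : A = ⋃ n, A ∩ B n := by
    rw [← inter_iUnion, hB, iUnion_disjointed, eq_comm, inter_eq_left]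
    intro x hx
    simpa using ht (hAS hx)
  calc μ A = ∑' n, μ (A ∩ B n) := by
        conv_lhs => rw [hAB]
        exact measure_iUnion hBd fun n => hA.inter (hBm n)
    _ ≤ ∑' n, c * ν (A ∩ B n) := by
        refine ENNReal.tsum_le_tsum fun n => hle _ (htS ⟨n, rfl⟩) _ (hA.inter (hBm n)) ?_
        exact fun x hx => ⟨disjointed_subset (fun n => Metric.ball (e n) (ρ (e n))) n hx.2, hAS hx.1⟩
    _ = c * ν A := by
        rw [ENNReal.tsum_mul_left, ← measure_iUnion hBd fun n => hA.inter (hBm n), ← hAB]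

/-- If `μ ≤ c • ν` holds locally for every `c > 1`, then `μ ≤ ν`. -/
theorem measure_le_of_locally_le {μ ν : Measure X} {S : Set X}
    (h : ∀ c : ℝ, 1 < c → ∀ x ∈ S, ∃ ρ > 0, ∀ A, MeasurableSet A → A ⊆ Metric.ball x ρ ∩ S →
      μ A ≤ ENNReal.ofReal c * ν A)
    {A : Set X} (hA : MeasurableSet A) (hAS : A ⊆ S) : μ A ≤ ν A := by
  have h1 : Tendsto (fun c : ℝ => ENNReal.ofReal c * ν A) (𝓝[>] 1) (𝓝 (1 * ν A)) := by
    refine ENNReal.Tendsto.mul_const ?_ (Or.inl one_ne_zero)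
    have := (ENNReal.continuous_ofReal.tendsto 1).mono_left (nhdsWithin_le_nhds (s := Ioi 1))
    rwa [ENNReal.ofReal_one] at this
  rw [one_mul] at h1
  refine ge_of_tendsto h1 ?_
  filter_upwards [self_mem_nhdsWithin] with c hc
  exact measure_le_of_locally (h c hc) hA hAS

end Localization

section Area

variable {E : Type*} [NormedAddCommGroup E] [InnerProductSpace ℝ E] [FiniteDimensional ℝ E]
  [MeasurableSpace E] [BorelSpace E] {K : Set E}

/-- Central projection to a hyperplane `{ℓ = 1}` is nearly an isometry on sets which are nearly
contained in this hyperplane. -/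
theorem norm_inv_smul_sub_sub_le {ℓ : E →L[ℝ] ℝ} {z z' : E} {τ R : ℝ} (hτ0 : 0 ≤ τ)
    (hτ : τ ≤ 1 / 2) (hz : |ℓ z - 1| ≤ τ) (hz' : |ℓ z' - 1| ≤ τ)
    (hzz : |ℓ (z - z')| ≤ τ * ‖z - z'‖) (hR : ‖z'‖ ≤ R) :
    ‖((ℓ z)⁻¹ • z - (ℓ z')⁻¹ • z') - (z - z')‖ ≤ (2 + 4 * R) * τ * ‖z - z'‖ := by
  have h1 : 1 / 2 ≤ ℓ z := by have := (abs_le.1 hz).1; linarith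
  have h2 : 1 / 2 ≤ ℓ z' := by have := (abs_le.1 hz').1; linarith
  have e : ((ℓ z)⁻¹ • z - (ℓ z')⁻¹ • z') - (z - z') =
      ((ℓ z)⁻¹ - 1) • (z - z') + ((ℓ z)⁻¹ - (ℓ z')⁻¹) • z' := by
    module
  have i1 : (ℓ z)⁻¹ ≤ 2 := by
    rw [inv_le_comm₀ (by linarith) two_pos]; linarith
  have i2 : (ℓ z')⁻¹ ≤ 2 := by
    rw [inv_le_comm₀ (by linarith) two_pos]; linarith
  have p1 : 0 ≤ (ℓ z)⁻¹ := inv_nonneg.2 (by linarith)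
  have p2 : 0 ≤ (ℓ z')⁻¹ := inv_nonneg.2 (by linarith)
  have j1 : |(ℓ z)⁻¹ - 1| ≤ 2 * τ := by
    have : (ℓ z)⁻¹ - 1 = (ℓ z)⁻¹ * (1 - ℓ z) := by
      rw [mul_sub, mul_one, inv_mul_cancel₀ (by linarith)]
    rw [this, abs_mul, abs_of_nonneg p1, abs_sub_comm]
    exact mul_le_mul i1 hz (abs_nonneg _) zero_le_two
  have j2 : |(ℓ z)⁻¹ - (ℓ z')⁻¹| ≤ 4 * (τ * ‖z - z'‖) := by
    have : (ℓ z)⁻¹ - (ℓ z')⁻¹ = (ℓ z)⁻¹ * (ℓ z')⁻¹ * (ℓ z' - ℓ z) := by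
      have a1 : ℓ z ≠ 0 := by linarith
      have a2 : ℓ z' ≠ 0 := by linarith
      field_simp
    rw [this, abs_mul, abs_of_nonneg (mul_nonneg p1 p2), abs_sub_comm, ← map_sub]
    exact mul_le_mul (by nlinarith) hzz (abs_nonneg _) (by norm_num)
  rw [e]
  refine (norm_add_le _ _).trans ?_
  rw [norm_smul, norm_smul, Real.norm_eq_abs, Real.norm_eq_abs]
  have k1 := mul_le_mul_of_nonneg_right j1 (norm_nonneg (z - z'))
  have k2 := mul_le_mul j2 hR (norm_nonneg _) (by positivity)
  nlinarith

namespace IsBody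

variable (hK : IsBody K) {Ψ : E ≃ₜ E} (hΨ : IsDeformation Ψ)
include hK hΨ

theorem areaDensity_pos {x : E} (hx1 : gauge K x = 1) (hx : DifferentiableAt ℝ (gauge K) x) :
    0 < areaDensity K Ψ x := by
  rw [areaDensity, norm_pos_iff]
  intro h
  have h1 := DFunLike.congr_fun h (fderiv ℝ Ψ x x)
  simp only [cof, ContinuousLinearMap.comp_apply, _root_.smul_apply,
    hΨ.inverse_apply_fderiv, map_smul, fderiv_gauge_self hx, hx1, _root_.zero_apply,
    smul_eq_mul, mul_one, abs_eq_zero] at h1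
  exact hΨ.det_ne_zero x h1

theorem exists_ball_areaDensity {x : E} (hx1 : gauge K x = 1)
    (hx : DifferentiableAt ℝ (gauge K) x) {c : ℝ} (hc : 1 < c) :
    ∃ ρ > 0, ∀ z ∈ Metric.ball x ρ, DifferentiableAt ℝ (gauge K) z →
      areaDensity K Ψ z ≤ c * areaDensity K Ψ x ∧ areaDensity K Ψ x ≤ c * areaDensity K Ψ z := by
  have hpos := hK.areaDensity_pos hΨ hx1 hx
  set D : Set E := {z | DifferentiableAt ℝ (gauge K) z} with hD
  have h1 : ContinuousWithinAt (fderiv ℝ (gauge K)) D x := by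
    rw [Metric.continuousWithinAt_iff]
    intro ε hε
    obtain ⟨ρ, hρ, h⟩ := exists_ball_norm_fderiv_sub_le hK.convexOn_gauge hx (half_pos hε)
    refine ⟨ρ, hρ, fun {y} hy hyx => ?_⟩
    rw [dist_eq_norm]
    exact (h y hyx hy).trans_lt (half_lt_self hε)
  have h2 : ContinuousWithinAt (areaDensity K Ψ) D x :=
    (h1.clm_comp hΨ.continuous_cof.continuousWithinAt).norm
  have h3 : ∀ᶠ z in 𝓝[D] x, areaDensity K Ψ z < c * areaDensity K Ψ x :=
    h2.eventually (gt_mem_nhds (by nlinarith))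
  have h4 : ∀ᶠ z in 𝓝[D] x, areaDensity K Ψ x < c * areaDensity K Ψ z :=
    (h2.const_mul c).eventually (lt_mem_nhds (by nlinarith))
  have h5 := h3.and h4
  rw [eventually_nhdsWithin_iff, Metric.eventually_nhds_iff_ball] at h5
  obtain ⟨ρ, hρ, h⟩ := h5
  exact ⟨ρ, hρ, fun z hz hdz => ⟨(h z hz hdz).1.le, (h z hz hdz).2.le⟩⟩

/-- Near a point of `∂K` where the gauge is differentiable, the composition of the central
projection to the tangent hyperplane with the differential of `Ψ` is nearly isometric to `Ψ`. -/
theorem exists_ball_flat {x : E} (hx1 : gauge K x = 1)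
    (hx : DifferentiableAt ℝ (gauge K) x) {c : ℝ} (hc : 1 < c) :
    ∃ ρ > 0, (∀ z ∈ Metric.ball x ρ, gauge K z = 1 →
        c⁻¹ ≤ fderiv ℝ (gauge K) x z ∧ fderiv ℝ (gauge K) x z ≤ c) ∧
      ∀ z ∈ Metric.ball x ρ, ∀ z' ∈ Metric.ball x ρ, gauge K z = 1 → gauge K z' = 1 →
        ‖fderiv ℝ Ψ x ((fderiv ℝ (gauge K) x z)⁻¹ • z) -
            fderiv ℝ Ψ x ((fderiv ℝ (gauge K) x z')⁻¹ • z')‖ ≤ c * ‖Ψ z - Ψ z'‖ ∧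
        ‖Ψ z - Ψ z'‖ ≤ c * ‖fderiv ℝ Ψ x ((fderiv ℝ (gauge K) x z)⁻¹ • z) -
            fderiv ℝ Ψ x ((fderiv ℝ (gauge K) x z')⁻¹ • z')‖ := by
  set ℓ := fderiv ℝ (gauge K) x with hℓ
  set M := fderiv ℝ Ψ x with hM
  obtain ⟨L, hL⟩ := hΨ.lipschitz_symm
  have hℓx : ℓ x = 1 := by rw [hℓ, fderiv_gauge_self hx, hx1]
  -- an error `τ * ‖z - z'‖` in the two linear approximations costs at most `τ * T * ‖Ψ z - Ψ z'‖`
  set T : ℝ := (‖M‖ * (2 + 4 * (‖x‖ + 1)) + 1) * L + 1 with hT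
  have hT1 : 1 ≤ T := by rw [hT]; have := L.2; linarith [show 0 ≤ (‖M‖ * (2 + 4 * (‖x‖ + 1)) + 1) * L by positivity]
  have hc0 : 0 < c := by linarith
  have hci : c⁻¹ < 1 := inv_lt_one_of_one_lt₀ hc
  set τ : ℝ := min (1 / 2) ((1 - c⁻¹) / T) with hτ
  have hτ0 : 0 < τ := lt_min (by norm_num) (div_pos (by linarith) (by linarith))
  have hτ2 : τ ≤ 1 / 2 := min_le_left _ _
  have hτT : τ * T ≤ 1 - c⁻¹ := by
    rw [← le_div_iff₀ (by linarith)]; exact min_le_right _ _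
  have hcc : 1 - c⁻¹ ≤ c - 1 := by
    have : c * c⁻¹ = 1 := mul_inv_cancel₀ hc0.ne'
    nlinarith
  have hττ : τ ≤ 1 - c⁻¹ := by nlinarith
  obtain ⟨ρ₁, hρ₁, h₁⟩ := exists_ball_abs_sub_sub_fderiv_le hK.convexOn_gauge hx hτ0
  have hstrict : HasStrictFDerivAt Ψ M x :=
    hΨ.contDiff.contDiffAt.hasStrictFDerivAt one_ne_zero
  obtain ⟨ρ₂, hρ₂, h₂⟩ : ∃ ρ > 0, ∀ z ∈ Metric.ball x ρ, ∀ z' ∈ Metric.ball x ρ,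
      ‖Ψ z - Ψ z' - M (z - z')‖ ≤ τ * ‖z - z'‖ := by
    have := hstrict.isLittleO.def hτ0
    rw [nhds_prod_eq, Filter.eventually_iff, Filter.mem_prod_same_iff] at this
    obtain ⟨t, ht, h⟩ := this
    obtain ⟨ρ, hρ, hρt⟩ := Metric.mem_nhds_iff.1 ht
    exact ⟨ρ, hρ, fun z hz z' hz' => h (mk_mem_prod (hρt hz) (hρt hz'))⟩
  set ρ := min 1 (min ρ₁ ρ₂) with hρ
  have hρ1 : ρ ≤ 1 := min_le_left _ _
  have hsub₁ : Metric.ball x ρ ⊆ Metric.ball x ρ₁ :=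
    Metric.ball_subset_ball ((min_le_right _ _).trans (min_le_left _ _))
  have hsub₂ : Metric.ball x ρ ⊆ Metric.ball x ρ₂ :=
    Metric.ball_subset_ball ((min_le_right _ _).trans (min_le_right _ _))
  have hρ0 : 0 < ρ := lt_min one_pos (lt_min hρ₁ hρ₂)
  have hd : ∀ z ∈ Metric.ball x ρ, ∀ z' ∈ Metric.ball x ρ, gauge K z = 1 → gauge K z' = 1 →
      |ℓ (z - z')| ≤ τ * ‖z - z'‖ := by
    intro z hz z' hz' e e'
    have := h₁ z (hsub₁ hz) z' (hsub₁ hz')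
    rwa [e, e', sub_self, zero_sub, abs_neg] at this
  have hone : ∀ z ∈ Metric.ball x ρ, gauge K z = 1 → |ℓ z - 1| ≤ τ := by
    intro z hz e
    have := hd z hz x (Metric.mem_ball_self hρ0) e hx1
    rw [map_sub, hℓx] at this
    refine this.trans ?_
    have h3 : ‖z - x‖ ≤ 1 := by rw [← dist_eq_norm]; exact (Metric.mem_ball.1 hz).le.trans hρ1
    nlinarith
  refine ⟨ρ, hρ0, fun z hz e => ?_, fun z hz z' hz' e e' => ?_⟩
  · have := abs_le.1 (hone z hz e)
    constructor <;> linarith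
  · have hR : ‖z'‖ ≤ ‖x‖ + 1 := by
      have h3 : ‖z' - x‖ ≤ 1 := by rw [← dist_eq_norm]; exact (Metric.mem_ball.1 hz').le.trans hρ1
      calc ‖z'‖ = ‖x + (z' - x)‖ := by rw [add_sub_cancel]
        _ ≤ _ := (norm_add_le _ _).trans (by gcongr)
    have h3 := norm_inv_smul_sub_sub_le hτ0.le hτ2 (hone z hz e) (hone z' hz' e')
      (hd z hz z' hz' e e') hR
    have h4 := h₂ z (hsub₂ hz) z' (hsub₂ hz')
    have h5 : ‖z - z'‖ ≤ L * ‖Ψ z - Ψ z'‖ := by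
      have := hL.dist_le_mul (Ψ z) (Ψ z')
      rwa [Ψ.symm_apply_apply, Ψ.symm_apply_apply, dist_eq_norm, dist_eq_norm] at this
    set a := (ℓ z)⁻¹ • z - (ℓ z')⁻¹ • z' with ha
    rw [← map_sub, ← ha]
    have h6 : ‖M a - (Ψ z - Ψ z')‖ ≤ τ * T * ‖Ψ z - Ψ z'‖ := by
      have e1 : M a - (Ψ z - Ψ z') = M (a - (z - z')) - (Ψ z - Ψ z' - M (z - z')) := by
        rw [map_sub M a (z - z')]; abel
      rw [e1]
      calc _ ≤ ‖M‖ * ((2 + 4 * (‖x‖ + 1)) * τ * ‖z - z'‖) + τ * ‖z - z'‖ := by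
            refine (norm_sub_le _ _).trans (add_le_add ?_ h4)
            exact (M.le_opNorm _).trans (by gcongr)
        _ = τ * (‖M‖ * (2 + 4 * (‖x‖ + 1)) + 1) * ‖z - z'‖ := by ring
        _ ≤ τ * (‖M‖ * (2 + 4 * (‖x‖ + 1)) + 1) * (L * ‖Ψ z - Ψ z'‖) := by gcongr
        _ ≤ _ := by
            rw [hT]
            nlinarith [mul_nonneg hτ0.le (norm_nonneg (Ψ z - Ψ z'))]
    have h7 : ‖M a - (Ψ z - Ψ z')‖ ≤ (1 - c⁻¹) * ‖Ψ z - Ψ z'‖ := h6.trans (by gcongr)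
    constructor
    · have := norm_sub_norm_le (M a) (Ψ z - Ψ z')
      nlinarith [norm_nonneg (Ψ z - Ψ z')]
    · have := norm_sub_norm_le (Ψ z - Ψ z') (M a)
      rw [norm_sub_rev (Ψ z - Ψ z') (M a)] at this
      have h8 : c⁻¹ * ‖Ψ z - Ψ z'‖ ≤ ‖M a‖ := by nlinarith
      rwa [inv_mul_le_iff₀ hc0] at h8

end IsBody

end Area

end ShapePerimeter

namespace ShapePerimeter

section AreaFormula

variable {E : Type*} [NormedAddCommGroup E] [InnerProductSpace ℝ E] [FiniteDimensional ℝ E]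
  [MeasurableSpace E] [BorelSpace E] {K : Set E}

theorem exists_pow_eq {c : ℝ} (hc : 1 < c) {n : ℕ} (hn : n ≠ 0) : ∃ b : ℝ, 1 < b ∧ b ^ n = c :=
  ⟨c ^ (n : ℝ)⁻¹, Real.one_lt_rpow hc (by positivity), Real.rpow_inv_natCast_pow (by linarith) hn⟩

namespace IsBody

variable (hK : IsBody K) {Ψ : E ≃ₜ E} (hΨ : IsDeformation Ψ)
include hK hΨ

/-- The area formula, locally and up to a factor close to `1`. -/
theorem exists_ball_area {x : E} (hx1 : gauge K x = 1)
    (hx : DifferentiableAt ℝ (gauge K) x) {c : ℝ} (hc : 1 < c) :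
    ∃ ρ > 0, ∀ A, MeasurableSet A → A ⊆ Metric.ball x ρ ∩ {z | gauge K z = 1} →
      (Measure.euclideanHausdorffMeasure (Module.finrank ℝ E - 1) : Measure E) (Ψ '' A) ≤
        ENNReal.ofReal c * ∫⁻ z in A, ENNReal.ofReal (areaDensity K Ψ z) ∂coneMeasure K ∧
      ∫⁻ z in A, ENNReal.ofReal (areaDensity K Ψ z) ∂coneMeasure K ≤ ENNReal.ofReal c *
        (Measure.euclideanHausdorffMeasure (Module.finrank ℝ E - 1) : Measure E) (Ψ '' A) := by
  have : Nontrivial E := ⟨⟨x, 0, hK.ne_zero_of_gauge_eq_one hx1⟩⟩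
  set d := Module.finrank ℝ E with hd
  have hd0 : 0 < d := Module.finrank_pos
  -- a factor `b ^ (d - 1)` is lost to the near-isometry, `b ^ d` to the comparison of cones, and `b` to
  -- the oscillation of the area density
  obtain ⟨b, hb, hbc⟩ := exists_pow_eq hc (n := (d - 1) + d + 1) (by omega)
  have hb0 : 0 < b := by linarith
  obtain ⟨ρ₁, hρ₁, hℓb, hflat⟩ := hK.exists_ball_flat hΨ hx1 hx hb
  obtain ⟨ρ₂, hρ₂, hdens⟩ := hK.exists_ball_areaDensity hΨ hx1 hx hb
  refine ⟨min ρ₁ ρ₂, lt_min hρ₁ hρ₂, fun A hA hAS => ?_⟩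
  set ℓ := fderiv ℝ (gauge K) x with hℓ
  have hℓ0 : ℓ ≠ 0 := fderiv_gauge_ne_zero hx (by rw [hx1]; exact one_pos)
  obtain ⟨M, hM⟩ := hΨ.isInvertible_fderiv x
  have hA1 : ∀ z ∈ A, z ∈ Metric.ball x ρ₁ ∧ z ∈ Metric.ball x ρ₂ ∧ gauge K z = 1 :=
    fun z hz => ⟨Metric.ball_subset_ball (min_le_left _ _) (hAS hz).1,
      Metric.ball_subset_ball (min_le_right _ _) (hAS hz).1, (hAS hz).2⟩
  have hpos : ∀ z ∈ A, gauge K z = 1 ∧ 0 < ℓ z := fun z hz =>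
    ⟨(hA1 z hz).2.2, (inv_pos.2 hb0).trans_le (hℓb z (hA1 z hz).1 (hA1 z hz).2.2).1⟩
  set B := flatShadow K ℓ A with hB
  have hBm : MeasurableSet B := hK.measurableSet_flatShadow ℓ hA
  have hqA : (fun z => (ℓ z)⁻¹ • z) '' A = B := hK.image_flatShadow hpos
  have hradq : ∀ z ∈ A, radial K ((ℓ z)⁻¹ • z) = z := fun z hz => by
    rw [radial_smul (inv_pos.2 (hpos z hz).2), radial_of_gauge_eq_one (hpos z hz).1]
  set H := (Measure.euclideanHausdorffMeasure (d - 1) : Measure E) with hH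
  set L : NNReal := ⟨b, hb0.le⟩ with hL
  have hLb : (L : ℝ≥0∞) = ENNReal.ofReal b := by
    rw [ENNReal.ofReal, Real.toNNReal_of_nonneg hb0.le]; rfl
  have e1 : H (Ψ '' A) ≤ ENNReal.ofReal b ^ (d - 1) * H (M '' B) := by
    have h1 : LipschitzOnWith L (fun y => Ψ (radial K (M.symm y))) (M '' B) := by
      refine LipschitzOnWith.of_dist_le_mul ?_
      rintro _ ⟨w, hw, rfl⟩ _ ⟨w', hw', rfl⟩
      rw [← hqA] at hw hw'
      obtain ⟨z, hz, rfl⟩ := hw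
      obtain ⟨z', hz', rfl⟩ := hw'
      simp only [M.symm_apply_apply, hradq z hz, hradq z' hz', dist_eq_norm]
      have := (hflat z (hA1 z hz).1 z' (hA1 z' hz').1 (hA1 z hz).2.2 (hA1 z' hz').2.2).2
      rw [← hM] at this
      exact this
    have h2 := euclideanHausdorffMeasure_image_le h1 (d - 1)
    rw [hLb, image_image] at h2
    have h3 : (fun w => Ψ (radial K (M.symm (M w)))) '' B = Ψ '' A := by
      rw [← hK.radial_image_flatShadow hpos, image_image]
      simp only [M.symm_apply_apply]
      rfl
    rwa [h3] at h2
  have e2 : H (M '' B) ≤ ENNReal.ofReal b ^ (d - 1) * H (Ψ '' A) := by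
    have h1 : LipschitzOnWith L (fun y => M ((ℓ (Ψ.symm y))⁻¹ • Ψ.symm y)) (Ψ '' A) := by
      refine LipschitzOnWith.of_dist_le_mul ?_
      rintro _ ⟨z, hz, rfl⟩ _ ⟨z', hz', rfl⟩
      simp only [Ψ.symm_apply_apply, dist_eq_norm]
      have := (hflat z (hA1 z hz).1 z' (hA1 z' hz').1 (hA1 z hz).2.2 (hA1 z' hz').2.2).1
      rw [← hM] at this
      exact this
    have h2 := euclideanHausdorffMeasure_image_le h1 (d - 1)
    rw [hLb, image_image] at h2
    have h3 : (fun z => M ((ℓ (Ψ.symm (Ψ z)))⁻¹ • Ψ.symm (Ψ z))) '' A = M '' B := by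
      rw [← hqA, image_image]
      simp only [Ψ.symm_apply_apply]
    rwa [h3] at h2
  have e3 : H (M '' B) = ENNReal.ofReal (areaDensity K Ψ x) * (d * volume (flatCone ℓ B)) := by
    rw [euclideanHausdorffMeasure_image_flat hℓ0 hBm (fun y hy => hy.1) M]
    congr 2
    rw [areaDensity, cof, ← hM, ContinuousLinearMap.inverse_equiv, ContinuousLinearMap.comp_smul,
      norm_smul, Real.norm_eq_abs, abs_abs]
  obtain ⟨e4, e5⟩ := hK.volume_flatCone_flatShadow hA hb0 fun z hz =>
    ⟨(hA1 z hz).2.2, hℓb z (hA1 z hz).1 (hA1 z hz).2.2⟩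
  have hae : ∀ᵐ z ∂(coneMeasure K).restrict A, z ∈ A ∧ DifferentiableAt ℝ (gauge K) z :=
    (ae_restrict_mem hA).and (ae_restrict_of_ae hK.ae_coneMeasure_differentiableAt)
  have e6 : ∫⁻ z in A, ENNReal.ofReal (areaDensity K Ψ z) ∂coneMeasure K ≤
      ENNReal.ofReal b * ENNReal.ofReal (areaDensity K Ψ x) * coneMeasure K A := by
    rw [← setLIntegral_const, ← ENNReal.ofReal_mul hb0.le]
    refine lintegral_mono_ae ?_
    filter_upwards [hae] with z hz
    exact ENNReal.ofReal_le_ofReal (hdens z (hA1 z hz.1).2.1 hz.2).1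
  have e7 : ENNReal.ofReal (areaDensity K Ψ x) * coneMeasure K A ≤
      ENNReal.ofReal b * ∫⁻ z in A, ENNReal.ofReal (areaDensity K Ψ z) ∂coneMeasure K := by
    rw [← setLIntegral_const, ← lintegral_const_mul _
      (measurable_areaDensity K hΨ).ennreal_ofReal]
    refine lintegral_mono_ae ?_
    filter_upwards [hae] with z hz
    rw [← ENNReal.ofReal_mul hb0.le]
    exact ENNReal.ofReal_le_ofReal (hdens z (hA1 z hz.1).2.1 hz.2).2
  have hcb : ENNReal.ofReal c =
      ENNReal.ofReal b ^ (d - 1) * ENNReal.ofReal b ^ d * ENNReal.ofReal b := by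
    rw [← hbc, ENNReal.ofReal_pow hb0.le, pow_succ, pow_add]
  rw [ENNReal.ofReal_pow hb0.le] at e4 e5
  constructor
  · calc H (Ψ '' A) ≤ ENNReal.ofReal b ^ (d - 1) * (ENNReal.ofReal (areaDensity K Ψ x) *
          (ENNReal.ofReal b ^ d * coneMeasure K A)) := by rw [e3] at e1; exact e1.trans (by gcongr)
      _ = ENNReal.ofReal b ^ (d - 1) * ENNReal.ofReal b ^ d *
          (ENNReal.ofReal (areaDensity K Ψ x) * coneMeasure K A) := by ring
      _ ≤ ENNReal.ofReal b ^ (d - 1) * ENNReal.ofReal b ^ d * (ENNReal.ofReal b *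
          ∫⁻ z in A, ENNReal.ofReal (areaDensity K Ψ z) ∂coneMeasure K) := by gcongr
      _ = _ := by rw [hcb]; ring
  · calc _ ≤ ENNReal.ofReal b * ENNReal.ofReal (areaDensity K Ψ x) * (ENNReal.ofReal b ^ d *
          (d * volume (flatCone ℓ B))) := e6.trans (by gcongr)
      _ = ENNReal.ofReal b * ENNReal.ofReal b ^ d * H (M '' B) := by rw [e3]; ring
      _ ≤ ENNReal.ofReal b * ENNReal.ofReal b ^ d *
          (ENNReal.ofReal b ^ (d - 1) * H (Ψ '' A)) := by gcongr
      _ = _ := by rw [hcb]; ring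

/-- Sets of cone measure zero have area zero; this holds also near the points where the gauge is
not differentiable, because the radial projection is locally Lipschitz. -/
theorem exists_ball_null {x : E} (hx1 : gauge K x = 1) :
    ∃ ρ > 0, ∀ A, MeasurableSet A → A ⊆ Metric.ball x ρ ∩ {z | gauge K z = 1} →
      coneMeasure K A = 0 →
      (Measure.euclideanHausdorffMeasure (Module.finrank ℝ E - 1) : Measure E) (Ψ '' A) = 0 := by
  have hx0 := hK.ne_zero_of_gauge_eq_one hx1
  have hxn : 0 < ‖x‖ := norm_pos_iff.2 hx0
  set ℓ : E →L[ℝ] ℝ := (‖x‖ ^ 2)⁻¹ • innerSL ℝ x with hℓ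
  have hℓx : ℓ x = 1 := by
    rw [hℓ, _root_.smul_apply, innerSL_apply_apply, real_inner_self_eq_norm_sq, smul_eq_mul,
      inv_mul_cancel₀ (by positivity)]
  have hℓ0 : ℓ ≠ 0 := by
    intro h; rw [h] at hℓx; simp at hℓx
  obtain ⟨L₁, t, ht, hL₁⟩ := hΨ.contDiff.contDiffAt.exists_lipschitzOnWith (x := x)
  obtain ⟨ρ₁, hρ₁, hρt⟩ := Metric.mem_nhds_iff.1 ht
  have hev : ∀ᶠ z in 𝓝 x, ℓ z ∈ Ioo (1 / 2 : ℝ) 2 :=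
    ℓ.continuous.continuousAt.eventually_mem (by rw [hℓx]; exact Ioo_mem_nhds (by norm_num) (by norm_num))
  obtain ⟨ρ₂, hρ₂, hρℓ⟩ := Metric.eventually_nhds_iff_ball.1 hev
  obtain ⟨L₂, hL₂⟩ := hK.exists_lipschitzWith
  obtain ⟨R, hR, hRg⟩ := hK.exists_norm_le
  refine ⟨min ρ₁ ρ₂, lt_min hρ₁ hρ₂, fun A hA hAS h0 => ?_⟩
  have hA1 : ∀ z ∈ A, z ∈ t ∧ ℓ z ∈ Ioo (1 / 2 : ℝ) 2 ∧ gauge K z = 1 :=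
    fun z hz => ⟨hρt (Metric.ball_subset_ball (min_le_left _ _) (hAS hz).1),
      hρℓ z (Metric.ball_subset_ball (min_le_right _ _) (hAS hz).1), (hAS hz).2⟩
  have hpos : ∀ z ∈ A, gauge K z = 1 ∧ 0 < ℓ z := fun z hz =>
    ⟨(hA1 z hz).2.2, by linarith [(hA1 z hz).2.1.1]⟩
  set B := flatShadow K ℓ A with hB
  have hBm : MeasurableSet B := hK.measurableSet_flatShadow ℓ hA
  have hqA : (fun z => (ℓ z)⁻¹ • z) '' A = B := hK.image_flatShadow hpos
  have hBH : (Measure.euclideanHausdorffMeasure (Module.finrank ℝ E - 1) : Measure E) B = 0 := by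
    rw [← finrank_mul_volume_flatCone hℓ0 hBm fun y hy => hy.1]
    have := (hK.volume_flatCone_flatShadow hA two_pos fun z hz =>
      ⟨(hA1 z hz).2.2, by have := (hA1 z hz).2.1.1; norm_num at this ⊢; exact this.le,
        (hA1 z hz).2.1.2.le⟩).1
    rw [h0, mul_zero, nonpos_iff_eq_zero] at this
    rw [this, mul_zero]
  -- `w ↦ (gauge K w)⁻¹ • w` is Lipschitz where `1 / 2 ≤ gauge K w ≤ 2`
  have hrad : LipschitzOnWith (2 + 4 * (L₂ * (2 * R.toNNReal))) (radial K) B := by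
    refine LipschitzOnWith.of_dist_le_mul ?_
    have key : ∀ w ∈ B, 1 / 2 ≤ gauge K w ∧ ‖w‖ ≤ 2 * R := by
      intro w hw
      rw [← hqA] at hw
      obtain ⟨z, hz, rfl⟩ := hw
      have hz' := hA1 z hz
      have e : gauge K ((ℓ z)⁻¹ • z) = (ℓ z)⁻¹ := by
        rw [gauge_smul_of_nonneg (inv_nonneg.2 (hpos z hz).2.le), hz'.2.2, smul_eq_mul, mul_one]
      have e' := hRg ((ℓ z)⁻¹ • z)
      have i1 : (ℓ z)⁻¹ ≤ 2 := by
        rw [inv_le_comm₀ (hpos z hz).2 two_pos]; linarith [hz'.2.1.1]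
      have i2 : 1 / 2 ≤ (ℓ z)⁻¹ := by
        rw [le_inv_comm₀ (by norm_num) (hpos z hz).2]; norm_num; linarith [hz'.2.1.2]
      change 1 / 2 ≤ gauge K ((ℓ z)⁻¹ • z) ∧ ‖(ℓ z)⁻¹ • z‖ ≤ 2 * R
      rw [e] at e' ⊢
      exact ⟨i2, e'.trans (by nlinarith)⟩
    intro w hw w' hw'
    obtain ⟨a1, a2⟩ := key w hw
    obtain ⟨b1, b2⟩ := key w' hw'
    have hl := hL₂.dist_le_mul w' w
    rw [Real.dist_eq, dist_eq_norm] at hl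
    have i1 : (gauge K w)⁻¹ ≤ 2 := by rw [inv_le_comm₀ (by linarith) two_pos]; linarith
    have i2 : (gauge K w')⁻¹ ≤ 2 := by rw [inv_le_comm₀ (by linarith) two_pos]; linarith
    have p1 : 0 ≤ (gauge K w)⁻¹ := inv_nonneg.2 (by linarith)
    have p2 : 0 ≤ (gauge K w')⁻¹ := inv_nonneg.2 (by linarith)
    have e : radial K w - radial K w' = (gauge K w)⁻¹ • (w - w') +
        ((gauge K w)⁻¹ * (gauge K w')⁻¹ * (gauge K w' - gauge K w)) • w' := by
      have q1 : gauge K w ≠ 0 := by linarith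
      have q2 : gauge K w' ≠ 0 := by linarith
      have : (gauge K w)⁻¹ * (gauge K w')⁻¹ * (gauge K w' - gauge K w) =
        (gauge K w)⁻¹ - (gauge K w')⁻¹ := by field_simp
      rw [this, radial, radial]
      module
    rw [dist_eq_norm, e, dist_eq_norm]
    refine (norm_add_le _ _).trans ?_
    rw [norm_smul, norm_smul, Real.norm_eq_abs, Real.norm_eq_abs, abs_mul, abs_of_nonneg p1,
      abs_of_nonneg (mul_nonneg p1 p2)]
    push_cast
    rw [Real.coe_toNNReal _ hR.le, add_mul]
    refine add_le_add (by gcongr) ?_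
    calc _ ≤ (2 * 2) * (L₂ * ‖w' - w‖) * (2 * R) := by gcongr
      _ = _ := by rw [norm_sub_rev]; ring
  have h1 : LipschitzOnWith (L₁ * (2 + 4 * (L₂ * (2 * R.toNNReal)))) (Ψ ∘ radial K) B :=
    hL₁.comp hrad fun w hw => (hA1 _ hw.2).1
  have h2 := euclideanHausdorffMeasure_image_le h1 (Module.finrank ℝ E - 1)
  rw [image_comp, hK.radial_image_flatShadow hpos, hBH, mul_zero, nonpos_iff_eq_zero] at h2
  exact h2

/-- The area formula: the area of a piece `Ψ(A)` of the deformed boundary `Ψ(∂K)`. -/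
theorem euclideanHausdorffMeasure_image {A : Set E} (hA : MeasurableSet A)
    (hA1 : ∀ z ∈ A, gauge K z = 1) :
    (Measure.euclideanHausdorffMeasure (Module.finrank ℝ E - 1) : Measure E) (Ψ '' A) =
      ∫⁻ z in A, ENNReal.ofReal (areaDensity K Ψ z) ∂coneMeasure K := by
  set H := (Measure.euclideanHausdorffMeasure (Module.finrank ℝ E - 1) : Measure E) with hH
  set μ := H.map Ψ.symm with hμ
  have hμA : ∀ A, MeasurableSet A → μ A = H (Ψ '' A) := fun A hA => by
    rw [hμ, Measure.map_apply Ψ.symm.continuous.measurable hA, Ψ.image_eq_preimage_symm]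
  set ν := (coneMeasure K).withDensity fun z => ENNReal.ofReal (areaDensity K Ψ z) with hν
  have hνA : ∀ A, MeasurableSet A → ν A =
      ∫⁻ z in A, ENNReal.ofReal (areaDensity K Ψ z) ∂coneMeasure K := fun A hA =>
    withDensity_apply _ hA
  set D : Set E := {z | DifferentiableAt ℝ (gauge K) z} with hD
  have hDm : MeasurableSet D := measurableSet_of_differentiableAt ℝ (gauge K)
  -- the points at which the gauge is differentiable, and then the null set of the others
  have hreg : μ (A ∩ D) = ν (A ∩ D) := by
    have hAD := hA.inter hDm
    have hloc := fun (c : ℝ) (hc : 1 < c) x (hx : x ∈ {z | gauge K z = 1} ∩ D) =>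
      hK.exists_ball_area hΨ hx.1 hx.2 hc
    refine le_antisymm
      (measure_le_of_locally_le (S := {z | gauge K z = 1} ∩ D) ?_ hAD fun z hz => ⟨hA1 z hz.1, hz.2⟩)
      (measure_le_of_locally_le (S := {z | gauge K z = 1} ∩ D) ?_ hAD fun z hz => ⟨hA1 z hz.1, hz.2⟩)
    · intro c hc x hx
      obtain ⟨ρ, hρ, h⟩ := hloc c hc x hx
      refine ⟨ρ, hρ, fun A hA hAS => ?_⟩
      rw [hμA A hA, hνA A hA]
      exact (h A hA fun z hz => ⟨(hAS hz).1, (hAS hz).2.1⟩).1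
    · intro c hc x hx
      obtain ⟨ρ, hρ, h⟩ := hloc c hc x hx
      refine ⟨ρ, hρ, fun A hA hAS => ?_⟩
      rw [hμA A hA, hνA A hA]
      exact (h A hA fun z hz => ⟨(hAS hz).1, (hAS hz).2.1⟩).2
  have hκ0 : coneMeasure K (A \ D) = 0 :=
    measure_mono_null (fun z hz => hz.2) (ae_iff.1 hK.ae_coneMeasure_differentiableAt)
  have hμ0 : μ (A \ D) = 0 := by
    refine measure_null_of_locally_null _ fun x hx => ?_
    obtain ⟨ρ, hρ, h⟩ := hK.exists_ball_null hΨ (hA1 x hx.1)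
    refine ⟨(A \ D) ∩ Metric.ball x ρ, inter_mem self_mem_nhdsWithin
      (mem_nhdsWithin_of_mem_nhds (Metric.ball_mem_nhds x hρ)), ?_⟩
    rw [hμA _ ((hA.diff hDm).inter measurableSet_ball)]
    exact h _ ((hA.diff hDm).inter measurableSet_ball) (fun z hz => ⟨hz.2, hA1 z hz.1.1⟩)
      (measure_mono_null inter_subset_left hκ0)
  rw [← hμA A hA, ← hνA A hA, ← measure_inter_add_sdiff A hDm, ← measure_inter_add_sdiff A hDm,
    hreg, hμ0, hν, withDensity_absolutelyContinuous _ _ hκ0]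

end IsBody

end AreaFormula

end ShapePerimeter

/-! ### First-order expansion of the area density -/

namespace ShapePerimeter

section Expansion

variable {N : ℕ}

/-- The trace of an endomorphism of `ℝ^N`, as a continuous linear form. -/
noncomputable def traceCLM (N : ℕ) : (Eucl N →L[ℝ] Eucl N) →L[ℝ] ℝ :=
  ∑ i, (EuclideanSpace.proj i : Eucl N →L[ℝ] ℝ).comp
    (ContinuousLinearMap.apply ℝ (Eucl N) (EuclideanSpace.single i (1 : ℝ)))

theorem traceCLM_apply (B : Eucl N →L[ℝ] Eucl N) :
    traceCLM N B = ∑ i, (B (EuclideanSpace.single i 1)) i := by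
  simp [traceCLM]

theorem traceCLM_fderiv (φ : Eucl N → Eucl N) (x : Eucl N) :
    traceCLM N (fderiv ℝ φ x) = divergence φ x := traceCLM_apply _

theorem det_eq_matrix_det (B : Eucl N →L[ℝ] Eucl N) :
    B.det = (Matrix.of fun i j => (B (EuclideanSpace.single j 1)) i).det := by
  rw [ContinuousLinearMap.det, ← LinearMap.det_toMatrix (EuclideanSpace.basisFun (Fin N) ℝ).toBasis]
  congr 1

theorem differentiable_det : Differentiable ℝ fun B : Eucl N →L[ℝ] Eucl N => B.det := by
  simp_rw [det_eq_matrix_det, Matrix.det_apply, Matrix.of_apply]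
  have : ∀ i j, Differentiable ℝ fun B : Eucl N →L[ℝ] Eucl N =>
      (B (EuclideanSpace.single j 1)) i := fun i j =>
    ((EuclideanSpace.proj i : Eucl N →L[ℝ] ℝ).comp
    (ContinuousLinearMap.apply ℝ (Eucl N) (EuclideanSpace.single j (1 : ℝ)))).differentiable
  fun_prop

theorem hasFDerivAt_det_one_add :
    HasFDerivAt (fun B : Eucl N →L[ℝ] Eucl N => (1 + B).det) (traceCLM N) 0 := by
  have h1 : DifferentiableAt ℝ (fun B : Eucl N →L[ℝ] Eucl N => (1 + B).det) 0 :=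
    DifferentiableAt.comp (g := fun B : Eucl N →L[ℝ] Eucl N => B.det) 0 (differentiable_det _)
      (by fun_prop)
  have h2 : fderiv ℝ (fun B : Eucl N →L[ℝ] Eucl N => (1 + B).det) 0 = traceCLM N := by
    ext B
    have h3 : HasDerivAt (fun t : ℝ => (1 + (0 + t • B) : Eucl N →L[ℝ] Eucl N).det)
        (fderiv ℝ (fun B : Eucl N →L[ℝ] Eucl N => (1 + B).det) 0 B) 0 :=
      h1.hasFDerivAt.hasLineDerivAt B
    set M : Matrix (Fin N) (Fin N) ℝ := Matrix.of fun i j => (B (EuclideanSpace.single j 1)) i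
    have h4 : ∀ t : ℝ, (1 + (0 + t • B) : Eucl N →L[ℝ] Eucl N).det = 1 + M.trace * t +
        (Polynomial.divX (Polynomial.divX (1 + (Polynomial.X : Polynomial ℝ) •
          M.map Polynomial.C).det)).eval t * t ^ 2 := by
      intro t
      rw [det_eq_matrix_det, ← Matrix.det_one_add_smul]
      congr 1
      ext i j
      simp [M, Matrix.one_apply]
    simp_rw [h4] at h3
    have h5 := ((((hasDerivAt_id (0 : ℝ)).const_mul M.trace).const_add 1).add
      ((Polynomial.hasDerivAt (Polynomial.divX (Polynomial.divX
        (1 + (Polynomial.X : Polynomial ℝ) • M.map Polynomial.C).det)) 0).mul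
        ((hasDerivAt_id (0 : ℝ)).pow 2)))
    have h6 := h3.unique h5
    rw [h6, traceCLM_apply]
    simp [M, Matrix.trace]
  rw [← h2]
  exact h1.hasFDerivAt

theorem abs_norm_add_sub_le {F : Type*} [NormedAddCommGroup F] [InnerProductSpace ℝ F] {n v : F}
    (hn : ‖n‖ = 1) (hv : ‖v‖ ≤ 1) : |‖n + v‖ - 1 - inner ℝ n v| ≤ ‖v‖ ^ 2 := by
  have h1 : inner ℝ n (n + v) ≤ ‖n + v‖ := by
    have := real_inner_le_norm n (n + v)
    rwa [hn, one_mul] at this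
  rw [inner_add_right, real_inner_self_eq_norm_sq, hn] at h1
  have h2 : |inner ℝ n v| ≤ ‖v‖ := by
    have := abs_real_inner_le_norm n v
    rwa [hn, one_mul] at this
  have h3 : ‖n + v‖ ^ 2 = 1 + 2 * inner ℝ n v + ‖v‖ ^ 2 := by
    rw [norm_add_sq_real, hn]; ring
  have h4 := abs_le.1 h2
  rw [abs_le]
  constructor
  · nlinarith
  · have h5 : ‖n + v‖ ≤ 1 + inner ℝ n v + ‖v‖ ^ 2 := by
      refine abs_le_of_sq_le_sq' ?_ (by nlinarith [sq_nonneg ‖v‖]) |>.2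
      rw [h3]
      nlinarith [sq_nonneg ‖v‖, sq_nonneg (inner ℝ n v + ‖v‖ ^ 2 / 2), mul_nonneg (sq_nonneg ‖v‖)
        (by linarith : 0 ≤ 1 + inner ℝ n v)]
    linarith

set_option maxHeartbeats 1000000 in
/-- The first-order expansion of the ratio of areas of hyperplane pieces with unit normal `n` under
the linear map `1 + B`, uniformly in `n`. -/
theorem exists_abs_det_mul_norm_sub_le {ε : ℝ} (hε : 0 < ε) :
    ∃ δ > 0, δ ≤ 1 ∧ ∀ B : Eucl N →L[ℝ] Eucl N, ‖B‖ ≤ δ → ∀ n : Eucl N, ‖n‖ = 1 →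
      |(|(1 + B).det| * ‖(innerSL ℝ n).comp (1 + B).inverse‖) - 1 -
        (traceCLM N B - inner ℝ n (B n))| ≤ ε * ‖B‖ := by
  set T := ‖traceCLM N‖ with hT
  have hT0 : 0 ≤ T := ContinuousLinearMap.opNorm_nonneg _
  set η : ℝ := min (1 / 4) (ε / 16) with hη
  have hη0 : 0 < η := lt_min (by norm_num) (by positivity)
  have hη4 : η ≤ 1 / 4 := min_le_left _ _
  have hηε : 16 * η ≤ ε := by have := min_le_right (1 / 4 : ℝ) (ε / 16); rw [← hη] at this; linarith
  have hdet := (hasFDerivAt_det_one_add (N := N)).isLittleO.def hη0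
  have hinv := (hasFDerivAt_ringInverse (𝕜 := ℝ) (1 : (Eucl N →L[ℝ] Eucl N)ˣ)).isLittleO.def hη0
  obtain ⟨δ₁, hδ₁, h₁⟩ := Metric.eventually_nhds_iff_ball.1 hdet
  obtain ⟨δ₂, hδ₂, h₂⟩ := Metric.eventually_nhds_iff_ball.1 hinv
  refine ⟨min (min (δ₁ / 2) (δ₂ / 2)) (min 1 (η / (T + 1))), by positivity,
    (min_le_right _ _).trans (min_le_left _ _), fun B hB n hn => ?_⟩
  have hB1 : ‖B‖ < δ₁ := by
    have := hB.trans ((min_le_left _ _).trans (min_le_left _ _)); linarith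
  have hB2 : ‖B‖ < δ₂ := by
    have := hB.trans ((min_le_left _ _).trans (min_le_right _ _)); linarith
  have hBη' : ‖B‖ * (T + 1) ≤ η := by
    have := hB.trans ((min_le_right _ _).trans (min_le_right _ _))
    rwa [le_div_iff₀ (by positivity)] at this
  have hBη : ‖B‖ ≤ η := by nlinarith [norm_nonneg B]
  have hd := h₁ B (by simpa using hB1)
  have hi := h₂ (1 + B) (by simpa [dist_eq_norm] using hB2)
  have hone : (1 : Eucl N →L[ℝ] Eucl N).det = 1 := by
    rw [ContinuousLinearMap.det]; exact LinearMap.det_id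
  have e0 : (1 + 0 : Eucl N →L[ℝ] Eucl N).det = 1 := by rw [add_zero, hone]
  rw [e0, sub_zero, Real.norm_eq_abs] at hd
  simp only [Units.val_one, Ring.inverse_one, inv_one, add_sub_cancel_left,
    ContinuousLinearMap.ringInverse_eq_inverse, neg_apply,
    ContinuousLinearMap.mulLeftRight_apply, one_mul, mul_one] at hi
  set t := traceCLM N B with ht
  set s := inner ℝ n (B n) with hs
  have ht' : |t| ≤ T * ‖B‖ := (traceCLM N).le_opNorm B
  have hs' : |s| ≤ ‖B‖ := by
    have := abs_real_inner_le_norm n (B n)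
    rw [hn, one_mul] at this
    refine this.trans ((B.le_opNorm n).trans ?_)
    rw [hn, mul_one]
  set r := (1 + B).det - 1 - t with hr
  set R := (1 + B).inverse - 1 - -B with hR
  have hRB : (1 + B).inverse = 1 - B + R := by rw [hR]; abel
  set v : Eucl N := (InnerProductSpace.toDual ℝ (Eucl N)).symm ((innerSL ℝ n).comp (R - B)) with hv
  have hvn : ‖v‖ ≤ ‖B‖ + η * ‖B‖ := by
    rw [hv, LinearIsometryEquiv.norm_map]
    refine (ContinuousLinearMap.opNorm_comp_le _ _).trans ?_
    rw [innerSL_apply_norm, hn, one_mul]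
    refine (norm_sub_le _ _).trans ?_
    linarith
  have hB0 := norm_nonneg B
  have hnv : inner ℝ n v = inner ℝ n (R n) - s := by
    rw [real_inner_comm, hv, InnerProductSpace.toDual_symm_apply]
    simp [hs]
  have hRn : |inner ℝ n (R n)| ≤ η * ‖B‖ := by
    have := abs_real_inner_le_norm n (R n)
    rw [hn, one_mul] at this
    refine this.trans ((R.le_opNorm n).trans ?_)
    rw [hn, mul_one]; exact hi
  have hnorm : ‖(innerSL ℝ n).comp (1 + B).inverse‖ = ‖n + v‖ := by
    rw [← (InnerProductSpace.toDual ℝ (Eucl N)).norm_map (n + v), map_add, hv,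
      LinearIsometryEquiv.apply_symm_apply, hRB]
    congr 1
    ext y
    simp only [ContinuousLinearMap.comp_apply, _root_.add_apply, sub_apply,
      innerSL_apply_apply, InnerProductSpace.toDual_apply_apply, one_apply_eq_self,
      inner_add_right, inner_sub_right]
    ring
  have hN := abs_norm_add_sub_le hn (hvn.trans (by nlinarith) : ‖v‖ ≤ 1)
  rw [hnv] at hN
  have hv2 : ‖v‖ ^ 2 ≤ 2 * η * ‖B‖ := by
    have : ‖v‖ ≤ 5 / 4 * ‖B‖ := by nlinarith
    nlinarith [norm_nonneg v]
  set q := ‖n + v‖ - 1 + s with hq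
  have hq' : |q| ≤ 3 * η * ‖B‖ := by
    have a := abs_le.1 hN; have b := abs_le.1 hRn
    rw [abs_le]; constructor <;> linarith
  have hTB : T * ‖B‖ ≤ η := by nlinarith
  have hηB : η * ‖B‖ ≤ 1 / 4 * (1 / 4) := mul_le_mul hη4 (hBη.trans hη4) hB0 (by norm_num)
  have hdpos : 0 ≤ (1 + B).det := by
    have a := abs_le.1 hd; have b := abs_le.1 ht'
    linarith
  have e1 : |(1 + B).det| * ‖n + v‖ - 1 - (t - s) =
      q - t * s + t * q + r * (1 - s + q) := by
    rw [abs_of_nonneg hdpos, hq, hr]; ring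
  rw [hnorm, e1]
  have b1 : |t * s| ≤ η * ‖B‖ := by rw [abs_mul]; exact mul_le_mul (ht'.trans hTB) hs' (abs_nonneg _) hη0.le
  have b2 : |t * q| ≤ 3 * η * ‖B‖ := by
    rw [abs_mul]
    calc _ ≤ 1 * (3 * η * ‖B‖) :=
          mul_le_mul ((ht'.trans hTB).trans (by linarith)) hq' (abs_nonneg _) zero_le_one
      _ = _ := one_mul _
  have b3 : |r * (1 - s + q)| ≤ η * ‖B‖ * 3 := by
    rw [abs_mul]
    refine mul_le_mul hd ?_ (abs_nonneg _) (by positivity)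
    have a := abs_le.1 hs'; have b := abs_le.1 hq'
    rw [abs_le]; constructor <;> linarith
  have a1 := abs_le.1 b1
  have a2 := abs_le.1 b2
  have a3 := abs_le.1 b3
  have a4 := abs_le.1 hq'
  have hf : 16 * η * ‖B‖ ≤ ε * ‖B‖ := by gcongr
  have hηB0 : 0 ≤ η * ‖B‖ := by positivity
  rw [abs_le]; constructor <;> linarith

end Expansion

end ShapePerimeter

/-! ### Deformations of a convex body and the surface measure of its boundary -/

namespace ShapePerimeter

namespace Theta

variable {N : ℕ}

theorem norm_apply_le (θ : Theta N) (x : Eucl N) : ‖θ x‖ ≤ ‖θ‖ := by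
  rw [norm_def]
  exact (le_ciSup θ.2.2.1 x).trans
    (le_add_of_nonneg_right (Real.iSup_nonneg fun _ => norm_nonneg _))

theorem norm_fderiv_le (θ : Theta N) (x : Eucl N) : ‖fderiv ℝ (θ : Eucl N → Eucl N) x‖ ≤ ‖θ‖ := by
  rw [norm_def]
  exact (le_ciSup θ.2.2.2 x).trans
    (le_add_of_nonneg_left (Real.iSup_nonneg fun _ => norm_nonneg _))

theorem contDiff (θ : Theta N) : ContDiff ℝ 1 (θ : Eucl N → Eucl N) := θ.2.1

theorem continuous_fderiv (θ : Theta N) : Continuous (fderiv ℝ (θ : Eucl N → Eucl N)) :=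
  θ.contDiff.continuous_fderiv one_ne_zero

theorem norm_sub_le (θ : Theta N) (x y : Eucl N) : ‖θ x - θ y‖ ≤ ‖θ‖ * ‖x - y‖ :=
  convex_univ.norm_image_sub_le_of_norm_fderiv_le (fun z _ => θ.differentiableAt z)
    (fun z _ => θ.norm_fderiv_le z) (mem_univ y) (mem_univ x)

/-- A small `θ ∈ Θ` yields the deformation `z ↦ (Id + θ)(x₀ + z)`. -/
theorem exists_deformation (θ : Theta N) (hθ : ‖θ‖ ≤ 1 / 2) (x₀ : Eucl N) :
    ∃ Ψ : Eucl N ≃ₜ Eucl N, IsDeformation Ψ ∧ (∀ z, Ψ z = x₀ + z + θ (x₀ + z)) ∧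
      ∀ z, fderiv ℝ Ψ z = 1 + fderiv ℝ θ (x₀ + z) := by
  set f : Eucl N → Eucl N := fun z => x₀ + z + θ (x₀ + z) with hf
  have hinj : ∀ z z', ‖z - z'‖ ≤ 2 * ‖f z - f z'‖ := by
    intro z z'
    have h1 := θ.norm_sub_le (x₀ + z) (x₀ + z')
    have e : f z - f z' = (z - z') + (θ (x₀ + z) - θ (x₀ + z')) := by simp only [hf]; abel
    have h2 : ‖z - z'‖ ≤ ‖f z - f z'‖ + ‖θ (x₀ + z) - θ (x₀ + z')‖ := by
      rw [e]; exact norm_le_add_norm_add _ _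
    rw [add_sub_add_left_eq_sub] at h1
    nlinarith [norm_nonneg (z - z')]
  have happ : ApproximatesLinearOn f ((ContinuousLinearEquiv.refl ℝ (Eucl N) :
      Eucl N ≃L[ℝ] Eucl N) : Eucl N →L[ℝ] Eucl N) univ (1 / 2) := by
    intro z _ z' _
    have h1 := θ.norm_sub_le (x₀ + z) (x₀ + z')
    rw [add_sub_add_left_eq_sub] at h1
    have e : f z - f z' - ((ContinuousLinearEquiv.refl ℝ (Eucl N) :
      Eucl N ≃L[ℝ] Eucl N) : Eucl N →L[ℝ] Eucl N) (z - z') =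
        θ (x₀ + z) - θ (x₀ + z') := by
      simp only [hf, ContinuousLinearEquiv.coe_refl, ContinuousLinearMap.coe_id', id]; abel
    rw [e]
    refine h1.trans ?_
    push_cast
    gcongr
  have hc : Subsingleton (Eucl N) ∨ (1 / 2 : NNReal) <
      ‖((ContinuousLinearEquiv.refl ℝ (Eucl N)).symm : Eucl N →L[ℝ] Eucl N)‖₊⁻¹ := by
    rcases subsingleton_or_nontrivial (Eucl N) with h | h
    · exact Or.inl h
    · right
      have h1 : ‖((ContinuousLinearEquiv.refl ℝ (Eucl N)).symm : Eucl N →L[ℝ] Eucl N)‖₊ = 1 := by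
        ext
        exact ContinuousLinearMap.norm_id
      rw [h1, inv_one]
      exact NNReal.half_lt_self one_ne_zero
  have hΨ : ∀ z, happ.toHomeomorph f hc z = f z := fun z => rfl
  have hcd : ContDiff ℝ 1 f := by
    have := θ.contDiff
    exact (contDiff_const.add contDiff_id).add (this.comp (contDiff_const.add contDiff_id))
  refine ⟨happ.toHomeomorph f hc, ⟨?_, 2, ?_⟩, hΨ, fun z => ?_⟩
  · exact hcd
  · refine LipschitzWith.of_dist_le_mul fun y y' => ?_
    have := hinj ((happ.toHomeomorph f hc).symm y) ((happ.toHomeomorph f hc).symm y')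
    rw [← hΨ, ← hΨ, Homeomorph.apply_symm_apply, Homeomorph.apply_symm_apply] at this
    rw [dist_eq_norm, dist_eq_norm]
    exact this
  · have h1 : HasFDerivAt (fun z : Eucl N => x₀ + z) (1 : Eucl N →L[ℝ] Eucl N) z :=
      (hasFDerivAt_id z).const_add x₀
    have h2 : HasFDerivAt f (1 + (fderiv ℝ θ (x₀ + z)).comp (1 : Eucl N →L[ℝ] Eucl N)) z :=
      h1.add ((θ.differentiableAt (x₀ + z)).hasFDerivAt.comp z h1)
    exact h2.fderiv

end Theta

section Body

variable {N : ℕ}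

/-- The outward unit normal of the level sets of the gauge of `K`, where the gauge is
differentiable. -/
noncomputable def unitNormal (K : Set (Eucl N)) (z : Eucl N) : Eucl N :=
  ‖fderiv ℝ (gauge K) z‖⁻¹ • (InnerProductSpace.toDual ℝ (Eucl N)).symm (fderiv ℝ (gauge K) z)

theorem measurable_unitNormal (K : Set (Eucl N)) : Measurable (unitNormal K) := by
  have h := measurable_fderiv ℝ (gauge K)
  exact h.norm.inv.smul
    ((InnerProductSpace.toDual ℝ (Eucl N)).symm.continuous.measurable.comp h)

theorem norm_unitNormal {K : Set (Eucl N)} {z : Eucl N} (h : fderiv ℝ (gauge K) z ≠ 0) :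
    ‖unitNormal K z‖ = 1 := by
  rw [unitNormal, norm_smul, norm_inv, norm_norm, LinearIsometryEquiv.norm_map,
    inv_mul_cancel₀ (norm_ne_zero_iff.2 h)]

theorem fderiv_gauge_eq_smul (K : Set (Eucl N)) (z : Eucl N) :
    fderiv ℝ (gauge K) z = ‖fderiv ℝ (gauge K) z‖ • innerSL ℝ (unitNormal K z) := by
  rcases eq_or_ne (fderiv ℝ (gauge K) z) 0 with h | h
  · rw [h]; simp
  ext y
  rw [unitNormal, _root_.smul_apply, innerSL_apply_apply, real_inner_smul_left,
    InnerProductSpace.toDual_symm_apply, smul_eq_mul, mul_inv_cancel_left₀ (norm_ne_zero_iff.2 h)]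

theorem fderiv_gauge_apply_eq (K : Set (Eucl N)) (z y : Eucl N) :
    fderiv ℝ (gauge K) z y = ‖fderiv ℝ (gauge K) z‖ * inner ℝ (unitNormal K z) y := by
  conv_lhs => rw [fderiv_gauge_eq_smul]
  rfl

/-- The factor by which the linear map `1 + B` multiplies areas in hyperplanes with unit
normal `n`. -/
noncomputable def areaRatio (B : Eucl N →L[ℝ] Eucl N) (n : Eucl N) : ℝ :=
  |(1 + B).det| * ‖(innerSL ℝ n).comp (1 + B).inverse‖

theorem areaDensity_eq {K : Set (Eucl N)} {Ψ : Eucl N → Eucl N} {z : Eucl N}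
    {B : Eucl N →L[ℝ] Eucl N} (h : fderiv ℝ Ψ z = 1 + B) :
    areaDensity K Ψ z = ‖fderiv ℝ (gauge K) z‖ * areaRatio B (unitNormal K z) := by
  rw [areaDensity, cof, h, ContinuousLinearMap.comp_smul, norm_smul, Real.norm_eq_abs, abs_abs,
    areaRatio]
  conv_lhs => rw [fderiv_gauge_eq_smul, ContinuousLinearMap.smul_comp, norm_smul, norm_norm]
  ring

/-- The translate of `C` by `-x₀`. -/
def centered (C : Set (Eucl N)) (x₀ : Eucl N) : Set (Eucl N) := (fun z => x₀ + z) ⁻¹' C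

/-- The outward unit normal of `C`, in terms of the gauge of `C` with respect to `x₀`. -/
noncomputable def gaugeNormal (C : Set (Eucl N)) (x₀ x : Eucl N) : Eucl N :=
  unitNormal (centered C x₀) (x - x₀)

theorem isBody_centered {C : Set (Eucl N)} (hC : Convex ℝ C) (hb : Bornology.IsBounded C)
    {x₀ : Eucl N} (hx₀ : x₀ ∈ interior C) : IsBody (centered C x₀) where
  convex := hC.translate_preimage_right x₀
  nhds := by
    refine (continuous_const.add continuous_id).continuousAt.preimage_mem_nhds ?_
    simpa using mem_interior_iff_mem_nhds.1 hx₀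
  bounded := by
    refine (hb.vadd (-x₀)).subset fun z hz => ⟨x₀ + z, hz, ?_⟩
    simp

theorem measurable_gaugeNormal (C : Set (Eucl N)) (x₀ : Eucl N) : Measurable (gaugeNormal C x₀) :=
  (measurable_unitNormal _).comp (measurable_id.sub_const x₀)

theorem frontier_eq_image {C : Set (Eucl N)} (hC : Convex ℝ C) (hb : Bornology.IsBounded C)
    {x₀ : Eucl N} (hx₀ : x₀ ∈ interior C) :
    frontier C = (fun z => x₀ + z) '' {z | gauge (centered C x₀) z = 1} := by
  have hK := isBody_centered hC hb hx₀
  have h1 : {z | gauge (centered C x₀) z = 1} = (fun z => x₀ + z) ⁻¹' frontier C := by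
    ext z
    rw [mem_ofPred_eq, gauge_eq_one_iff_mem_frontier hK.convex hK.nhds]
    have := (Homeomorph.addLeft x₀).preimage_frontier C
    change z ∈ frontier ((Homeomorph.addLeft x₀) ⁻¹' C) ↔ z ∈ (Homeomorph.addLeft x₀) ⁻¹' frontier C
    rw [this]
  rw [h1]
  exact (image_preimage_eq _ (Homeomorph.addLeft x₀).surjective).symm

theorem mem_frontier_iff_gauge {C : Set (Eucl N)} (hC : Convex ℝ C) (hb : Bornology.IsBounded C)
    {x₀ : Eucl N} (hx₀ : x₀ ∈ interior C) {x : Eucl N} :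
    x ∈ frontier C ↔ gauge (centered C x₀) (x - x₀) = 1 := by
  rw [frontier_eq_image hC hb hx₀]
  constructor
  · rintro ⟨z, hz, rfl⟩; simpa using hz
  · intro h; exact ⟨x - x₀, h, by simp⟩

theorem isDeformation_addLeft (x₀ : Eucl N) : IsDeformation (Homeomorph.addLeft x₀) where
  contDiff := contDiff_const.add contDiff_id
  lipschitz_symm := ⟨1, by
    refine LipschitzWith.of_dist_le_mul fun y y' => ?_
    change dist (-x₀ + y) (-x₀ + y') ≤ _
    simp⟩

theorem measurableEmbedding_const_add (x₀ : Eucl N) :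
    MeasurableEmbedding fun z : Eucl N => x₀ + z :=
  (MeasurableEquiv.addLeft x₀).measurableEmbedding

/-- The surface measure in terms of the cone measure. -/
theorem surfaceMeasure_eq {C : Set (Eucl N)} (hC : Convex ℝ C) (hb : Bornology.IsBounded C)
    [NeZero N] {x₀ : Eucl N} (hx₀ : x₀ ∈ interior C) :
    surfaceMeasure C = ((coneMeasure (centered C x₀)).withDensity
      fun z => (‖fderiv ℝ (gauge (centered C x₀)) z‖₊ : ℝ≥0∞)).map (fun z => x₀ + z) := by
  set K := centered C x₀ with hKdef
  have hK : IsBody K := isBody_centered hC hb hx₀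
  have hm : Measurable fun z : Eucl N => x₀ + z := measurable_const_add x₀
  ext A hA
  rw [surfaceMeasure, Measure.restrict_apply hA, Measure.map_apply hm hA,
    withDensity_apply _ (hm hA), frontier_eq_image hC hb hx₀]
  have hSm : MeasurableSet {z | gauge K z = 1} :=
    measurableSet_eq_fun hK.continuous_gauge.measurable measurable_const
  have h1 : A ∩ (fun z => x₀ + z) '' {z | gauge K z = 1} =
      (Homeomorph.addLeft x₀) '' ((fun z => x₀ + z) ⁻¹' A ∩ {z | gauge K z = 1}) := by
    change _ = (fun z => x₀ + z) '' _
    rw [image_preimage_inter]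
  have h2 := hK.euclideanHausdorffMeasure_image (isDeformation_addLeft x₀)
    ((hm hA).inter hSm) fun z hz => hz.2
  rw [finrank_euclideanSpace_fin] at h2
  rw [h1, h2]
  have h3 : (coneMeasure K).restrict ((fun z => x₀ + z) ⁻¹' A ∩ {z | gauge K z = 1}) =
      (coneMeasure K).restrict ((fun z => x₀ + z) ⁻¹' A) := by
    refine Measure.restrict_congr_set ?_
    filter_upwards [hK.ae_gauge_eq_one] with z hz
    exact propext ⟨fun h => h.1, fun h => ⟨h, hz⟩⟩
  rw [h3]
  refine lintegral_congr fun z => ?_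
  have h4 : fderiv ℝ (Homeomorph.addLeft x₀) z = 1 + 0 := by
    rw [add_zero]
    exact ((hasFDerivAt_id z).const_add x₀).fderiv
  have h5 : ContinuousLinearMap.inverse (1 : Eucl N →L[ℝ] Eucl N) = 1 :=
    ContinuousLinearMap.inverse_id
  have h6 : (1 : Eucl N →L[ℝ] Eucl N).det = 1 := by
    rw [ContinuousLinearMap.det]; exact LinearMap.det_id
  rw [areaDensity, cof, h4, add_zero, h5, h6, abs_one, one_smul]
  change ENNReal.ofReal ‖(fderiv ℝ (gauge K) z).comp (ContinuousLinearMap.id ℝ (Eucl N))‖ = _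
  rw [ContinuousLinearMap.comp_id, ofReal_norm]
  rfl

section Surface

variable {C : Set (Eucl N)} (hC : Convex ℝ C) (hb : Bornology.IsBounded C)
    [NeZero N] {x₀ : Eucl N} (hx₀ : x₀ ∈ interior C)
include hC hb hx₀

theorem isFiniteMeasure_surfaceMeasure : IsFiniteMeasure (surfaceMeasure C) := by
  have hK := isBody_centered hC hb hx₀
  have := hK.isFiniteMeasure_coneMeasure
  rw [surfaceMeasure_eq hC hb hx₀]
  obtain ⟨L, hL0, hL⟩ := hK.exists_norm_fderiv_le
  have : IsFiniteMeasure ((coneMeasure (centered C x₀)).withDensity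
      fun z => (‖fderiv ℝ (gauge (centered C x₀)) z‖₊ : ℝ≥0∞)) := by
    refine isFiniteMeasure_withDensity ?_
    refine ne_top_of_le_ne_top ?_ (lintegral_mono (g := fun _ => ENNReal.ofReal L) fun z => ?_)
    · rw [lintegral_const]
      exact ENNReal.mul_ne_top ENNReal.ofReal_ne_top (measure_ne_top _ _)
    · change ‖fderiv ℝ (gauge (centered C x₀)) z‖ₑ ≤ _
      rw [← ofReal_norm]
      exact ENNReal.ofReal_le_ofReal (hL z)
  infer_instance

theorem integral_surfaceMeasure {F : Type*} [NormedAddCommGroup F] [NormedSpace ℝ F]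
    (f : Eucl N → F) : ∫ x, f x ∂surfaceMeasure C =
      ∫ z, ‖fderiv ℝ (gauge (centered C x₀)) z‖ • f (x₀ + z) ∂coneMeasure (centered C x₀) := by
  rw [surfaceMeasure_eq hC hb hx₀,
    (measurableEmbedding_const_add x₀).integral_map (μ := Measure.withDensity _ _) f,
    integral_withDensity_eq_integral_smul (measurable_fderiv ℝ _).nnnorm]
  rfl

theorem integrable_surfaceMeasure_iff {f : Eucl N → ℝ} : Integrable f (surfaceMeasure C) ↔
    Integrable (fun z => ‖fderiv ℝ (gauge (centered C x₀)) z‖ * f (x₀ + z))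
      (coneMeasure (centered C x₀)) := by
  rw [surfaceMeasure_eq hC hb hx₀,
    (measurableEmbedding_const_add x₀).integrable_map_iff (μ := Measure.withDensity _ _),
    integrable_withDensity_iff_integrable_smul (measurable_fderiv ℝ _).nnnorm]
  rfl

theorem ae_surfaceMeasure_of_ae {P : Eucl N → Prop}
    (h : ∀ᵐ z ∂coneMeasure (centered C x₀), P (x₀ + z)) : ∀ᵐ x ∂surfaceMeasure C, P x := by
  rw [surfaceMeasure_eq hC hb hx₀,
    (measurableEmbedding_const_add x₀).ae_map_iff (μ := Measure.withDensity _ _)]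
  exact withDensity_absolutelyContinuous _ _ h

/-- At almost every boundary point the gauge with respect to `x₀` is differentiable. -/
theorem ae_surfaceMeasure_regular : ∀ᵐ x ∂surfaceMeasure C,
    gauge (centered C x₀) (x - x₀) = 1 ∧
      DifferentiableAt ℝ (gauge (centered C x₀)) (x - x₀) := by
  have hK := isBody_centered hC hb hx₀
  refine ae_surfaceMeasure_of_ae hC hb hx₀ ?_
  filter_upwards [hK.ae_gauge_eq_one, hK.ae_coneMeasure_differentiableAt] with z h1 h2
  rw [add_sub_cancel_left]
  exact ⟨h1, h2⟩

omit [NeZero N] hC hb hx₀ in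
theorem norm_gaugeNormal {x : Eucl N} (h : gauge (centered C x₀) (x - x₀) = 1)
    (hd : DifferentiableAt ℝ (gauge (centered C x₀)) (x - x₀)) : ‖gaugeNormal C x₀ x‖ = 1 :=
  norm_unitNormal (IsBody.fderiv_gauge_ne_zero hd (by rw [h]; exact one_pos))

theorem ae_norm_gaugeNormal : ∀ᵐ x ∂surfaceMeasure C, ‖gaugeNormal C x₀ x‖ = 1 := by
  filter_upwards [ae_surfaceMeasure_regular hC hb hx₀] with x hx
  exact norm_gaugeNormal hx.1 hx.2

/-- The Gauss–Green formula on a convex body. -/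
theorem setIntegral_divergence_eq {φ : Eucl N → Eucl N} (hφ : ContDiff ℝ 1 φ)
    (hc : HasCompactSupport φ) :
    ∫ x in C, divergence φ x = ∫ x, inner ℝ (gaugeNormal C x₀ x) (φ x) ∂surfaceMeasure C := by
  have hK := isBody_centered hC hb hx₀
  have h1 := hK.setIntegral_divergence (isDeformation_addLeft x₀) hφ hc
  have h2 : (Homeomorph.addLeft x₀) '' centered C x₀ = C :=
    image_preimage_eq _ (Homeomorph.addLeft x₀).surjective
  rw [h2] at h1
  rw [h1, integral_surfaceMeasure hC hb hx₀]
  refine integral_congr_ae (Eventually.of_forall fun z => ?_)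
  have h4 : fderiv ℝ (Homeomorph.addLeft x₀) z = 1 :=
    ((hasFDerivAt_id z).const_add x₀).fderiv
  have h5 : ContinuousLinearMap.inverse (1 : Eucl N →L[ℝ] Eucl N) = 1 :=
    ContinuousLinearMap.inverse_id
  have h6 : (1 : Eucl N →L[ℝ] Eucl N).det = 1 := by
    rw [ContinuousLinearMap.det]; exact LinearMap.det_id
  simp only [cof, h4, h5, h6, abs_one, one_smul, one_apply_eq_self]
  rw [fderiv_gauge_apply_eq, gaugeNormal, add_sub_cancel_left]
  rfl

theorem integrable_areaRatio {θ : Theta N} (hθ : ‖θ‖ ≤ 1 / 2) :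
    Integrable (fun x => areaRatio (fderiv ℝ θ x) (gaugeNormal C x₀ x)) (surfaceMeasure C) := by
  have hK := isBody_centered hC hb hx₀
  obtain ⟨Ψ, hΨ, h1, h2⟩ := θ.exists_deformation hθ x₀
  rw [integrable_surfaceMeasure_iff hC hb hx₀]
  refine (hK.integrable_areaDensity hΨ).congr (Eventually.of_forall fun z => ?_)
  simp only [areaDensity_eq (h2 z), gaugeNormal, add_sub_cancel_left]

theorem perimeter_deform {θ : Theta N} (hθ : ‖θ‖ ≤ 1 / 2) : perimeter (deform C θ) =
    ENNReal.ofReal (∫ x, areaRatio (fderiv ℝ θ x) (gaugeNormal C x₀ x) ∂surfaceMeasure C) := by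
  have hK := isBody_centered hC hb hx₀
  obtain ⟨Ψ, hΨ, h1, h2⟩ := θ.exists_deformation hθ x₀
  have h3 : deform C θ = Ψ '' centered C x₀ := by
    have e : (Ψ : Eucl N → Eucl N) = (fun x => x + θ x) ∘ fun z => x₀ + z := by
      funext z; exact h1 z
    rw [e, image_comp, deform]
    congr 1
    exact (image_preimage_eq _ (Homeomorph.addLeft x₀).surjective).symm
  rw [h3, hK.perimeter_image hΨ, integral_surfaceMeasure hC hb hx₀]
  congr 1
  refine integral_congr_ae (Eventually.of_forall fun z => ?_)
  simp only [areaDensity_eq (h2 z), gaugeNormal, add_sub_cancel_left, smul_eq_mul]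

theorem perimeterFunctional_eq {θ : Theta N} (hθ : ‖θ‖ ≤ 1 / 2) : perimeterFunctional C θ =
    ∫ x, areaRatio (fderiv ℝ θ x) (gaugeNormal C x₀ x) ∂surfaceMeasure C := by
  rw [perimeterFunctional, perimeter_deform hC hb hx₀ hθ, ENNReal.toReal_ofReal]
  exact integral_nonneg fun x => mul_nonneg (abs_nonneg _) (norm_nonneg _)

/-- The area of the boundary of a deformed convex body. -/
theorem perimeter_deform_eq_measure {θ : Theta N} (hθ : ‖θ‖ ≤ 1 / 2) : perimeter (deform C θ) =
    (Measure.euclideanHausdorffMeasure (N - 1) : Measure (Eucl N))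
      ((fun x => x + θ x) '' frontier C) := by
  have hK := isBody_centered hC hb hx₀
  obtain ⟨Ψ, hΨ, h1, h2⟩ := θ.exists_deformation hθ x₀
  have e : (Ψ : Eucl N → Eucl N) = (fun x => x + θ x) ∘ fun z => x₀ + z := by
    funext z; exact h1 z
  have h3 : deform C θ = Ψ '' centered C x₀ := by
    rw [e, image_comp, deform]
    congr 1
    exact (image_preimage_eq _ (Homeomorph.addLeft x₀).surjective).symm
  have hSm : MeasurableSet {z | gauge (centered C x₀) z = 1} :=
    measurableSet_eq_fun hK.continuous_gauge.measurable measurable_const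
  have h4 := hK.euclideanHausdorffMeasure_image hΨ hSm fun z hz => hz
  rw [finrank_euclideanSpace_fin, e, image_comp, ← frontier_eq_image hC hb hx₀, ← e] at h4
  rw [h4, h3, hK.perimeter_image hΨ, ofReal_integral_eq_lintegral_ofReal
    (hK.integrable_areaDensity hΨ) (Eventually.of_forall fun z => norm_nonneg _)]
  have h5 : (coneMeasure (centered C x₀)).restrict {z | gauge (centered C x₀) z = 1} =
      coneMeasure (centered C x₀) := Measure.restrict_eq_self_of_ae_mem hK.ae_gauge_eq_one
  rw [h5]

end Surface

end Body

end ShapePerimeter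

/-! ### The Fréchet derivative of the perimeter -/

namespace ShapePerimeter

section Derivative

variable {N : ℕ}

theorem norm_unitNormal_le (K : Set (Eucl N)) (z : Eucl N) : ‖unitNormal K z‖ ≤ 1 := by
  rcases eq_or_ne (fderiv ℝ (gauge K) z) 0 with h | h
  · rw [unitNormal, h]; simp
  · exact (norm_unitNormal h).le

theorem norm_gaugeNormal_le (C : Set (Eucl N)) (x₀ x : Eucl N) : ‖gaugeNormal C x₀ x‖ ≤ 1 :=
  norm_unitNormal_le _ _

/-- The tangential divergence with respect to the normal field `ν`. -/
noncomputable def divergenceAlong (ν : Eucl N → Eucl N) (ξ : Eucl N → Eucl N) (x : Eucl N) : ℝ :=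
  divergence ξ x - inner ℝ (fderiv ℝ ξ x (ν x)) (ν x)

theorem Theta.divergence_add (ξ η : Theta N) (x : Eucl N) :
    divergence (ξ + η : Theta N) x = divergence ξ x + divergence η x := by
  rw [← traceCLM_fderiv, ← traceCLM_fderiv, ← traceCLM_fderiv, Theta.fderiv_add_apply, map_add]

theorem Theta.divergence_smul (r : ℝ) (ξ : Theta N) (x : Eucl N) :
    divergence (r • ξ : Theta N) x = r * divergence ξ x := by
  rw [← traceCLM_fderiv, ← traceCLM_fderiv, Theta.fderiv_smul_apply, map_smul, smul_eq_mul]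

theorem norm_divergenceAlong_le {ν : Eucl N → Eucl N} (hν : ∀ x, ‖ν x‖ ≤ 1) (ξ : Theta N)
    (x : Eucl N) : ‖divergenceAlong ν ξ x‖ ≤ (‖traceCLM N‖ + 1) * ‖ξ‖ := by
  have h1 : ‖divergence ξ x‖ ≤ ‖traceCLM N‖ * ‖ξ‖ := by
    rw [← traceCLM_fderiv]
    exact ((traceCLM N).le_opNorm _).trans (by gcongr; exact ξ.norm_fderiv_le x)
  have h2 : ‖inner ℝ (fderiv ℝ ξ x (ν x)) (ν x)‖ ≤ ‖ξ‖ := by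
    refine (norm_inner_le_norm _ _).trans ?_
    calc _ ≤ (‖ξ‖ * 1) * 1 := by
          gcongr
          · exact (ContinuousLinearMap.le_opNorm _ _).trans
              (by gcongr; exacts [ξ.norm_fderiv_le x, hν x])
          · exact hν x
      _ = _ := by ring
  rw [add_mul, one_mul]
  exact (norm_sub_le _ _).trans (add_le_add h1 h2)

theorem measurable_divergenceAlong {ν : Eucl N → Eucl N} (hm : Measurable ν) (ξ : Theta N) :
    Measurable (divergenceAlong ν ξ) := by
  have h1 : Continuous (divergence (ξ : Eucl N → Eucl N)) := by
    have := (traceCLM N).continuous.comp ξ.continuous_fderiv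
    exact this.congr fun x => traceCLM_fderiv _ _
  have h2 : Measurable fun x => fderiv ℝ (ξ : Eucl N → Eucl N) x (ν x) :=
    measurable_clm_apply ξ.continuous_fderiv.measurable hm
  exact h1.measurable.sub (h2.inner hm)

theorem integrable_divergenceAlong {σ : Measure (Eucl N)} [IsFiniteMeasure σ]
    {ν : Eucl N → Eucl N} (hm : Measurable ν) (hν : ∀ x, ‖ν x‖ ≤ 1) (ξ : Theta N) :
    Integrable (divergenceAlong ν ξ) σ :=
  Integrable.of_bound (measurable_divergenceAlong hm ξ).aestronglyMeasurable _
    (Eventually.of_forall (norm_divergenceAlong_le hν ξ))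

/-- The linear form `ξ ↦ ∫ (∇ · ξ - (Dξ · ν) · ν) dσ` on `Θ`. -/
noncomputable def firstVariation (σ : Measure (Eucl N)) [IsFiniteMeasure σ] {ν : Eucl N → Eucl N}
    (hm : Measurable ν) (hν : ∀ x, ‖ν x‖ ≤ 1) : Theta N →L[ℝ] ℝ :=
  LinearMap.mkContinuous
    { toFun := fun ξ => ∫ x, divergenceAlong ν ξ x ∂σ
      map_add' := fun ξ η => by
        rw [← integral_add (integrable_divergenceAlong hm hν ξ)
          (integrable_divergenceAlong hm hν η)]
        refine integral_congr_ae (Eventually.of_forall fun x => ?_)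
        simp only [divergenceAlong, Theta.divergence_add, Theta.fderiv_add_apply,
          _root_.add_apply, inner_add_left]
        ring
      map_smul' := fun r ξ => by
        rw [RingHom.id_apply, smul_eq_mul, ← integral_const_mul]
        refine integral_congr_ae (Eventually.of_forall fun x => ?_)
        simp only [divergenceAlong, Theta.divergence_smul, Theta.fderiv_smul_apply,
          _root_.smul_apply, inner_smul_left, RCLike.conj_to_real]
        ring }
    ((‖traceCLM N‖ + 1) * σ.real univ) fun ξ => by
      have := norm_integral_le_of_norm_le_const (μ := σ)
        (Eventually.of_forall (norm_divergenceAlong_le hν ξ))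
      exact this.trans (le_of_eq (by ring))

theorem firstVariation_apply (σ : Measure (Eucl N)) [IsFiniteMeasure σ] {ν : Eucl N → Eucl N}
    (hm : Measurable ν) (hν : ∀ x, ‖ν x‖ ≤ 1) (ξ : Theta N) :
    firstVariation σ hm hν ξ = ∫ x, divergenceAlong ν ξ x ∂σ := rfl

theorem areaRatio_zero (n : Eucl N) : areaRatio 0 n = ‖n‖ := by
  have h5 : ContinuousLinearMap.inverse (1 : Eucl N →L[ℝ] Eucl N) = 1 :=
    ContinuousLinearMap.inverse_id
  have h6 : (1 : Eucl N →L[ℝ] Eucl N).det = 1 := by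
    rw [ContinuousLinearMap.det]; exact LinearMap.det_id
  rw [areaRatio, add_zero, h5, h6, abs_one, one_mul]
  exact (congrArg norm (ContinuousLinearMap.comp_id _)).trans (innerSL_apply_norm (𝕜 := ℝ) n)

theorem Theta.fderiv_zero (x : Eucl N) : fderiv ℝ ((0 : Theta N) : Eucl N → Eucl N) x = 0 := by
  have h0 : ((0 : Theta N) : Eucl N → Eucl N) = fun _ => 0 := rfl
  rw [h0]; simp

/-- The first variation of the area is the integral of the tangential divergence. -/
theorem hasFDerivAt_integral_areaRatio {σ : Measure (Eucl N)} [IsFiniteMeasure σ]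
    {ν : Eucl N → Eucl N} (hm : Measurable ν) (hν : ∀ x, ‖ν x‖ ≤ 1) (hν1 : ∀ᵐ x ∂σ, ‖ν x‖ = 1)
    (hint : ∀ θ : Theta N, ‖θ‖ ≤ 1 / 2 →
      Integrable (fun x => areaRatio (fderiv ℝ θ x) (ν x)) σ) :
    HasFDerivAt (fun θ : Theta N => ∫ x, areaRatio (fderiv ℝ θ x) (ν x) ∂σ)
      (firstVariation σ hm hν) 0 := by
  rw [hasFDerivAt_iff_isLittleO_nhds_zero, Asymptotics.isLittleO_iff]
  intro ε hε
  set m := σ.real univ with hmdef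
  have hm0 : 0 ≤ m := measureReal_nonneg
  obtain ⟨δ, hδ, -, h⟩ := exists_abs_det_mul_norm_sub_le (N := N) (ε := ε / (m + 1)) (by positivity)
  have hnear : Metric.closedBall (0 : Theta N) (min δ (1 / 2)) ∈ 𝓝 0 :=
    Metric.closedBall_mem_nhds _ (by positivity)
  filter_upwards [hnear] with θ hθ
  rw [mem_closedBall_zero_iff, le_min_iff] at hθ
  have i1 := hint θ hθ.2
  have i0 := hint 0 (by rw [norm_zero]; norm_num)
  have i2 := integrable_divergenceAlong (σ := σ) hm hν θ
  have i3 : Integrable (fun x => areaRatio (fderiv ℝ θ x) (ν x) -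
      areaRatio (fderiv ℝ (0 : Theta N) x) (ν x)) σ := i1.sub i0
  rw [zero_add, firstVariation_apply, ← integral_sub i1 i0, ← integral_sub i3 i2]
  calc _ ≤ ε / (m + 1) * ‖θ‖ * m := by
        refine norm_integral_le_of_norm_le_const ?_
        filter_upwards [hν1] with x hx
        have h1 := h (fderiv ℝ θ x) ((θ.norm_fderiv_le x).trans hθ.1) (ν x) hx
        rw [Theta.fderiv_zero, areaRatio_zero, hx, divergenceAlong, ← traceCLM_fderiv,
          real_inner_comm, Real.norm_eq_abs]
        refine h1.trans ?_
        gcongr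
        exact θ.norm_fderiv_le x
    _ = ε * ‖θ‖ * (m / (m + 1)) := by ring
    _ ≤ ε * ‖θ‖ * 1 := by
        gcongr
        rw [div_le_one (by positivity)]; linarith
    _ = _ := mul_one _

variable {C : Set (Eucl N)} (hC : Convex ℝ C) (hb : Bornology.IsBounded C)
    [NeZero N] {x₀ : Eucl N} (hx₀ : x₀ ∈ interior C)
include hC hb hx₀

theorem hasFDerivAt_perimeterFunctional [IsFiniteMeasure (surfaceMeasure C)] :
    HasFDerivAt (perimeterFunctional C) (firstVariation (surfaceMeasure C)
      (measurable_gaugeNormal C x₀) (norm_gaugeNormal_le C x₀)) 0 := by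
  refine (hasFDerivAt_integral_areaRatio (measurable_gaugeNormal C x₀) (norm_gaugeNormal_le C x₀)
    (ae_norm_gaugeNormal hC hb hx₀)
    fun θ hθ => integrable_areaRatio hC hb hx₀ hθ).congr_of_eventuallyEq ?_
  have hnear : Metric.closedBall (0 : Theta N) (1 / 2) ∈ 𝓝 0 :=
    Metric.closedBall_mem_nhds _ (by norm_num)
  filter_upwards [hnear] with θ hθ
  exact perimeterFunctional_eq hC hb hx₀ (mem_closedBall_zero_iff.1 hθ)

theorem eventually_perimeter_lt_top : ∀ᶠ θ : Theta N in 𝓝 0, perimeter (deform C θ) < ∞ := by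
  have hnear : Metric.closedBall (0 : Theta N) (1 / 2) ∈ 𝓝 0 :=
    Metric.closedBall_mem_nhds _ (by norm_num)
  filter_upwards [hnear] with θ hθ
  rw [perimeter_deform hC hb hx₀ (mem_closedBall_zero_iff.1 hθ)]
  exact ENNReal.ofReal_lt_top

end Derivative

end ShapePerimeter

/-! ### Monotonicity of the perimeter -/

namespace ShapePerimeter

section Projection

variable {E : Type*} [NormedAddCommGroup E] [InnerProductSpace ℝ E] [CompleteSpace E]

/-- A point of the boundary of a convex set with interior has a normal vector. -/
theorem exists_normal_of_mem_frontier {C : Set E} (hC : Convex ℝ C)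
    (hi : (interior C).Nonempty) {y : E} (hy : y ∈ frontier C) :
    ∃ v : E, v ≠ 0 ∧ ∀ z ∈ closure C, inner ℝ v (z - y) ≤ 0 := by
  obtain ⟨f, hf⟩ := geometric_hahn_banach_open_point hC.interior isOpen_interior hy.2
  refine ⟨(InnerProductSpace.toDual ℝ E).symm f, ?_, fun z hz => ?_⟩
  · intro h
    rw [LinearIsometryEquiv.map_eq_zero_iff] at h
    obtain ⟨z, hz⟩ := hi
    have := hf z hz
    rw [h] at this
    simp at this
  · rw [InnerProductSpace.toDual_symm_apply, map_sub, sub_nonpos]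
    rw [← hC.closure_interior_eq_closure_of_nonempty_interior hi] at hz
    exact closure_minimal (fun w hw => (hf w hw).le)
      (isClosed_le f.continuous continuous_const) hz

/-- The projection onto a closed convex set `C` is `1`-Lipschitz, and `y ∈ C` is the projection of
`x` as soon as `x - y` is normal to `C` at `y`. -/
theorem exists_projection {C : Set E} (hC : Convex ℝ C) (hcl : IsClosed C) (hne : C.Nonempty) :
    ∃ p : E → E, LipschitzWith 1 p ∧
      ∀ x, ∀ y ∈ C, (∀ w ∈ C, inner ℝ (x - y) (w - y) ≤ 0) → p x = y := by
  have h : ∀ x, ∃ y ∈ C, ∀ w ∈ C, inner ℝ (x - y) (w - y) ≤ 0 := fun x => by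
    obtain ⟨y, hy, h⟩ := exists_norm_eq_iInf_of_complete_convex hne hcl.isComplete hC x
    exact ⟨y, hy, (norm_eq_iInf_iff_real_inner_le_zero hC hy).1 h⟩
  choose p hp hpw using h
  have key : ∀ x x' y y', y ∈ C → y' ∈ C → (∀ w ∈ C, inner ℝ (x - y) (w - y) ≤ 0) →
      (∀ w ∈ C, inner ℝ (x' - y') (w - y') ≤ 0) → ‖y - y'‖ ≤ ‖x - x'‖ := by
    intro x x' y y' hy hy' h h'
    have h1 := h y' hy'
    have h2 := h' y hy
    have h3 : ‖y - y'‖ ^ 2 ≤ inner ℝ (x - x') (y - y') := by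
      have e : inner ℝ (x - x') (y - y') - ‖y - y'‖ ^ 2 =
          -inner ℝ (x - y) (y' - y) - inner ℝ (x' - y') (y - y') := by
        rw [← real_inner_self_eq_norm_sq]
        simp only [inner_sub_left, inner_sub_right]
        ring
      linarith
    have h4 := h3.trans (real_inner_le_norm _ _)
    rcases (norm_nonneg (y - y')).eq_or_lt with h0 | h0
    · rw [← h0]; exact norm_nonneg _
    · rw [sq] at h4
      exact le_of_mul_le_mul_right h4 h0
  refine ⟨p, LipschitzWith.of_dist_le_mul fun x x' => ?_, fun x y hy h => ?_⟩
  · rw [NNReal.coe_one, one_mul, dist_eq_norm, dist_eq_norm]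
    exact key x x' _ _ (hp x) (hp x') (hpw x) (hpw x')
  · have := key x x _ _ (hp x) hy (hpw x) h
    rw [sub_self, norm_zero] at this
    exact sub_eq_zero.1 (norm_le_zero_iff.1 this)

theorem inter_frontier_nonempty_of_isPreconnected {X : Type*} [TopologicalSpace X] {t s : Set X}
    (ht : IsPreconnected t) (h1 : (t ∩ s).Nonempty) (h2 : (t ∩ sᶜ).Nonempty) :
    (t ∩ frontier s).Nonempty := by
  by_contra hne
  rw [not_nonempty_iff_eq_empty] at hne
  have hcov : ∀ x ∈ t, x ∈ interior s ∨ x ∈ (closure s)ᶜ := by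
    intro x hx
    by_contra hcon
    push Not at hcon
    have : x ∈ t ∩ frontier s := ⟨hx, notMem_compl_iff.1 hcon.2, hcon.1⟩
    rw [hne] at this
    exact this
  obtain ⟨a, hat, ha⟩ := h1
  obtain ⟨b, hbt, hb⟩ := h2
  obtain ⟨x, -, hx1, hx2⟩ := ht _ _ isOpen_interior isClosed_closure.isOpen_compl hcov
    ⟨a, hat, (hcov a hat).resolve_right fun h => h (subset_closure ha)⟩
    ⟨b, hbt, (hcov b hbt).resolve_left fun h => hb (interior_subset h)⟩
  exact hx2 (subset_closure (interior_subset hx1))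

/-- The projection onto a convex set `C` maps the boundary of a larger bounded set onto the
boundary of `C`. -/
theorem frontier_subset_image_projection {C F : Set E} (hC : Convex ℝ C)
    (hi : (interior C).Nonempty) (hCF : closure C ⊆ F) (hF : Bornology.IsBounded F) {p : E → E}
    (hp : ∀ x, ∀ y ∈ closure C, (∀ w ∈ closure C, inner ℝ (x - y) (w - y) ≤ 0) → p x = y) :
    frontier C ⊆ p '' frontier F := by
  intro y hy
  obtain ⟨v, hv, hvC⟩ := exists_normal_of_mem_frontier hC hi hy
  set r : ℝ → E := fun s => y + s • v with hr
  have hrc : Continuous r := by fun_prop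
  have hconn : IsPreconnected (r '' Ici 0) := isPreconnected_Ici.image _ hrc.continuousOn
  have h1 : (r '' Ici 0 ∩ F).Nonempty :=
    ⟨y, ⟨0, by simp, by simp [hr]⟩, hCF (frontier_subset_closure hy)⟩
  have h2 : (r '' Ici 0 ∩ Fᶜ).Nonempty := by
    obtain ⟨R, hR, hFR⟩ := hF.subset_closedBall_lt 0 y
    have hv' : 0 < ‖v‖ := norm_pos_iff.2 hv
    refine ⟨r ((R + 1) / ‖v‖), ⟨_, by simp only [mem_Ici]; positivity, rfl⟩, fun hmem => ?_⟩
    have := mem_closedBall_iff_norm.1 (hFR hmem)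
    simp only [hr, add_sub_cancel_left, norm_smul, norm_div, norm_norm] at this
    rw [div_mul_cancel₀ _ hv'.ne', Real.norm_of_nonneg (by linarith)] at this
    linarith
  -- the normal ray from `y` starts in `F` and leaves it
  obtain ⟨_, ⟨s, hs, rfl⟩, hsF⟩ := inter_frontier_nonempty_of_isPreconnected hconn h1 h2
  refine ⟨_, hsF, hp _ y (frontier_subset_closure hy) fun w hw => ?_⟩
  simp only [hr, add_sub_cancel_left, inner_smul_left, RCLike.conj_to_real]
  exact mul_nonpos_of_nonneg_of_nonpos hs (hvC w hw)

end Projection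

section Monotone

variable {N : ℕ} {C : Set (Eucl N)} (hC : Convex ℝ C) (hb : Bornology.IsBounded C)
    [NeZero N] {x₀ : Eucl N} (hx₀ : x₀ ∈ interior C)
include hC hb hx₀

/-- Deformations which enlarge a convex set do not decrease its perimeter, because the projection
onto the set maps the new boundary onto the old one without increasing areas. -/
theorem perimeterFunctional_zero_le {θ : Theta N} (hθ : ‖θ‖ ≤ 1 / 2)
    (hsub : closure C ⊆ (fun x => x + θ x) '' closure C) :
    perimeterFunctional C 0 ≤ perimeterFunctional C θ := by
  obtain ⟨Ψ, hΨ, h1, -⟩ := θ.exists_deformation hθ 0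
  have e : (Ψ : Eucl N → Eucl N) = fun x => x + θ x := by
    funext z; rw [h1, zero_add]
  rw [← e] at hsub
  obtain ⟨p, hp1, hp⟩ := exists_projection hC.closure isClosed_closure
    ⟨x₀, subset_closure (interior_subset hx₀)⟩
  have hbF : Bornology.IsBounded (Ψ '' closure C) :=
    (hb.isCompact_closure.image Ψ.continuous).isBounded
  have h2 : frontier C ⊆ p '' (Ψ '' frontier C) := by
    refine (frontier_subset_image_projection hC ⟨x₀, hx₀⟩ hsub hbF hp).trans (image_mono ?_)
    rw [← Ψ.image_frontier]
    exact image_mono frontier_closure_subset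
  have h3 : (Measure.euclideanHausdorffMeasure (N - 1) : Measure (Eucl N)) (frontier C) ≤
      (Measure.euclideanHausdorffMeasure (N - 1) : Measure (Eucl N)) (Ψ '' frontier C) := by
    refine (measure_mono h2).trans ?_
    have := euclideanHausdorffMeasure_image_le (hp1.lipschitzOnWith (s := Ψ '' frontier C)) (N - 1)
    simpa using this
  have h0 : ‖(0 : Theta N)‖ ≤ 1 / 2 := by rw [norm_zero]; norm_num
  have e0 : (fun x => x + (0 : Theta N) x) '' frontier C = frontier C := by
    have : (fun x : Eucl N => x + (0 : Theta N) x) = id := by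
      funext x; exact add_zero x
    rw [this, image_id]
  rw [perimeterFunctional, perimeterFunctional, perimeter_deform_eq_measure hC hb hx₀ h0,
    perimeter_deform_eq_measure hC hb hx₀ hθ, e0, ← e]
  refine ENNReal.toReal_mono ?_ h3
  rw [e, ← perimeter_deform_eq_measure hC hb hx₀ hθ, perimeter_deform hC hb hx₀ hθ]
  exact ENNReal.ofReal_ne_top

end Monotone

end ShapePerimeter

/-! ### The measure `∇χ_C` and the reduced boundary of a convex body -/

namespace ShapePerimeter

section VectorMeasure

theorem integral_indicator_const_vectorMeasure {X E F G : Type*} [MeasurableSpace X]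
    [NormedAddCommGroup E] [NormedSpace ℝ E] [NormedAddCommGroup F] [NormedSpace ℝ F]
    [NormedAddCommGroup G] [NormedSpace ℝ G] [CompleteSpace G] {D : VectorMeasure X F}
    [IsFiniteMeasure D.variation] (B : E →L[ℝ] F →L[ℝ] G) {s : Set X} (hs : MeasurableSet s)
    (e : E) : D.integral (s.indicator fun _ => e) B = B e (D s) := by
  have : IsFiniteMeasure (D.restrict s).variation := by
    rw [VectorMeasure.variation_restrict hs]; infer_instance
  rw [VectorMeasure.integral_indicator hs, VectorMeasure.integral_const,
    VectorMeasure.restrict_apply _ hs MeasurableSet.univ, univ_inter]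

/-- Integration of a bounded function with respect to a vector measure with density. -/
theorem integral_withDensityᵥ {X E F G : Type*} [MeasurableSpace X]
    [NormedAddCommGroup E] [NormedSpace ℝ E] [NormedAddCommGroup F] [NormedSpace ℝ F]
    [CompleteSpace F] [NormedAddCommGroup G] [NormedSpace ℝ G] [CompleteSpace G] {μ : Measure X}
    {f : X → F} (hf : Integrable f μ) (B : E →L[ℝ] F →L[ℝ] G) {φ : X → E}
    (hφ : StronglyMeasurable φ) {M : ℝ} (hM : ∀ x, ‖φ x‖ ≤ M) :
    (μ.withDensityᵥ f).integral φ B = ∫ x, B (φ x) (f x) ∂μ := by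
  set D := μ.withDensityᵥ f with hD
  have hfin : IsFiniteMeasure D.variation := by
    constructor
    rw [hD, Measure.variation_withDensityᵥ hf, withDensity_apply _ MeasurableSet.univ,
      Measure.restrict_univ]
    exact hf.2
  have hint : ∀ ψ : X → E, StronglyMeasurable ψ → (∃ M, ∀ x, ‖ψ x‖ ≤ M) →
      Integrable (fun x => B (ψ x) (f x)) μ := by
    rintro ψ hψ ⟨M, hM⟩
    refine (hf.norm.const_mul (‖B‖ * M)).mono' ?_ (Eventually.of_forall fun x => ?_)
    · exact B.aestronglyMeasurable_comp₂ hψ.aestronglyMeasurable hf.aestronglyMeasurable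
    · refine (B.le_opNorm₂ _ _).trans ?_
      gcongr
      exact hM x
  have hsimple : ∀ ψ : SimpleFunc X E, D.integral ψ B = ∫ x, B (ψ x) (f x) ∂μ := by
    intro ψ
    induction ψ using SimpleFunc.induction with
    | const c hs =>
      rename_i s
      have e1 : ((SimpleFunc.const X c).piecewise s hs (SimpleFunc.const X 0) : X → E) =
          s.indicator fun _ => c := by
        funext x
        by_cases hx : x ∈ s <;> simp [hx]
      simp only [SimpleFunc.coe_piecewise, SimpleFunc.coe_const, SimpleFunc.const_zero,
        SimpleFunc.coe_zero, piecewise_eq_indicator]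
      have e2 : ∀ x, B (s.indicator (Function.const X c) x) (f x) =
          s.indicator (fun x => B c (f x)) x := by
        intro x
        by_cases hx : x ∈ s <;> simp [hx]
      simp_rw [e2]
      rw [integral_indicator hs, (B c).integral_comp_comm hf.integrableOn,
        ← withDensityᵥ_apply hf hs]
      exact integral_indicator_const_vectorMeasure B hs c
    | add hdisj h1 h2 =>
      rename_i u v
      have i1 : ∀ w : SimpleFunc X E, Integrable w D.variation := fun w => w.integrable_of_isFiniteMeasure
      have b1 : ∀ w : SimpleFunc X E, ∃ M, ∀ x, ‖w x‖ ≤ M := fun w => w.exists_forall_norm_le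
      rw [SimpleFunc.coe_add, VectorMeasure.integral_add (i1 u) (i1 v), h1, h2,
        ← integral_add (hint u u.stronglyMeasurable (b1 u)) (hint v v.stronglyMeasurable (b1 v))]
      refine integral_congr_ae (Eventually.of_forall fun x => ?_)
      simp
  have h1 : Tendsto (fun n => D.integral (hφ.approxBounded M n) B) atTop
      (𝓝 (D.integral φ B)) := by
    refine VectorMeasure.tendsto_integral_of_dominated_convergence (fun _ => |M|)
      (fun n => (hφ.approxBounded M n).stronglyMeasurable.aestronglyMeasurable)
      (integrable_const _) (fun n => Eventually.of_forall fun x => ?_)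
      (Eventually.of_forall fun x => hφ.tendsto_approxBounded_of_norm_le (hM x))
    exact (hφ.norm_approxBounded_le ((norm_nonneg _).trans (hM x)) n x).trans (le_abs_self M)
  have h2 : Tendsto (fun n => ∫ x, B (hφ.approxBounded M n x) (f x) ∂μ) atTop
      (𝓝 (∫ x, B (φ x) (f x) ∂μ)) := by
    refine tendsto_integral_of_dominated_convergence (fun x => ‖B‖ * |M| * ‖f x‖)
      (fun n => B.aestronglyMeasurable_comp₂
        (hφ.approxBounded M n).stronglyMeasurable.aestronglyMeasurable hf.aestronglyMeasurable)
      (hf.norm.const_mul _) (fun n => Eventually.of_forall fun x => ?_)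
      (Eventually.of_forall fun x => ?_)
    · refine (B.le_opNorm₂ _ _).trans ?_
      gcongr
      exact (hφ.norm_approxBounded_le ((norm_nonneg _).trans (hM x)) n x).trans (le_abs_self M)
    · have := (B.flip (f x)).continuous.tendsto (φ x)
      exact this.comp (hφ.tendsto_approxBounded_of_norm_le (hM x))
  refine tendsto_nhds_unique h1 (h2.congr fun n => ?_)
  rw [hsimple]

end VectorMeasure

section GradIndicator

variable {N : ℕ}

/-- The measure `∇χ_S` is unique: test fields approximate `χ_A e` in `L¹` for every Borel set `A` and
every vector `e`. -/
theorem IsGradIndicator.eq {S : Set (Eucl N)} {D D' : VectorMeasure (Eucl N) (Eucl N)}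
    (h : IsGradIndicator S D) (h' : IsGradIndicator S D') : D = D' := by
  have hfD : IsFiniteMeasure D.variation := ⟨h.1⟩
  have hfD' : IsFiniteMeasure D'.variation := ⟨h'.1⟩
  ext1 A hA
  have key : ∀ e : Eucl N, ‖e‖ ≤ 1 → inner ℝ e (D A) = inner ℝ e (D' A) := by
    intro e he
    set μ := D.variation + D'.variation with hμ
    set f : Eucl N → Eucl N := A.indicator fun _ => e with hf
    have hfm : StronglyMeasurable f := stronglyMeasurable_const.indicator hA
    have hf1 : ∀ x, ‖f x‖ ≤ 1 := fun x => by
      by_cases hx : x ∈ A <;> simp [hf, hx, he]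
    have hfi : Integrable f μ := Integrable.of_bound hfm.aestronglyMeasurable 1
      (Eventually.of_forall hf1)
    choose φ hφ hφc hφ1 hφi hφε using fun n : ℕ =>
      exists_testField_integral_sub_le μ hfi hf1 (Nat.one_div_pos_of_nat (α := ℝ) (n := n))
    have hzero : Tendsto (fun n => ∫⁻ x, ‖φ n x - f x‖ₑ ∂μ) atTop (𝓝 0) := by
      have h1 : Tendsto (fun n : ℕ => ENNReal.ofReal (1 / ((n : ℝ) + 1))) atTop (𝓝 0) := by
        rw [← ENNReal.ofReal_zero]
        exact ENNReal.tendsto_ofReal tendsto_one_div_add_atTop_nhds_zero_nat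
      refine tendsto_of_tendsto_of_tendsto_of_le_of_le tendsto_const_nhds h1
        (fun _ => zero_le) fun n => ?_
      change ∫⁻ x, ‖φ n x - f x‖ₑ ∂μ ≤ _
      have h2 := ofReal_integral_norm_eq_lintegral_enorm (hfi.sub (hφi n))
      have h3 : ∫⁻ x, ‖φ n x - f x‖ₑ ∂μ = ∫⁻ x, ‖(f - φ n) x‖ₑ ∂μ :=
        lintegral_congr fun x => enorm_sub_rev _ _
      rw [h3, ← h2]
      exact ENNReal.ofReal_le_ofReal (hφε n)
    have hlim : ∀ D'' : VectorMeasure (Eucl N) (Eucl N), IsFiniteMeasure D''.variation →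
        D''.variation ≤ μ →
        Tendsto (fun n => D''.integral (φ n) (innerSL ℝ)) atTop (𝓝 (inner ℝ e (D'' A))) := by
      intro D'' hfin hle
      have h1 : D''.integral f (innerSL ℝ) = inner ℝ e (D'' A) :=
        integral_indicator_const_vectorMeasure (innerSL ℝ) hA e
      rw [← h1]
      refine VectorMeasure.tendsto_integral_of_L1 f hfm.aestronglyMeasurable
        (Eventually.of_forall fun n => (hφi n).mono_measure hle) ?_
      exact tendsto_of_tendsto_of_tendsto_of_le_of_le tendsto_const_nhds hzero
        (fun _ => zero_le) fun n => lintegral_mono' hle le_rfl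
    have l1 := hlim D hfD (Measure.le_add_right le_rfl)
    have l2 := hlim D' hfD' (Measure.le_add_left le_rfl)
    refine tendsto_nhds_unique l1 (l2.congr fun n => ?_)
    have e1 := h.2 (φ n) (hφ n) (hφc n)
    have e2 := h'.2 (φ n) (hφ n) (hφc n)
    linarith
  refine ext_inner_left ℝ fun v => ?_
  rcases eq_or_ne v 0 with rfl | hv
  · simp
  have := key (‖v‖⁻¹ • v) (by rw [norm_smul, norm_inv, norm_norm, inv_mul_cancel₀ (norm_ne_zero_iff.2 hv)])
  rw [real_inner_smul_left, real_inner_smul_left] at this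
  exact mul_left_cancel₀ (inv_ne_zero (norm_ne_zero_iff.2 hv)) this

theorem IsGradIndicator.gradIndicator_eq {S : Set (Eucl N)} {D : VectorMeasure (Eucl N) (Eucl N)}
    (h : IsGradIndicator S D) : gradIndicator S = D := by
  have hex : ∃ D, IsGradIndicator S D := ⟨D, h⟩
  rw [gradIndicator, dif_pos hex]
  exact hex.choose_spec.eq h

variable {C : Set (Eucl N)} (hC : Convex ℝ C) (hb : Bornology.IsBounded C)
    [NeZero N] {x₀ : Eucl N} (hx₀ : x₀ ∈ interior C)
include hC hb hx₀

theorem integrable_gaugeNormal : Integrable (gaugeNormal C x₀) (surfaceMeasure C) := by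
  have := isFiniteMeasure_surfaceMeasure hC hb hx₀
  exact Integrable.of_bound (measurable_gaugeNormal C x₀).aestronglyMeasurable 1
    (Eventually.of_forall (norm_gaugeNormal_le C x₀))

theorem variation_withDensityᵥ_gaugeNormal :
    ((surfaceMeasure C).withDensityᵥ (-gaugeNormal C x₀)).variation = surfaceMeasure C := by
  rw [Measure.variation_withDensityᵥ (integrable_gaugeNormal hC hb hx₀).neg]
  conv_rhs => rw [← withDensity_one (μ := surfaceMeasure C)]
  refine withDensity_congr_ae ?_
  filter_upwards [ae_norm_gaugeNormal hC hb hx₀] with x hx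
  rw [Pi.neg_apply, enorm_neg, ← ofReal_norm, hx, ENNReal.ofReal_one, Pi.one_apply]

theorem gradIndicator_eq :
    gradIndicator C = (surfaceMeasure C).withDensityᵥ (-gaugeNormal C x₀) := by
  have := isFiniteMeasure_surfaceMeasure hC hb hx₀
  refine IsGradIndicator.gradIndicator_eq ⟨?_, fun φ hφ hc => ?_⟩
  · rw [variation_withDensityᵥ_gaugeNormal hC hb hx₀]
    exact measure_lt_top _ _
  · have hone : ((1 : ℕ∞) : WithTop ℕ∞) ≤ ((⊤ : ℕ∞) : WithTop ℕ∞) := by exact_mod_cast le_top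
    obtain ⟨M, hM⟩ := hφ.continuous.bounded_above_of_compact_support hc
    rw [setIntegral_divergence_eq hC hb hx₀ (hφ.of_le hone) hc,
      integral_withDensityᵥ (integrable_gaugeNormal hC hb hx₀).neg (innerSL ℝ)
        hφ.continuous.stronglyMeasurable hM, ← integral_neg]
    refine integral_congr_ae (Eventually.of_forall fun x => ?_)
    simp only [Pi.neg_apply, map_neg, neg_neg]
    exact real_inner_comm _ _

theorem gradIndicator_variation : (gradIndicator C).variation = surfaceMeasure C := by
  rw [gradIndicator_eq hC hb hx₀, variation_withDensityᵥ_gaugeNormal hC hb hx₀]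

/-- Every boundary point lies in the support of the surface measure: the cone over a neighbourhood of
it in `∂C` contains an open set. -/
theorem surfaceMeasure_ball_pos {x : Eucl N} (hx : x ∈ frontier C) {ρ : ℝ} (hρ : 0 < ρ) :
    0 < surfaceMeasure C (Metric.ball x ρ) := by
  set K := centered C x₀ with hKdef
  have hK : IsBody K := isBody_centered hC hb hx₀
  rw [mem_frontier_iff_gauge hC hb hx₀] at hx
  set z := x - x₀ with hz
  have hz0 : z ≠ 0 := hK.ne_zero_of_gauge_eq_one hx
  have hm : Measurable fun z : Eucl N => x₀ + z := measurable_const_add x₀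
  have hpre : (fun z => x₀ + z) ⁻¹' Metric.ball x ρ = Metric.ball z ρ := by
    ext y
    rw [mem_preimage, Metric.mem_ball, Metric.mem_ball, dist_eq_norm, dist_eq_norm, hz]
    congr! 2
    abel
  rw [surfaceMeasure_eq hC hb hx₀, Measure.map_apply hm measurableSet_ball, hpre, pos_iff_ne_zero]
  intro h0
  rw [withDensity_apply_eq_zero (measurable_fderiv ℝ _).nnnorm.coe_nnreal_ennreal] at h0
  have h1 : coneMeasure K (Metric.ball z ρ) = 0 := by
    rw [measure_congr (?_ : Metric.ball z ρ =ᵐ[coneMeasure K] _)]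
    · exact h0
    · filter_upwards [hK.ae_gauge_eq_one, hK.ae_coneMeasure_differentiableAt] with y h1 h2
      refine propext ⟨fun h => ⟨?_, h⟩, fun h => h.2⟩
      have := IsBody.fderiv_gauge_ne_zero h2 (by rw [h1]; exact one_pos)
      simpa using this
  rw [hK.coneMeasure_apply measurableSet_ball, mul_eq_zero] at h1
  have h2 : {x | gauge K x ≤ 1} ∩ radial K ⁻¹' Metric.ball z ρ ∈ 𝓝 ((1 / 2 : ℝ) • z) := by
    have hzz : (1 / 2 : ℝ) • z ≠ 0 := smul_ne_zero (by norm_num) hz0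
    have hg : gauge K ((1 / 2 : ℝ) • z) = 1 / 2 := by
      rw [gauge_smul_of_nonneg (by norm_num), hx, smul_eq_mul, mul_one]
    refine inter_mem ?_ ?_
    · have : ∀ᶠ y in 𝓝 ((1 / 2 : ℝ) • z), gauge K y < 1 :=
        hK.continuous_gauge.continuousAt.eventually_lt_const (by rw [hg]; norm_num)
      filter_upwards [this] with y hy using hy.le
    · have hcont : ContinuousAt (radial K) ((1 / 2 : ℝ) • z) :=
        (hK.continuous_gauge.continuousAt.inv₀ (hK.gauge_pos.2 hzz).ne').smul continuousAt_id
      refine hcont.preimage_mem_nhds ?_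
      rw [radial_smul (by norm_num), radial_of_gauge_eq_one hx]
      exact Metric.ball_mem_nhds z hρ
  rcases h1 with h1 | h1
  · rw [finrank_euclideanSpace_fin] at h1
    exact NeZero.ne N (by exact_mod_cast h1)
  · exact (Measure.measure_pos_of_mem_nhds volume h2).ne' h1

/-- The normal is continuous along the boundary points at which the gauge is differentiable. -/
theorem exists_ball_gaugeNormal_sub_le {x : Eucl N}
    (hx : gauge (centered C x₀) (x - x₀) = 1)
    (hd : DifferentiableAt ℝ (gauge (centered C x₀)) (x - x₀)) {ε : ℝ} (hε : 0 < ε) :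
    ∃ ρ > 0, ∀ y ∈ Metric.ball x ρ, DifferentiableAt ℝ (gauge (centered C x₀)) (y - x₀) →
      ‖gaugeNormal C x₀ y - gaugeNormal C x₀ x‖ ≤ ε := by
  set K := centered C x₀ with hKdef
  have hK : IsBody K := isBody_centered hC hb hx₀
  set D : Set (Eucl N) := {z | DifferentiableAt ℝ (gauge K) z} with hD
  have h1 : ContinuousWithinAt (fderiv ℝ (gauge K)) D (x - x₀) := by
    rw [Metric.continuousWithinAt_iff]
    intro ε hε
    obtain ⟨ρ, hρ, h⟩ := exists_ball_norm_fderiv_sub_le hK.convexOn_gauge hd (half_pos hε)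
    refine ⟨ρ, hρ, fun {y} hy hyx => ?_⟩
    rw [dist_eq_norm]
    exact (h y hyx hy).trans_lt (half_lt_self hε)
  have hne := IsBody.fderiv_gauge_ne_zero hd (by rw [hx]; exact one_pos)
  have h2 : ContinuousWithinAt (unitNormal K) D (x - x₀) :=
    (h1.norm.inv₀ (norm_ne_zero_iff.2 hne)).smul
      ((InnerProductSpace.toDual ℝ (Eucl N)).symm.continuous.continuousAt.comp_continuousWithinAt h1)
  rw [Metric.continuousWithinAt_iff] at h2
  obtain ⟨ρ, hρ, h⟩ := h2 ε hε
  refine ⟨ρ, hρ, fun y hy hdy => ?_⟩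
  have := h hdy (by rw [dist_eq_norm, sub_sub_sub_cancel_right, ← dist_eq_norm]; exact hy)
  rw [dist_eq_norm] at this
  exact this.le

/-- At the boundary points where the gauge is differentiable, the averages of `∇χ_C` converge to
the inward normal. -/
theorem tendsto_gradQuotient {x : Eucl N} (hx : gauge (centered C x₀) (x - x₀) = 1)
    (hd : DifferentiableAt ℝ (gauge (centered C x₀)) (x - x₀)) :
    Tendsto (gradQuotient C x) (𝓝[>] 0) (𝓝 (-gaugeNormal C x₀ x)) := by
  have := isFiniteMeasure_surfaceMeasure hC hb hx₀
  rw [Metric.tendsto_nhds]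
  intro ε hε
  obtain ⟨ρ, hρ, h⟩ := exists_ball_gaugeNormal_sub_le hC hb hx₀ hx hd (half_pos hε)
  filter_upwards [Ioo_mem_nhdsGT hρ] with r hr
  set σ := surfaceMeasure C with hσ
  have hxC := (mem_frontier_iff_gauge hC hb hx₀).2 hx
  have hpos : 0 < σ.real (Metric.ball x r) :=
    ENNReal.toReal_pos (surfaceMeasure_ball_pos hC hb hx₀ hxC hr.1).ne' (measure_ne_top _ _)
  have hi := integrable_gaugeNormal hC hb hx₀
  have e1 : gradQuotient C x r =
      (σ.real (Metric.ball x r))⁻¹ • ∫ y in Metric.ball x r, -gaugeNormal C x₀ y ∂σ := by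
    rw [gradQuotient, gradIndicator_variation hC hb hx₀, gradIndicator_eq hC hb hx₀,
      withDensityᵥ_apply hi.neg measurableSet_ball]
    rfl
  have e2 : (-gaugeNormal C x₀ x) =
      (σ.real (Metric.ball x r))⁻¹ • ∫ y in Metric.ball x r, -gaugeNormal C x₀ x ∂σ := by
    rw [setIntegral_const, smul_smul, inv_mul_cancel₀ hpos.ne', one_smul]
  rw [dist_eq_norm, e1, e2]
  have hi' : Integrable (fun y => -gaugeNormal C x₀ y) (σ.restrict (Metric.ball x r)) :=
    hi.neg.integrableOn
  rw [← smul_sub, ← integral_sub hi' (integrable_const _), norm_smul, norm_inv,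
    Real.norm_of_nonneg hpos.le]
  have h1 : ‖∫ y in Metric.ball x r, (-gaugeNormal C x₀ y - -gaugeNormal C x₀ x) ∂σ‖ ≤
      ε / 2 * σ.real (Metric.ball x r) := by
    refine norm_setIntegral_le_of_norm_le_const_ae' (measure_lt_top _ _) ?_
    filter_upwards [ae_surfaceMeasure_regular hC hb hx₀] with y hy hyr
    rw [neg_sub_neg, norm_sub_rev]
    exact h y (Metric.ball_subset_ball hr.2.le hyr) hy.2
  calc _ ≤ (σ.real (Metric.ball x r))⁻¹ * (ε / 2 * σ.real (Metric.ball x r)) := by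
        gcongr
    _ = ε / 2 := by field_simp
    _ < ε := half_lt_self hε

theorem mem_reducedBoundary {x : Eucl N} (hx : gauge (centered C x₀) (x - x₀) = 1)
    (hd : DifferentiableAt ℝ (gauge (centered C x₀)) (x - x₀)) : x ∈ reducedBoundary C := by
  refine ⟨fun ρ hρ => ?_, _, norm_gaugeNormal hx hd, tendsto_gradQuotient hC hb hx₀ hx hd⟩
  rw [gradIndicator_variation hC hb hx₀]
  exact surfaceMeasure_ball_pos hC hb hx₀ ((mem_frontier_iff_gauge hC hb hx₀).2 hx) hρ

theorem outerNormal_eq {x : Eucl N} (hx : gauge (centered C x₀) (x - x₀) = 1)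
    (hd : DifferentiableAt ℝ (gauge (centered C x₀)) (x - x₀)) :
    outerNormal C x = gaugeNormal C x₀ x := by
  rw [outerNormal, if_pos (mem_reducedBoundary hC hb hx₀ hx hd),
    (tendsto_gradQuotient hC hb hx₀ hx hd).limUnder_eq, neg_neg]

end GradIndicator

end ShapePerimeter

/-! ### Positivity of the first variation -/

namespace ShapePerimeter

section Fields

variable {N : ℕ}

/-- A compactly supported `C¹` vector field, as an element of `Θ`. -/
def Theta.ofContDiff (f : Eucl N → Eucl N) (hf : ContDiff ℝ 1 f) (hc : HasCompactSupport f) :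
    Theta N :=
  (⟨f, hf, by
    obtain ⟨M, hM⟩ := hf.continuous.bounded_above_of_compact_support hc
    exact ⟨M, by rintro _ ⟨x, rfl⟩; exact hM x⟩, by
    obtain ⟨M, hM⟩ := (hf.continuous_fderiv one_ne_zero).bounded_above_of_compact_support
      (hc.fderiv (𝕜 := ℝ))
    exact ⟨M, by rintro _ ⟨x, rfl⟩; exact hM x⟩⟩ : thetaSubmodule N)

theorem Theta.ofContDiff_apply (f : Eucl N → Eucl N) (hf : ContDiff ℝ 1 f)
    (hc : HasCompactSupport f) (x : Eucl N) : Theta.ofContDiff f hf hc x = f x := rfl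

/-- A smooth cutoff function equal to `1` on a bounded set. -/
theorem exists_cutoff {C : Set (Eucl N)} (hb : Bornology.IsBounded C) :
    ∃ χ : Eucl N → ℝ, ContDiff ℝ 1 χ ∧ HasCompactSupport χ ∧ ∀ x ∈ C, χ x = 1 := by
  obtain ⟨R, hR, hC⟩ := hb.subset_closedBall_lt 0 0
  let χ : ContDiffBump (0 : Eucl N) := ⟨R, R + 1, hR, lt_add_one R⟩
  exact ⟨χ, χ.contDiff, χ.hasCompactSupport, fun x hx => χ.one_of_mem_closedBall (hC hx)⟩

end Fields

section Positivity

variable {N : ℕ} {C : Set (Eucl N)} (hC : Convex ℝ C) (hb : Bornology.IsBounded C)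
    {x₀ : Eucl N} (hx₀ : x₀ ∈ interior C)
include hC hb hx₀

/-- A convex set lies on one side of its tangent hyperplanes. -/
theorem inner_gaugeNormal_sub_nonpos {p : Eucl N} (hp : gauge (centered C x₀) (p - x₀) = 1)
    (hd : DifferentiableAt ℝ (gauge (centered C x₀)) (p - x₀)) {y : Eucl N} (hy : y ∈ closure C) :
    inner ℝ (gaugeNormal C x₀ p) (y - p) ≤ 0 := by
  have hK := isBody_centered hC hb hx₀
  have h1 : gauge (centered C x₀) (y - x₀) ≤ 1 := by
    rw [gauge_le_one_iff_mem_closure hK.convex hK.nhds]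
    have h2 : closure (centered C x₀) = (fun z => x₀ + z) ⁻¹' closure C :=
      ((Homeomorph.addLeft x₀).preimage_closure C).symm
    rw [h2, mem_preimage, add_sub_cancel]
    exact hy
  have h2 := IsBody.fderiv_gauge_le hK hd (y - x₀)
  have h3 := IsBody.fderiv_gauge_self hd
  have h4 : fderiv ℝ (gauge (centered C x₀)) (p - x₀) (y - p) ≤ 0 := by
    have e : y - p = (y - x₀) - (p - x₀) := by abel
    rw [e, map_sub, h3, hp]
    linarith
  rw [fderiv_gauge_apply_eq] at h4
  have hne := IsBody.fderiv_gauge_ne_zero hd (by rw [hp]; exact one_pos)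
  by_contra hcon
  push Not at hcon
  have := mul_pos (norm_pos_iff.2 hne) hcon
  exact absurd h4 (not_le.2 this)

/-- If the ball `B(x, r)` is contained in `C`, then every tangent hyperplane of `C` has distance at
least `r` from `x`. -/
theorem le_inner_gaugeNormal_sub {p : Eucl N} (hp : gauge (centered C x₀) (p - x₀) = 1)
    (hd : DifferentiableAt ℝ (gauge (centered C x₀)) (p - x₀)) {x : Eucl N} {r : ℝ} (hr : 0 ≤ r)
    (hx : Metric.closedBall x r ⊆ closure C) : r ≤ inner ℝ (gaugeNormal C x₀ p) (p - x) := by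
  have hn := norm_gaugeNormal hp hd
  have hmem : x + r • gaugeNormal C x₀ p ∈ closure C := by
    refine hx ?_
    rw [mem_closedBall_iff_norm, add_sub_cancel_left, norm_smul, hn, mul_one,
      Real.norm_of_nonneg hr]
  have h1 := inner_gaugeNormal_sub_nonpos hC hb hx₀ hp hd hmem
  have e : x + r • gaugeNormal C x₀ p - p = r • gaugeNormal C x₀ p - (p - x) := by abel
  rw [e, inner_sub_right, real_inner_smul_right, real_inner_self_eq_norm_sq, hn] at h1
  linarith

variable [NeZero N]

/-- Points of `∂C` with a property which holds almost everywhere are dense in `∂C`. -/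
theorem exists_mem_ball_of_ae {P : Eucl N → Prop} (hP : ∀ᵐ x ∂surfaceMeasure C, P x) {x : Eucl N}
    (hx : x ∈ frontier C) {ρ : ℝ} (hρ : 0 < ρ) : ∃ p ∈ Metric.ball x ρ, P p := by
  by_contra! hcon
  refine (surfaceMeasure_ball_pos hC hb hx₀ hx hρ).ne' (measure_mono_null (fun p hp => ?_)
    (ae_iff.1 hP))
  exact hcon p hp

/-- A field which points outwards along `∂C` enlarges `C`. The image `y ∈ C` of a point `w` outside
`C` would lie beyond the tangent hyperplane at a point `p` of `∂C` which separates `w` from the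
interior of `C`. -/
theorem eventually_closure_subset_image {ξ : Theta N} {δ : ℝ} (hδ : 0 < δ)
    (hξ : ∀ᵐ x ∂surfaceMeasure C, δ ≤ inner ℝ (ξ x) (gaugeNormal C x₀ x)) :
    ∀ᶠ t in 𝓝[>] (0 : ℝ), closure C ⊆ (fun x => x + (t • ξ) x) '' closure C := by
  set K := centered C x₀ with hKdef
  have hK : IsBody K := isBody_centered hC hb hx₀
  obtain ⟨r, hr, hrC⟩ := Metric.mem_nhds_iff.1 (mem_interior_iff_mem_nhds.1 hx₀)
  obtain ⟨D, hD, hCD⟩ := hb.closure.subset_closedBall_lt 0 x₀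
  have hlim : Tendsto (fun t : ℝ => t * (‖ξ‖ * (D + r))) (𝓝[>] 0) (𝓝 0) := by
    have : Continuous fun t : ℝ => t * (‖ξ‖ * (D + r)) := by fun_prop
    have h := this.tendsto 0
    rw [zero_mul] at h
    exact h.mono_left nhdsWithin_le_nhds
  have hlim2 : Tendsto (fun t : ℝ => t * ‖ξ‖) (𝓝[>] 0) (𝓝 0) := by
    have : Continuous fun t : ℝ => t * ‖ξ‖ := by fun_prop
    have h := this.tendsto 0
    rw [zero_mul] at h
    exact h.mono_left nhdsWithin_le_nhds
  filter_upwards [hlim.eventually_lt_const (show 0 < r / 4 by positivity),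
    hlim2.eventually_lt_const (show (0 : ℝ) < 1 / 2 by norm_num), self_mem_nhdsWithin]
    with t ht1 ht2 ht
  have ht0 : (0 : ℝ) < t := ht
  have hnorm : ‖t • ξ‖ ≤ 1 / 2 := by
    rw [norm_smul, Real.norm_of_nonneg ht0.le]; exact ht2.le
  obtain ⟨Ψ, -, h1, -⟩ := (t • ξ).exists_deformation hnorm 0
  have e : ∀ z, Ψ z = z + t • ξ z := fun z => by rw [h1, zero_add, Theta.smul_apply]
  intro y hy
  set w := Ψ.symm y with hw
  have hwy : w + t • ξ w = y := by rw [← e, hw, Ψ.apply_symm_apply]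
  refine ⟨w, ?_, by simpa [Theta.smul_apply] using hwy⟩
  by_contra hwC
  have hg : 1 < gauge K (w - x₀) := by
    by_contra hcon
    push Not at hcon
    rw [gauge_le_one_iff_mem_closure hK.convex hK.nhds] at hcon
    have h2 : closure K = (fun z => x₀ + z) ⁻¹' closure C :=
      ((Homeomorph.addLeft x₀).preimage_closure C).symm
    rw [h2, mem_preimage, add_sub_cancel] at hcon
    exact hwC hcon
  set s := (gauge K (w - x₀))⁻¹ with hs
  have hs0 : 0 < s := inv_pos.2 (by linarith)
  have hs1 : s < 1 := inv_lt_one_of_one_lt₀ hg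
  -- the point where the segment from `x₀` to `w` leaves `C`, and a nearby regular point `p`
  set p₀ := x₀ + s • (w - x₀) with hp₀
  have hp₀C : p₀ ∈ frontier C := by
    rw [mem_frontier_iff_gauge hC hb hx₀, hp₀, add_sub_cancel_left,
      gauge_smul_of_nonneg hs0.le, smul_eq_mul, hs, inv_mul_cancel₀ (by linarith)]
  obtain ⟨p, hpp, ⟨hpg, hpd⟩, hpξ⟩ := exists_mem_ball_of_ae hC hb hx₀
    ((ae_surfaceMeasure_regular hC hb hx₀).and hξ) hp₀C
    (show 0 < (1 - s) * (r / 2) by have : 0 < 1 - s := by linarith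
                                   positivity)
  have hs1' : 0 < 1 - s := by linarith
  -- the point `x₁` near `x₀` such that `p` lies on the segment from `x₁` to `w`
  set x₁ := w + (1 - s)⁻¹ • (p - w) with hx₁
  have hx₁x₀ : ‖x₁ - x₀‖ ≤ r / 2 := by
    have e1 : x₁ - x₀ = (1 - s)⁻¹ • (p - p₀) := by
      have : p - p₀ = (p - w) + (1 - s) • (w - x₀) := by rw [hp₀]; module
      rw [this, smul_add, smul_smul, inv_mul_cancel₀ hs1'.ne', one_smul, hx₁]
      abel
    rw [e1, norm_smul, norm_inv, Real.norm_of_nonneg hs1'.le, inv_mul_le_iff₀ hs1',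
      ← dist_eq_norm]
    exact (Metric.mem_ball.1 hpp).le
  have hball : Metric.closedBall x₁ (r / 4) ⊆ closure C := by
    refine Subset.trans (fun z hz => ?_) (hrC.trans subset_closure)
    rw [Metric.mem_ball, dist_eq_norm]
    rw [mem_closedBall_iff_norm] at hz
    calc ‖z - x₀‖ = ‖(z - x₁) + (x₁ - x₀)‖ := by congr 1; abel
      _ ≤ r / 4 + r / 2 := (norm_add_le _ _).trans (add_le_add hz hx₁x₀)
      _ < r := by linarith
  set μ : ℝ := (1 - s) / s with hμ
  have hμ0 : 0 < μ := div_pos hs1' hs0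
  have hwp : w - p = μ • (p - x₁) := by
    have e4 : p - w = (1 - s) • (x₁ - w) := by
      rw [hx₁, add_sub_cancel_left, smul_smul, mul_inv_cancel₀ hs1'.ne', one_smul]
    have e5 : w - p = (1 - s) • (w - x₁) := by
      rw [← neg_sub p w, e4, ← smul_neg, neg_sub]
    have e6 : p - x₁ = s • (w - x₁) := by
      have : p - x₁ = (w - x₁) - (w - p) := by abel
      rw [this, e5]; module
    rw [e5, e6, smul_smul, hμ, div_mul_cancel₀ _ hs0.ne']
  set n := gaugeNormal C x₀ p with hn
  have hn1 : ‖n‖ = 1 := norm_gaugeNormal hpg hpd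
  have hpC : p ∈ closure C := frontier_subset_closure ((mem_frontier_iff_gauge hC hb hx₀).2 hpg)
  have i1 := le_inner_gaugeNormal_sub hC hb hx₀ hpg hpd (by positivity : 0 ≤ r / 4) hball
  have i2 := inner_gaugeNormal_sub_nonpos hC hb hx₀ hpg hpd hy
  have i3 : ‖p - x₁‖ ≤ D + r := by
    have a1 : ‖p - x₀‖ ≤ D := mem_closedBall_iff_norm.1 (hCD hpC)
    calc ‖p - x₁‖ = ‖(p - x₀) - (x₁ - x₀)‖ := by congr 1; abel
      _ ≤ D + r / 2 := (norm_sub_le _ _).trans (add_le_add a1 hx₁x₀)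
      _ ≤ D + r := by linarith
  have i4 : ‖ξ w - ξ p‖ ≤ ‖ξ‖ * (μ * (D + r)) := by
    refine (ξ.norm_sub_le w p).trans ?_
    rw [hwp, norm_smul, Real.norm_of_nonneg hμ0.le]
    gcongr
  have i5 : -(‖ξ‖ * (μ * (D + r))) ≤ inner ℝ n (ξ w - ξ p) := by
    have := abs_le.1 (abs_real_inner_le_norm n (ξ w - ξ p))
    rw [hn1, one_mul] at this
    linarith [this.1]
  have e7 : inner ℝ n (y - p) =
      μ * inner ℝ n (p - x₁) + t * (inner ℝ (ξ p) n + inner ℝ n (ξ w - ξ p)) := by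
    have : y - p = μ • (p - x₁) + t • (ξ p + (ξ w - ξ p)) := by
      rw [← hwy, ← hwp, add_sub_cancel]; abel
    rw [this, inner_add_right, real_inner_smul_right, real_inner_smul_right, inner_add_right,
      real_inner_comm n (ξ p)]
  rw [← hn, e7] at i2
  -- as `t` is small, `⟨y - p, n⟩` is positive, which contradicts `y ∈ C`
  have j1 : μ * (r / 4) ≤ μ * inner ℝ n (p - x₁) := by gcongr
  have j2 : t * (δ + -(‖ξ‖ * (μ * (D + r)))) ≤
      t * (inner ℝ (ξ p) n + inner ℝ n (ξ w - ξ p)) := by gcongr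
  have j3 : μ * (t * (‖ξ‖ * (D + r))) ≤ μ * (r / 4) := by gcongr
  have j4 : 0 < t * δ := mul_pos ht0 hδ
  have j5 : t * (δ + -(‖ξ‖ * (μ * (D + r)))) = t * δ - μ * (t * (‖ξ‖ * (D + r))) := by ring
  linarith

/-- The first variation of the perimeter is nonnegative on the fields which point outwards, since
these enlarge `C`. -/
theorem fderiv_perimeterFunctional_nonneg {ξ : Theta N} {δ : ℝ} (hδ : 0 < δ)
    (hξ : ∀ᵐ x ∂surfaceMeasure C, δ ≤ inner ℝ (ξ x) (gaugeNormal C x₀ x)) :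
    0 ≤ fderiv ℝ (perimeterFunctional C) 0 ξ := by
  have := isFiniteMeasure_surfaceMeasure hC hb hx₀
  have h1 := (hasFDerivAt_perimeterFunctional hC hb hx₀).differentiableAt.hasFDerivAt
  have h2 : HasDerivAt (fun t : ℝ => perimeterFunctional C (0 + t • ξ))
      (fderiv ℝ (perimeterFunctional C) 0 ξ) 0 := h1.hasLineDerivAt ξ
  refine ge_of_tendsto h2.tendsto_slope_zero_right ?_
  have hlim2 : Tendsto (fun t : ℝ => t * ‖ξ‖) (𝓝[>] 0) (𝓝 0) := by
    have : Continuous fun t : ℝ => t * ‖ξ‖ := by fun_prop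
    have h := this.tendsto 0
    rw [zero_mul] at h
    exact h.mono_left nhdsWithin_le_nhds
  filter_upwards [eventually_closure_subset_image hC hb hx₀ hδ hξ, self_mem_nhdsWithin,
    hlim2.eventually_lt_const (show (0 : ℝ) < 1 / 2 by norm_num)] with t ht1 ht ht2
  have ht0 : (0 : ℝ) < t := ht
  have h3 := perimeterFunctional_zero_le hC hb hx₀ (θ := t • ξ)
    (by rw [norm_smul, Real.norm_of_nonneg ht0.le]; exact ht2.le) ht1
  rw [zero_add, zero_smul, zero_add, zero_add, smul_eq_mul]
  exact mul_nonneg (inv_nonneg.2 ht0.le) (sub_nonneg.2 h3)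

/-- The field `χ · (x - x₀)` is uniformly outward along `∂C`. -/
theorem exists_outward_field {χ : Eucl N → ℝ} (hχ : ContDiff ℝ 1 χ) (hχc : HasCompactSupport χ)
    (hχ1 : ∀ x ∈ closure C, χ x = 1) : ∃ X : Theta N, HasCompactSupport X ∧
      ∃ r > 0, ∀ᵐ x ∂surfaceMeasure C, r ≤ inner ℝ (X x) (gaugeNormal C x₀ x) := by
  have hf : ContDiff ℝ 1 fun x => χ x • (x - x₀) := hχ.smul (contDiff_id.sub contDiff_const)
  have hc : HasCompactSupport fun x => χ x • (x - x₀) := hχc.smul_right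
  obtain ⟨r, hr, hrC⟩ := Metric.mem_nhds_iff.1 (mem_interior_iff_mem_nhds.1 hx₀)
  refine ⟨Theta.ofContDiff _ hf hc, hc, r / 2, half_pos hr, ?_⟩
  filter_upwards [ae_surfaceMeasure_regular hC hb hx₀] with x hx
  have hxC : x ∈ closure C := frontier_subset_closure ((mem_frontier_iff_gauge hC hb hx₀).2 hx.1)
  rw [Theta.ofContDiff_apply, hχ1 x hxC, one_smul, real_inner_comm]
  refine le_inner_gaugeNormal_sub hC hb hx₀ hx.1 hx.2 (half_pos hr).le ?_
  exact (Metric.closedBall_subset_ball (half_lt_self hr)).trans (hrC.trans subset_closure)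

end Positivity

end ShapePerimeter

/-! ### Representation of functionals which are positive on outward fields -/

namespace ShapePerimeter

open scoped CompactlySupported

section Representation

/-- The cone of the nonnegative functions. -/
def nonnegCone (X : Type*) [TopologicalSpace X] : PointedCone ℝ C_c(X, ℝ) where
  carrier := {f | ∀ x, 0 ≤ f x}
  zero_mem' := fun _ => le_rfl
  add_mem' := by
    intro f g hf hg
    exact fun x => add_nonneg (hf x) (hg x)
  smul_mem' := by
    intro c f hf
    exact fun x => mul_nonneg c.2 (hf x)

theorem mem_nonnegCone {X : Type*} [TopologicalSpace X] {f : C_c(X, ℝ)} :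
    f ∈ nonnegCone X ↔ ∀ x, 0 ≤ f x := Iff.rfl

/-- A positive functional on a space of functions on a compact set which contains the constants is
given by a measure: it extends to all continuous functions by the M. Riesz extension theorem. -/
theorem exists_measure_of_nonneg {X W : Type*} [TopologicalSpace X] [CompactSpace X] [T2Space X]
    [MeasurableSpace X] [BorelSpace X] [AddCommGroup W] [Module ℝ W] (r : W →ₗ[ℝ] C_c(X, ℝ))
    (Λ : W →ₗ[ℝ] ℝ) (hΛ : ∀ w, (∀ x, 0 ≤ r w x) → 0 ≤ Λ w) {w₁ : W} (hw₁ : ∀ x, r w₁ x = 1) :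
    ∃ μ : Measure X, IsFiniteMeasure μ ∧ ∀ w, Λ w = ∫ x, r w x ∂μ := by
  -- positivity makes `Λ w` depend on `r w` only
  have hker : Λ ∈ (LinearMap.ker r).dualAnnihilator := by
    rw [Submodule.mem_dualAnnihilator]
    intro w hw
    rw [LinearMap.mem_ker] at hw
    have h1 := hΛ w fun x => by rw [hw]; exact le_rfl
    have h2 := hΛ (-w) fun x => by rw [map_neg, hw, neg_zero]; exact le_rfl
    rw [map_neg] at h2
    linarith
  rw [← LinearMap.range_dualMap_eq_dualAnnihilator_ker] at hker
  obtain ⟨φ, hφ⟩ := hker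
  have hφ' : ∀ w, φ (r w) = Λ w := fun w => DFunLike.congr_fun hφ w
  obtain ⟨g, hg, hgpos⟩ := riesz_extension (nonnegCone X)
    ⟨LinearMap.range r, φ.domRestrict (LinearMap.range r)⟩ (by
      rintro ⟨_, w, rfl⟩ hx
      rw [mem_nonnegCone] at hx
      change 0 ≤ φ (r w)
      rw [hφ']
      exact hΛ w hx) (by
      intro y
      obtain ⟨M, hM⟩ := (isCompact_univ (X := X)).exists_bound_of_continuousOn
        y.continuous.continuousOn
      refine ⟨⟨r (M • w₁), M • w₁, rfl⟩, mem_nonnegCone.2 fun x => ?_⟩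
      have h1 : -M ≤ y x := (abs_le.1 (hM x (mem_univ x))).1
      have h2 : r (M • w₁) x = M := by
        rw [map_smul]
        change M * r w₁ x = M
        rw [hw₁ x, mul_one]
      change (0 : ℝ) ≤ r (M • w₁) x + y x
      rw [h2]
      linarith)
  let Λ' : C_c(X, ℝ) →ₚ[ℝ] ℝ := PositiveLinearMap.mk₀ g fun f hf => hgpos f (mem_nonnegCone.2 hf)
  refine ⟨RealRMK.rieszMeasure Λ', ⟨?_⟩, fun w => ?_⟩
  · have hle := RealRMK.rieszMeasure_le_of_eq_one Λ' (f := r w₁)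
      (fun x => by rw [hw₁ x]; exact zero_le_one) isCompact_univ fun x _ => hw₁ x
    exact hle.trans_lt ENNReal.ofReal_lt_top
  · rw [RealRMK.integral_rieszMeasure]
    have := hg ⟨r w, w, rfl⟩
    rw [← hφ' w]
    exact this.symm

variable {N : ℕ}

/-- The `C¹` functions on `ℝ^N`. -/
def smoothFunctions (N : ℕ) : Submodule ℝ (Eucl N → ℝ) where
  carrier := {f | ContDiff ℝ 1 f}
  zero_mem' := by rw [mem_ofPred_eq]; exact contDiff_const
  add_mem' := by
    intro f g hf hg
    rw [mem_ofPred_eq] at hf hg ⊢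
    exact hf.add hg
  smul_mem' := by
    intro c f hf
    rw [mem_ofPred_eq] at hf ⊢
    exact contDiff_const.smul hf

theorem mem_smoothFunctions {f : Eucl N → ℝ} : f ∈ smoothFunctions N ↔ ContDiff ℝ 1 f := Iff.rfl

theorem smoothFunctions.contDiff (f : smoothFunctions N) : ContDiff ℝ 1 f.1 :=
  mem_smoothFunctions.1 f.2

theorem Theta.ext_apply {θ η : Theta N} (h : ∀ x, θ x = η x) : θ = η := Subtype.ext (funext h)

/-- The product of a `C¹` function and a compactly supported field. -/
def Theta.mulField (Y : Theta N) (hY : HasCompactSupport Y) : smoothFunctions N →ₗ[ℝ] Theta N where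
  toFun f := Theta.ofContDiff (fun x => f.1 x • Y x)
    ((smoothFunctions.contDiff f).smul Y.contDiff) (HasCompactSupport.smul_left (f := f.1) hY)
  map_add' f g := Theta.ext_apply fun x => by
    rw [Theta.add_apply, Theta.ofContDiff_apply, Theta.ofContDiff_apply, Theta.ofContDiff_apply,
      ← add_smul]
    rfl
  map_smul' c f := Theta.ext_apply fun x => by
    rw [Theta.smul_apply, Theta.ofContDiff_apply, Theta.ofContDiff_apply, smul_smul]
    rfl

theorem Theta.mulField_apply (Y : Theta N) (hY : HasCompactSupport Y) (f : smoothFunctions N)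
    (x : Eucl N) : Y.mulField hY f x = f.1 x • Y x := rfl

/-- Restriction of a `C¹` function to a compact set. -/
def restrictCompact (S : Set (Eucl N)) [CompactSpace S] : smoothFunctions N →ₗ[ℝ] C_c(S, ℝ) where
  toFun f := ⟨⟨fun x => f.1 x, (smoothFunctions.contDiff f).continuous.comp continuous_subtype_val⟩,
    HasCompactSupport.of_compactSpace _⟩
  map_add' _ _ := rfl
  map_smul' _ _ := rfl

variable {σ : Measure (Eucl N)} {ν : Eucl N → Eucl N} {S : Set (Eucl N)} {L : Theta N →L[ℝ] ℝ}

/-- A functional which is nonnegative on outward fields is controlled by the normal component: it is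
nonnegative on `(m / r) • X ± ξ` up to an arbitrarily small multiple of `X`. -/
theorem abs_le_of_nonneg_of_outward
    (hpos : ∀ (δ : ℝ), 0 < δ → ∀ ξ : Theta N, (∀ᵐ x ∂σ, δ ≤ inner ℝ (ξ x) (ν x)) → 0 ≤ L ξ)
    {X : Theta N} {r : ℝ} (hr : 0 < r) (hX : ∀ᵐ x ∂σ, r ≤ inner ℝ (X x) (ν x)) {ξ : Theta N} {m : ℝ}
    (hm : 0 ≤ m) (hξ : ∀ᵐ x ∂σ, |inner ℝ (ξ x) (ν x)| ≤ m) : |L ξ| ≤ m * (L X / r) := by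
  have hX0 := hpos r hr X hX
  have key : ∀ η : Theta N, (∀ᵐ x ∂σ, |inner ℝ (η x) (ν x)| ≤ m) → L η ≤ m * (L X / r) := by
    intro η hη
    refine le_of_forall_pos_le_add fun ε hε => ?_
    set e := ε / (L X / r + 1) with he
    have hden : 0 < L X / r + 1 := by positivity
    have he0 : 0 < e := div_pos hε hden
    have h1 := hpos e he0 (((m + e) / r) • X - η) (by
      filter_upwards [hX, hη] with x h1 h2
      have e1 : (((m + e) / r) • X - η : Theta N) x = ((m + e) / r) • X x - η x := by
        rw [sub_eq_add_neg, Theta.add_apply, Theta.smul_apply, sub_eq_add_neg]; rfl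
      rw [e1, inner_sub_left, real_inner_smul_left]
      have h3 : (m + e) / r * r ≤ (m + e) / r * inner ℝ (X x) (ν x) := by gcongr
      rw [div_mul_cancel₀ _ hr.ne'] at h3
      linarith [(abs_le.1 h2).2])
    rw [map_sub, map_smul, smul_eq_mul] at h1
    have h2 : e * (L X / r + 1) = ε := div_mul_cancel₀ _ hden.ne'
    have h3 : (m + e) / r * L X = m * (L X / r) + e * (L X / r) := by ring
    nlinarith
  refine abs_le.2 ⟨?_, key ξ hξ⟩
  have h1 := key (-ξ) (by
    filter_upwards [hξ] with x hx
    have e1 : (-ξ : Theta N) x = -ξ x := rfl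
    rw [e1, inner_neg_left, abs_neg]
    exact hx)
  rw [map_neg] at h1
  linarith

theorem eq_of_ae_inner_eq
    (hpos : ∀ (δ : ℝ), 0 < δ → ∀ ξ : Theta N, (∀ᵐ x ∂σ, δ ≤ inner ℝ (ξ x) (ν x)) → 0 ≤ L ξ)
    {X : Theta N} {r : ℝ} (hr : 0 < r) (hX : ∀ᵐ x ∂σ, r ≤ inner ℝ (X x) (ν x)) {ξ η : Theta N}
    (h : ∀ᵐ x ∂σ, ξ x = η x) : L ξ = L η := by
  have h1 := abs_le_of_nonneg_of_outward hpos hr hX le_rfl (ξ := ξ - η) (by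
    filter_upwards [h] with x hx
    have e1 : (ξ - η : Theta N) x = ξ x - η x := by
      rw [sub_eq_add_neg, Theta.add_apply, sub_eq_add_neg]; rfl
    rw [e1, hx, sub_self, inner_zero_left, abs_zero])
  rw [zero_mul, map_sub] at h1
  exact sub_eq_zero.1 (abs_eq_zero.1 (le_antisymm h1 (abs_nonneg _)))

/-- If `Y` points outwards then `f ↦ L (f Y)` is positive, hence a measure. -/
theorem exists_measure_mulField (hS : IsCompact S) (hσS : ∀ᵐ x ∂σ, x ∈ S)
    (hpos : ∀ (δ : ℝ), 0 < δ → ∀ ξ : Theta N, (∀ᵐ x ∂σ, δ ≤ inner ℝ (ξ x) (ν x)) → 0 ≤ L ξ)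
    {Y : Theta N} (hYc : HasCompactSupport Y) {r : ℝ} (hr : 0 < r)
    (hY : ∀ᵐ x ∂σ, r ≤ inner ℝ (Y x) (ν x)) :
    ∃ μ : Measure (Eucl N), IsFiniteMeasure μ ∧ μ Sᶜ = 0 ∧
      ∀ f : smoothFunctions N, L (Y.mulField hYc f) = ∫ x, f.1 x ∂μ := by
  have : CompactSpace S := isCompact_iff_compactSpace.1 hS
  have hY0 := hpos r hr Y hY
  obtain ⟨μ, hμ, h⟩ := exists_measure_of_nonneg (restrictCompact S)
    ((L : Theta N →ₗ[ℝ] ℝ).comp (Y.mulField hYc)) (fun f hf => by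
      refine le_of_forall_pos_le_add fun ε hε => ?_
      set e := ε / (L Y + 1) with he
      have he0 : 0 < e := by positivity
      have h1 := hpos (e * r) (mul_pos he0 hr) (Y.mulField hYc f + e • Y) (by
        filter_upwards [hY, hσS] with x h1 h2
        have h3 : 0 ≤ f.1 x := hf ⟨x, h2⟩
        rw [Theta.add_apply, Theta.smul_apply, Theta.mulField_apply, inner_add_left,
          real_inner_smul_left, real_inner_smul_left]
        have h4 : 0 ≤ f.1 x * inner ℝ (Y x) (ν x) := mul_nonneg h3 (hr.le.trans h1)
        have h5 : e * r ≤ e * inner ℝ (Y x) (ν x) := by gcongr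
        linarith)
      rw [map_add, map_smul, smul_eq_mul] at h1
      have h2 : e * (L Y + 1) = ε := div_mul_cancel₀ _ (by positivity)
      change 0 ≤ L (Y.mulField hYc f) + ε
      nlinarith) (w₁ := ⟨fun _ => 1, mem_smoothFunctions.2 contDiff_const⟩) (fun x => rfl)
  have hemb : MeasurableEmbedding (Subtype.val : S → Eucl N) :=
    MeasurableEmbedding.subtype_coe hS.measurableSet
  refine ⟨μ.map Subtype.val, inferInstance, ?_, fun f => ?_⟩
  · rw [hemb.map_apply]
    convert measure_empty (μ := μ)
    ext x
    simp
  · rw [hemb.integral_map]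
    exact h f

/-- A functional which is nonnegative on outward fields is a vector measure. Each constant field
`e i` is the difference of the outward fields `c • X + e i` and `c • X`, so that
`ξ = ∑ i, (ξ i • (c • X + e i) - ξ i • c • X)` on `S`, and each term is given by a measure. -/
theorem exists_vectorMeasure (hS : IsCompact S) (hσS : ∀ᵐ x ∂σ, x ∈ S) (hν : ∀ x, ‖ν x‖ ≤ 1)
    (hpos : ∀ (δ : ℝ), 0 < δ → ∀ ξ : Theta N, (∀ᵐ x ∂σ, δ ≤ inner ℝ (ξ x) (ν x)) → 0 ≤ L ξ)
    {X : Theta N} (hXc : HasCompactSupport X) {r : ℝ} (hr : 0 < r)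
    (hX : ∀ᵐ x ∂σ, r ≤ inner ℝ (X x) (ν x)) :
    ∃ H : VectorMeasure (Eucl N) (Eucl N), H.variation univ < ∞ ∧ H.variation Sᶜ = 0 ∧
      ∀ ξ : Theta N, L ξ = (H.restrict S).integral ξ (innerSL ℝ) := by
  obtain ⟨χ, hχ, hχc, hχ1⟩ := exists_cutoff hS.isBounded
  set c : ℝ := 2 / r with hc
  have hc0 : 0 < c := div_pos two_pos hr
  -- `e i` is a compactly supported field which is constant on `S`
  let e : Fin N → Theta N := fun i => Theta.ofContDiff
    (fun x => χ x • (EuclideanSpace.single i (1 : ℝ) : Eucl N)) (hχ.smul contDiff_const)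
    hχc.smul_right
  have he : ∀ i x, e i x = χ x • EuclideanSpace.single i (1 : ℝ) := fun i x => rfl
  have hec : ∀ i, HasCompactSupport (e i) := fun i => hχc.smul_right
  -- by the choice of `c`, these fields point outwards with margin `1`
  let Y : Fin N → Theta N := fun i => c • X + e i
  have hYx : ∀ i x, Y i x = c • X x + e i x := fun i x => rfl
  have hYc : ∀ i, HasCompactSupport (Y i) := fun i =>
    HasCompactSupport.add (HasCompactSupport.smul_left (f := fun _ => c) hXc) (hec i)
  have hY : ∀ i, ∀ᵐ x ∂σ, 1 ≤ inner ℝ (Y i x) (ν x) := fun i => by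
    filter_upwards [hX, hσS] with x h1 h2
    rw [hYx, he, hχ1 x h2, one_smul, inner_add_left, real_inner_smul_left]
    have h3 := abs_le.1 (abs_real_inner_le_norm (EuclideanSpace.single i (1 : ℝ) : Eucl N) (ν x))
    have h4 : ‖(EuclideanSpace.single i (1 : ℝ) : Eucl N)‖ * ‖ν x‖ ≤ 1 := by
      rw [PiLp.norm_single, norm_one, one_mul]; exact hν x
    have h5 : c * r ≤ c * inner ℝ (X x) (ν x) := by gcongr
    rw [hc, div_mul_cancel₀ _ hr.ne'] at h5
    linarith
  obtain ⟨μ₀, hμ₀, hμ₀S, h₀⟩ := exists_measure_mulField hS hσS hpos hXc hr hX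
  choose μ hμ hμS hμL using fun i => exists_measure_mulField hS hσS hpos (hYc i) one_pos (hY i)
  -- all measures have densities with respect to their sum
  set m : Measure (Eucl N) := μ₀ + ∑ i, μ i with hm
  have hmfin : IsFiniteMeasure m := inferInstance
  have hmS : m Sᶜ = 0 := by
    rw [hm, Measure.add_apply, hμ₀S, Measure.finsetSum_apply, zero_add]
    exact Finset.sum_eq_zero fun i _ => hμS i
  have hd₀ : μ₀.HaveLebesgueDecomposition m :=
    Measure.haveLebesgueDecomposition_of_sigmaFinite μ₀ m
  have hd : ∀ i, (μ i).HaveLebesgueDecomposition m := fun i =>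
    Measure.haveLebesgueDecomposition_of_sigmaFinite (μ i) m
  have hac₀ : μ₀ ≪ m := Measure.absolutelyContinuous_of_le (Measure.le_add_right le_rfl)
  have hac : ∀ i, μ i ≪ m := fun i => by
    refine Measure.absolutelyContinuous_of_le (Measure.le_add_left ?_)
    rw [Measure.le_iff]
    intro s _
    rw [Measure.finsetSum_apply]
    exact Finset.single_le_sum (f := fun i => μ i s) (fun _ _ => zero_le) (Finset.mem_univ i)
  let ρ : Fin N → Eucl N → ℝ := fun i x =>
    ((μ i).rnDeriv m x).toReal - c * (μ₀.rnDeriv m x).toReal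
  have hρi : ∀ i, Integrable (ρ i) m := fun i =>
    Measure.integrable_toReal_rnDeriv.sub (Measure.integrable_toReal_rnDeriv.const_mul c)
  let h : Eucl N → Eucl N := fun x => ∑ i, ρ i x • EuclideanSpace.single i (1 : ℝ)
  have hhi : Integrable h m := integrable_finsetSum _ fun i _ => (hρi i).smul_const _
  have hvar : (m.withDensityᵥ h).variation = m.withDensity fun x => ‖h x‖ₑ :=
    Measure.variation_withDensityᵥ hhi
  refine ⟨m.withDensityᵥ h, ?_, ?_, fun ξ => ?_⟩
  · rw [hvar, withDensity_apply _ MeasurableSet.univ, Measure.restrict_univ]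
    exact hhi.2
  · rw [hvar]
    exact withDensity_absolutelyContinuous _ _ hmS
  · have hξc : Continuous (ξ : Eucl N → Eucl N) := ξ.contDiff.continuous
    have hbd : ∀ x, ‖S.indicator ξ x‖ ≤ ‖ξ‖ := fun x =>
      (norm_indicator_le_norm_self _ _).trans (ξ.norm_apply_le x)
    rw [← VectorMeasure.integral_indicator hS.measurableSet, integral_withDensityᵥ hhi (innerSL ℝ)
      (hξc.stronglyMeasurable.indicator hS.measurableSet) hbd]
    let f : Fin N → smoothFunctions N := fun i =>
      ⟨fun x => ξ x i, mem_smoothFunctions.2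
        ((EuclideanSpace.proj i : Eucl N →L[ℝ] ℝ).contDiff.comp ξ.contDiff)⟩
    have hf : ∀ i x, (f i).1 x = ξ x i := fun i x => rfl
    have hfb : ∀ i x, ‖(f i).1 x‖ ≤ ‖ξ‖ := fun i x =>
      (PiLp.norm_apply_le (ξ x) i).trans (ξ.norm_apply_le x)
    have hfm : ∀ i, AEStronglyMeasurable (f i).1 m := fun i =>
      (smoothFunctions.contDiff (f i)).continuous.aestronglyMeasurable
    -- the two fields agree on `S`
    have e1 : L ξ = L (∑ i, ((Y i).mulField (hYc i) (f i) - c • X.mulField hXc (f i))) := by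
      refine eq_of_ae_inner_eq hpos hr hX ?_
      filter_upwards [hσS] with x hx
      have e2 : ∀ s : Finset (Fin N),
          (∑ i ∈ s, ((Y i).mulField (hYc i) (f i) - c • X.mulField hXc (f i)) : Theta N) x =
          ∑ i ∈ s, ξ x i • (EuclideanSpace.single i (1 : ℝ) : Eucl N) := by
        intro s
        induction s using Finset.induction_on with
        | empty => simp only [Finset.sum_empty]; rfl
        | insert i s his ih =>
          rw [Finset.sum_insert his, Finset.sum_insert his, Theta.add_apply, ih]
          congr 1
          have e3 : ((Y i).mulField (hYc i) (f i) - c • X.mulField hXc (f i) : Theta N) x =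
              (Y i).mulField (hYc i) (f i) x - c • X.mulField hXc (f i) x := by
            rw [sub_eq_add_neg, Theta.add_apply, sub_eq_add_neg]; rfl
          rw [e3, Theta.mulField_apply, Theta.mulField_apply, hYx, he, hχ1 x hx, hf]
          module
      rw [e2]
      ext j
      simp [Pi.single_apply]
    have e4 : ∀ i, ∫ x, (f i).1 x ∂μ i = ∫ x, ((μ i).rnDeriv m x).toReal * (f i).1 x ∂m :=
      fun i => (integral_rnDeriv_smul (hac i)).symm
    have e5 : ∀ i, ∫ x, (f i).1 x ∂μ₀ = ∫ x, (μ₀.rnDeriv m x).toReal * (f i).1 x ∂m :=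
      fun i => (integral_rnDeriv_smul hac₀).symm
    have i1 : ∀ i, Integrable (fun x => ((μ i).rnDeriv m x).toReal * (f i).1 x) m := fun i =>
      Measure.integrable_toReal_rnDeriv.mul_bdd (c := ‖ξ‖) (hfm i) (Eventually.of_forall (hfb i))
    have i2 : ∀ i, Integrable (fun x => (μ₀.rnDeriv m x).toReal * (f i).1 x) m := fun i =>
      Measure.integrable_toReal_rnDeriv.mul_bdd (c := ‖ξ‖) (hfm i) (Eventually.of_forall (hfb i))
    rw [e1, map_sum]
    have e6 : ∀ i, L ((Y i).mulField (hYc i) (f i) - c • X.mulField hXc (f i)) =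
        ∫ x, ρ i x * (f i).1 x ∂m := by
      intro i
      rw [map_sub, map_smul, hμL, h₀, e4, e5, smul_eq_mul, ← integral_const_mul,
        ← integral_sub (i1 i) ((i2 i).const_mul c)]
      refine integral_congr_ae (Eventually.of_forall fun x => ?_)
      simp only [ρ]
      ring
    simp_rw [e6]
    rw [← integral_finsetSum _ fun i _ => (hρi i).mul_bdd (c := ‖ξ‖) (hfm i) (Eventually.of_forall (hfb i))]
    refine integral_congr_ae ?_
    filter_upwards [compl_mem_ae_iff.2 hmS] with x hx
    rw [compl_compl] at hx
    rw [indicator_of_mem hx]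
    change _ = inner ℝ (ξ x) (h x)
    simp only [h, inner_sum, real_inner_smul_right]
    refine Finset.sum_congr rfl fun i _ => ?_
    rw [hf, real_inner_comm, EuclideanSpace.inner_single_left]
    simp

end Representation

end ShapePerimeter

/-! ### Sets without interior, and conclusion -/

namespace ShapePerimeter

section Degenerate

variable {N : ℕ} {C : Set (Eucl N)}

theorem perimeter_eq_zero_of_volume {E : Set (Eucl N)} (hE : volume E = 0) : perimeter E = 0 := by
  simp [perimeter, Measure.restrict_eq_zero.2 hE]

theorem perimeter_eq_zero_of_dim [IsEmpty (Fin N)] (E : Set (Eucl N)) : perimeter E = 0 := by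
  simp [perimeter, divergence]

theorem volume_deform_eq_zero (hC : volume C = 0) (θ : Theta N) : volume (deform C θ) = 0 :=
  addHaar_image_eq_zero_of_differentiableOn_of_addHaar_eq_zero volume
    (fun x _ => (differentiableAt_id.add (θ.differentiableAt x)).differentiableWithinAt) hC

/-- A convex set without interior lies in a hyperplane. -/
theorem volume_eq_zero_of_interior_eq_empty (hC : Convex ℝ C) (hi : ¬(interior C).Nonempty) :
    volume C = 0 := by
  rw [hC.interior_nonempty_iff_affineSpan_eq_top] at hi
  exact measure_mono_null (subset_affineSpan ℝ C) (Measure.addHaar_affineSubspace volume _ hi)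

end Degenerate

section Nondegenerate

variable {N : ℕ} [NeZero N] {C : Set (Eucl N)} (hC : Convex ℝ C) (hb : Bornology.IsBounded C)
  {x₀ : Eucl N} (hx₀ : x₀ ∈ interior C)

include hC hb hx₀

theorem ae_outerNormal_eq : ∀ᵐ x ∂surfaceMeasure C, outerNormal C x = gaugeNormal C x₀ x := by
  filter_upwards [ae_surfaceMeasure_regular hC hb hx₀] with x hx
  exact outerNormal_eq hC hb hx₀ hx.1 hx.2

theorem tangentialDivergence_ae_eq (ξ : Eucl N → Eucl N) :
    tangentialDivergence C ξ =ᵐ[surfaceMeasure C] divergenceAlong (gaugeNormal C x₀) ξ := by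
  filter_upwards [ae_outerNormal_eq hC hb hx₀] with x hx
  rw [tangentialDivergence, divergenceAlong, hx]

theorem integrable_tangentialDivergence (ξ : Theta N) :
    Integrable (tangentialDivergence C ξ) (surfaceMeasure C) := by
  have := isFiniteMeasure_surfaceMeasure hC hb hx₀
  exact (integrable_divergenceAlong (measurable_gaugeNormal C x₀) (norm_gaugeNormal_le C x₀)
    ξ).congr (tangentialDivergence_ae_eq hC hb hx₀ ξ).symm

theorem fderiv_perimeterFunctional_eq_integral (ξ : Theta N) :
    fderiv ℝ (perimeterFunctional C) 0 ξ = ∫ x, tangentialDivergence C ξ x ∂surfaceMeasure C := by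
  have := isFiniteMeasure_surfaceMeasure hC hb hx₀
  rw [(hasFDerivAt_perimeterFunctional hC hb hx₀).fderiv, firstVariation_apply]
  exact integral_congr_ae (tangentialDivergence_ae_eq hC hb hx₀ ξ).symm

theorem abs_inner_outerNormal_ae_le (ξ : Theta N) : ∀ᵐ x ∂surfaceMeasure C,
    |inner ℝ (ξ x) (gaugeNormal C x₀ x)| ≤
      (eLpNorm (fun x => inner ℝ (ξ x) (outerNormal C x)) ∞ (surfaceMeasure C)).toReal := by
  have hν := ae_outerNormal_eq hC hb hx₀
  have hfin : eLpNormEssSup (fun x => inner ℝ (ξ x) (outerNormal C x)) (surfaceMeasure C) < ∞ := by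
    refine eLpNormEssSup_lt_top_of_ae_bound (C := ‖ξ‖) ?_
    filter_upwards [hν] with x hx
    rw [hx]
    refine (norm_inner_le_norm _ _).trans ?_
    calc ‖ξ x‖ * ‖gaugeNormal C x₀ x‖ ≤ ‖ξ‖ * 1 := by
          gcongr
          · exact ξ.norm_apply_le x
          · exact norm_gaugeNormal_le C x₀ x
      _ = ‖ξ‖ := mul_one _
  rw [eLpNorm_exponent_top]
  filter_upwards [hν, enorm_ae_le_eLpNormEssSup
    (fun x => inner ℝ (ξ x) (outerNormal C x)) (surfaceMeasure C)] with x hx h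
  rw [hx, ← ofReal_norm] at h
  exact (ENNReal.ofReal_le_iff_le_toReal hfin.ne).1 h

theorem exists_outward_field_of_isBounded : ∃ X : Theta N, HasCompactSupport X ∧
    ∃ r > 0, ∀ᵐ x ∂surfaceMeasure C, r ≤ inner ℝ (X x) (gaugeNormal C x₀ x) := by
  obtain ⟨χ, hχ, hχc, hχ1⟩ := exists_cutoff hb.closure
  exact exists_outward_field hC hb hx₀ hχ hχc hχ1

/-- The first variation of the perimeter is bounded by the `L^∞` norm of the normal component. -/
theorem exists_abs_fderiv_perimeterFunctional_le : ∃ k : ℝ, 0 < k ∧ ∀ ξ : Theta N,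
    |fderiv ℝ (perimeterFunctional C) 0 ξ| ≤
      k * (eLpNorm (fun x => inner ℝ (ξ x) (outerNormal C x)) ∞ (surfaceMeasure C)).toReal := by
  obtain ⟨X, -, r, hr, hX⟩ := exists_outward_field_of_isBounded hC hb hx₀
  have hX0 := fderiv_perimeterFunctional_nonneg hC hb hx₀ hr hX
  refine ⟨fderiv ℝ (perimeterFunctional C) 0 X / r + 1, by positivity, fun ξ => ?_⟩
  refine (abs_le_of_nonneg_of_outward
    (fun δ hδ ξ hξ => fderiv_perimeterFunctional_nonneg hC hb hx₀ hδ hξ) hr hX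
    ENNReal.toReal_nonneg (abs_inner_outerNormal_ae_le hC hb hx₀ ξ)).trans ?_
  rw [mul_comm]
  exact mul_le_mul_of_nonneg_right (le_add_of_nonneg_right zero_le_one) ENNReal.toReal_nonneg

/-- The first variation of the perimeter is a vector measure carried by `∂C`. -/
theorem exists_curvatureMeasure : ∃ H : VectorMeasure (Eucl N) (Eucl N),
    H.variation univ < ∞ ∧ H.variation (frontier C)ᶜ = 0 ∧ ∀ ξ : Theta N,
      fderiv ℝ (perimeterFunctional C) 0 ξ =
        (H.restrict (frontier C)).integral ξ (innerSL ℝ) := by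
  obtain ⟨X, hXc, r, hr, hX⟩ := exists_outward_field_of_isBounded hC hb hx₀
  have hS : IsCompact (frontier C) :=
    Metric.isCompact_of_isClosed_isBounded isClosed_frontier
      (hb.closure.subset frontier_subset_closure)
  exact exists_vectorMeasure hS (ae_restrict_mem isClosed_frontier.measurableSet)
    (norm_gaugeNormal_le C x₀)
    (fun δ hδ ξ hξ => fderiv_perimeterFunctional_nonneg hC hb hx₀ hδ hξ) hXc hr hX

end Nondegenerate

end ShapePerimeter

open ShapePerimeter in
theorem theorem2 (N : ℕ) (C : Set (Eucl N)) (hC : Convex ℝ C) (hb : Bornology.IsBounded C) :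
    -- the perimeter of `(Id + θ)(C)` is finite for small `θ`, and differentiable at `θ = 0`
    (∀ᶠ θ : Theta N in 𝓝 0, perimeter (deform C θ) < ∞) ∧
    DifferentiableAt ℝ (perimeterFunctional C) 0 ∧
    -- the `L^∞` estimate of the shape derivative
    (∃ k : ℝ, 0 < k ∧ ∀ ξ : Theta N,
      |fderiv ℝ (perimeterFunctional C) 0 ξ| ≤
        k * (eLpNorm (fun x => inner ℝ (ξ x) (outerNormal C x)) ∞ (surfaceMeasure C)).toReal) ∧
    -- the shape derivative is the integral of the tangential divergence over `∂C`, almost every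
    -- point of which has a normal (provided that `C` is not flat)
    ((interior C).Nonempty →
      (∀ᵐ x ∂(surfaceMeasure C), x ∈ reducedBoundary C) ∧
      ∀ ξ : Theta N,
        Integrable (tangentialDivergence C ξ) (surfaceMeasure C) ∧
        fderiv ℝ (perimeterFunctional C) 0 ξ =
          ∫ x, tangentialDivergence C ξ x ∂(surfaceMeasure C)) ∧
    -- the mean curvature measure
    (∃ H : VectorMeasure (Eucl N) (Eucl N),
      H.variation univ < ∞ ∧ H.variation (frontier C)ᶜ = 0 ∧
      ∀ ξ : Theta N,
        fderiv ℝ (perimeterFunctional C) 0 ξ =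
          (H.restrict (frontier C)).integral ξ (innerSL ℝ)) := by
  rcases (interior C).eq_empty_or_nonempty.symm with ⟨x₀, hx₀⟩ | hi
  · rcases eq_or_ne N 0 with rfl | hN
    · -- in dimension `0` there is no boundary
      have hS : surfaceMeasure C = 0 := by
        rw [surfaceMeasure, Measure.restrict_eq_zero, (isClopen_discrete C).frontier_eq]
        exact measure_empty
      have h0 : perimeterFunctional C = fun _ => 0 := by
        funext θ
        rw [perimeterFunctional, perimeter_eq_zero_of_dim, ENNReal.toReal_zero]
      rw [h0, hS]
      refine ⟨Eventually.of_forall fun θ => ?_, differentiableAt_const _, ⟨1, one_pos, ?_⟩,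
        fun _ => ⟨ae_zero.symm ▸ eventually_bot, ?_⟩, 0, ?_⟩
      · rw [perimeter_eq_zero_of_dim]
        exact ENNReal.zero_lt_top
      · simp
      · simp
      · simp [VectorMeasure.variation_zero,
          VectorMeasure.integral_zero_vectorMeasure]
    · have : NeZero N := ⟨hN⟩
      have := isFiniteMeasure_surfaceMeasure hC hb hx₀
      refine ⟨eventually_perimeter_lt_top hC hb hx₀,
        (hasFDerivAt_perimeterFunctional hC hb hx₀).differentiableAt,
        exists_abs_fderiv_perimeterFunctional_le hC hb hx₀, fun _ => ⟨?_, fun ξ =>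
          ⟨integrable_tangentialDivergence hC hb hx₀ ξ,
            fderiv_perimeterFunctional_eq_integral hC hb hx₀ ξ⟩⟩,
        exists_curvatureMeasure hC hb hx₀⟩
      filter_upwards [ae_surfaceMeasure_regular hC hb hx₀] with x hx
      exact mem_reducedBoundary hC hb hx₀ hx.1 hx.2
  · -- a flat set stays negligible under every deformation
    have hi' : ¬(interior C).Nonempty := not_nonempty_iff_eq_empty.2 hi
    have hP : ∀ θ : Theta N, perimeter (deform C θ) = 0 := fun θ =>
      perimeter_eq_zero_of_volume
        (volume_deform_eq_zero (volume_eq_zero_of_interior_eq_empty hC hi') θ)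
    have h0 : perimeterFunctional C = fun _ => 0 := by
      funext θ
      rw [perimeterFunctional, hP, ENNReal.toReal_zero]
    rw [h0]
    refine ⟨Eventually.of_forall fun θ => ?_, differentiableAt_const _, ⟨1, one_pos, ?_⟩,
      fun h => absurd h hi', 0, ?_⟩
    · rw [hP]
      exact ENNReal.zero_lt_top
    · simp
    · simp [VectorMeasure.variation_zero,
        VectorMeasure.integral_zero_vectorMeasure]
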